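/- Write $D_r=\{z\in\mathbb C:|z|<r\}$ and $e(\varphi)=e^{2\pi i\varphi}$. For $1<R_2<R_1<R$ put $$B_0=\frac{1}{2\log(R/R_1)}\cdot\frac{R_1+R_2}{R_1-R_2}\cdot\begin{cases}\log R & \text{if } R^2-R_1^2>R,\\ \log\frac{R^2}{R^2-R_1^2} & \text{if } R^2-R_1^2\le R,\end{cases}\qquad B_1=B_0\,\frac{8R_2}{R_2^2-1},$$ $$B_2=B_0\,\frac{16\pi(R_2^2-1)\sqrt{16R_2^2-\bigl(\sqrt{R_2^4+34R_2^2+1}-1-R_2^2\bigr)^2}}{\bigl(3R_2^2+3-\sqrt{R_2^4+34R_2^2+1}\bigr)^2}.$$ **Theorem (effective Riesz representation).** Let $1<R_2<R_1<R$ and $B,m\in\mathbb R$. Let $v:\overline{D_R}\to\mathbb R\cup\{-\infty\}$ be subharmonic, that is, upper semicontinuous and with $v(z)\le\int_0^1 v(z+re(\theta))\,d\theta$ for every closed disk $\{|\zeta-z|\le r\}\subset\overline{D_R}$, $r>0$. Assume that $v\le B$ on $\overline{D_R}$ and $v(0)=m$. Then there are a positive Borel measure $\mu$ and a function $h$ such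 that for all $w\in D_{R_1}$ $$v(w)=\int_{D_{R_1}}\log|z-w|\,\mu(dz)+h(w)$$ (with $\log 0=-\infty$, both sides being allowed to equal $-\infty$), where 1. $\displaystyle \mu(D_{R_1})\le\frac{B-m}{\log(R/R_1)}$; 2. $h$ is real-valued and harmonic on $D_{R_1}$, and satisfies $$\min_{c\in\mathbb R}\,\max_{|w|\le R_2}|h(w)-c|\le B_0\,(B-m),\qquad \left|\frac{d^k}{d\varphi^k}h(e(\varphi))\right|\le B_k\,(B-m)\quad(\varphi\in\mathbb R,\ k=1,2).$$ -/

import Mathlib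

open MeasureTheory Metric
open scoped ENNReal

noncomputable section

namespace EffectiveRiesz

/-- The integral of an extended-real-valued function, `∫ f⁺ dμ - ∫ f⁻ dμ`, with value in `[-∞, ∞]`.
It is the usual extended integral whenever `∫ f⁺ dμ < ∞`; it is used only in that case. -/
def extIntegral {α : Type*} [MeasurableSpace α] (μ : Measure α) (f : α → EReal) : EReal :=
  ((∫⁻ x, (f x).toENNReal ∂μ : ℝ≥0∞) : EReal) - ((∫⁻ x, (-f x).toENNReal ∂μ : ℝ≥0∞) : EReal)

/-- The point `e(θ) = exp(2πiθ)` of the unit circle. -/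
def e (θ : ℝ) : ℂ := Complex.exp (2 * Real.pi * Complex.I * θ)

/-- The mean value `∫₀¹ v(z + r e(θ)) dθ` of `v` over the circle of centre `z` and radius `r`. -/
def circleMean (v : ℂ → EReal) (z : ℂ) (r : ℝ) : EReal :=
  extIntegral (volume.restrict (Set.Ioc (0 : ℝ) 1)) (fun θ => v (z + r * e θ))

/-- `v : s → ℝ ∪ {-∞}` is subharmonic: it is upper semicontinuous and satisfies the sub-mean value
property on all closed disks contained in `s`. Values of `v` outside `s` are irrelevant. -/
structure SubharmonicOn (v : ℂ → EReal) (s : Set ℂ) : Prop where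
  lt_top : ∀ z ∈ s, v z < ⊤
  upperSemicontinuousOn : UpperSemicontinuousOn v s
  le_circleMean : ∀ (z : ℂ) (r : ℝ), 0 < r → closedBall z r ⊆ s → v z ≤ circleMean v z r

/-- The logarithmic potential `∫_s log |z - w| μ(dz) ∈ [-∞, ∞]`, where `log 0 = -∞`. -/
def logPotential (μ : Measure ℂ) (s : Set ℂ) (w : ℂ) : EReal :=
  extIntegral (μ.restrict s) (fun z => ENNReal.log ‖z - w‖ₑ)

/-- In the borderline case `R² - R₁² = R` the two branches agree. -/
def B₀ (R R₁ R₂ : ℝ) : ℝ :=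
  1 / (2 * Real.log (R / R₁)) * ((R₁ + R₂) / (R₁ - R₂)) *
    (if R < R ^ 2 - R₁ ^ 2 then Real.log R else Real.log (R ^ 2 / (R ^ 2 - R₁ ^ 2)))

def B₁ (R R₁ R₂ : ℝ) : ℝ :=
  B₀ R R₁ R₂ * (8 * R₂ / (R₂ ^ 2 - 1))

def B₂ (R R₁ R₂ : ℝ) : ℝ :=
  B₀ R R₁ R₂ *
    (16 * Real.pi * (R₂ ^ 2 - 1) *
        √(16 * R₂ ^ 2 - (√(R₂ ^ 4 + 34 * R₂ ^ 2 + 1) - 1 - R₂ ^ 2) ^ 2) /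
      (3 * R₂ ^ 2 + 3 - √(R₂ ^ 4 + 34 * R₂ ^ 2 + 1)) ^ 2)

end EffectiveRiesz

end

noncomputable section

namespace EffectiveRiesz

open Set Filter Topology InnerProductSpace

/-!
The function `p = B - v` is nonnegative and superharmonic on the disc of radius `R`. The defects
`p z - (mean of p over the circle of radius r around z)`, divided by the integral of
`log⁺ (r / ‖z‖)`, are densities of measures whose Green potentials are dominated by mollifications
of `p`; as `p 0` is finite, their masses on smaller discs are bounded. A vague limit `μ`, as
`r → 0`, has a Green potential that is at most `p`, and after mollification the difference has the
mean value property. Hence `p` is the sum of the Green potential of `μ`, restricted to the disc of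
radius `R₁`, and a nonnegative harmonic function `H`. At the centre this decomposition bounds the
mass of `μ`, because the Green function is at least `log (R / R₁)` there.

Since the Green function is `log ‖R² - z̄ w‖ - log R - log ‖z - w‖`, the harmonic part of `v` is
`h w = B - H w - ∫ (log ‖R² - z̄ w‖ - log R) μ(dz)`, which is bounded above in terms of `h 0`. The
Harnack inequality makes this one-sided bound two-sided, which is the constant `B₀`. The factors
relating `B₁` and `B₂` to `B₀` are the `L¹` norms of the first two angular derivatives of the
Poisson kernel.
-/

/-! ### Circle means of `[0, ∞]`-valued functions -/

lemma e_eq_exp_mul_I (θ : ℝ) : e θ = Complex.exp ((2 * Real.pi * θ : ℝ) * Complex.I) := by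
  rw [e]; congr 1; push_cast; ring

@[simp] lemma norm_e (θ : ℝ) : ‖e θ‖ = 1 := by
  rw [e_eq_exp_mul_I, Complex.norm_exp_ofReal_mul_I]

lemma e_add (s t : ℝ) : e (s + t) = e s * e t := by
  simp only [e, ← Complex.exp_add]; congr 1; push_cast; ring

lemma e_half : e (1 / 2) = -1 := by
  rw [e, ← Complex.exp_pi_mul_I]; congr 1; push_cast; ring

lemma e_periodic : Function.Periodic e 1 := fun θ => by
  rw [e_add, show e 1 = 1 by simp [e, Complex.exp_two_pi_mul_I], mul_one]

@[fun_prop] lemma continuous_e : Continuous e := by unfold e; fun_prop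

@[fun_prop] lemma measurable_e : Measurable e := continuous_e.measurable

lemma exists_eq_norm_mul_e (z : ℂ) : ∃ ψ : ℝ, z = ‖z‖ * e ψ := by
  refine ⟨z.arg / (2 * Real.pi), ?_⟩
  rw [e_eq_exp_mul_I, mul_div_cancel₀ _ (by positivity), Complex.norm_mul_exp_arg_mul_I]

lemma add_mul_e_mem_sphere (z : ℂ) {r : ℝ} (hr : 0 ≤ r) (θ : ℝ) : z + r * e θ ∈ sphere z r := by
  simp [abs_of_nonneg hr]

lemma norm_le_of_mem_sphere {E : Type*} [SeminormedAddCommGroup E] {x z : E} {r : ℝ}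
    (hx : x ∈ sphere z r) : ‖x‖ ≤ ‖z‖ + r := by
  simpa only [mem_sphere_iff_norm.1 hx] using norm_le_norm_add_norm_sub' x z

lemma lintegral_Ioc_add_of_periodic {f : ℝ → ℝ≥0∞} (hf : Function.Periodic f 1) (c : ℝ) :
    ∫⁻ θ in Ioc (0 : ℝ) 1, f (θ + c) = ∫⁻ θ in Ioc (0 : ℝ) 1, f θ := by
  have translate : ∫⁻ θ in Ioc (0 : ℝ) 1, f (θ + c) = ∫⁻ θ in Ioc c (c + 1), f θ := by
    rw [← (measurePreserving_add_right volume c).setLIntegral_comp_preimage_emb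
      (measurableEmbedding_addRight c) f (Ioc c (c + 1))]
    simp
  have change_domain := (isAddFundamentalDomain_Ioc (T := 1) one_pos c).setLIntegral_eq
    (isAddFundamentalDomain_Ioc (T := 1) one_pos 0) f (by
      rintro ⟨g, hg⟩ x
      obtain ⟨n, rfl⟩ := AddSubgroup.mem_zmultiples_iff.1 hg
      simpa [AddSubgroup.vadd_def, add_comm] using hf.zsmul n x)
  rw [translate, change_domain, zero_add]

/-- The mean `∫₀¹ f(z + r e(θ)) dθ` of a `[0, ∞]`-valued function over the circle of centre `z`
and radius `r`. -/
def lcircleMean (f : ℂ → ℝ≥0∞) (z : ℂ) (r : ℝ) : ℝ≥0∞ :=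
  ∫⁻ θ in Ioc (0 : ℝ) 1, f (z + r * e θ)

section lcircleMean

variable {f g : ℂ → ℝ≥0∞} {z : ℂ} {r : ℝ}

@[fun_prop] lemma measurable_lcircleMean (hf : Measurable f) (r : ℝ) :
    Measurable fun z => lcircleMean f z r := by
  unfold lcircleMean
  exact Measurable.lintegral_prod_right' (f := fun q : ℂ × ℝ => f (q.1 + r * e q.2)) (by fun_prop)

lemma lintegral_e_mul (f : ℂ → ℝ≥0∞) (w z : ℂ) :
    ∫⁻ θ in Ioc (0 : ℝ) 1, f (w + e θ * z) = lcircleMean f w ‖z‖ := by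
  obtain ⟨ψ, hψ⟩ := exists_eq_norm_mul_e z
  rw [lcircleMean, ← lintegral_Ioc_add_of_periodic (f := fun θ => f (w + ‖z‖ * e θ)) (c := ψ)]
  · refine lintegral_congr fun θ => ?_
    nth_rewrite 1 [hψ]
    rw [e_add, mul_left_comm]
  · intro θ
    simp only [e_periodic θ]

lemma lcircleMean_eq_lintegral_sub (f : ℂ → ℝ≥0∞) (z : ℂ) (r : ℝ) :
    lcircleMean f z r = ∫⁻ θ in Ioc (0 : ℝ) 1, f (z - r * e θ) := by
  rw [lcircleMean, ← lintegral_Ioc_add_of_periodic (f := fun θ => f (z + r * e θ)) (c := 1 / 2)]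
  · simp only [e_add, e_half, mul_neg, mul_one, sub_eq_add_neg]
  · intro θ
    simp only [e_periodic θ]

lemma lcircleMean_mono (hr : 0 ≤ r) (h : ∀ x ∈ sphere z r, f x ≤ g x) :
    lcircleMean f z r ≤ lcircleMean g z r :=
  lintegral_mono fun θ => h _ (add_mul_e_mem_sphere z hr θ)

lemma lcircleMean_congr (hr : 0 ≤ r) (h : ∀ x ∈ sphere z r, f x = g x) :
    lcircleMean f z r = lcircleMean g z r :=
  lintegral_congr fun θ => h _ (add_mul_e_mem_sphere z hr θ)

@[simp] lemma lcircleMean_const (c : ℝ≥0∞) (z : ℂ) (r : ℝ) :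
    lcircleMean (fun _ => c) z r = c := by
  simp [lcircleMean]

@[simp] lemma lcircleMean_zero_radius (f : ℂ → ℝ≥0∞) (z : ℂ) : lcircleMean f z 0 = f z := by
  simp [lcircleMean]

lemma lcircleMean_add (hf : Measurable f) (g : ℂ → ℝ≥0∞) (z : ℂ) (r : ℝ) :
    lcircleMean (fun x => f x + g x) z r = lcircleMean f z r + lcircleMean g z r :=
  lintegral_add_left (by fun_prop) _

lemma lcircleMean_comm (hf : Measurable f) (z : ℂ) (r s : ℝ) :
    lcircleMean (fun x => lcircleMean f x r) z s =
      lcircleMean (fun x => lcircleMean f x s) z r := by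
  simp only [lcircleMean]
  rw [lintegral_lintegral_swap (by fun_prop)]
  simp only [add_right_comm]

lemma lcircleMean_lintegral {α : Type*} [MeasurableSpace α] {μ : Measure α} [SFinite μ]
    {F : α → ℂ → ℝ≥0∞} (hF : Measurable (Function.uncurry F)) (w : ℂ) (r : ℝ) :
    lcircleMean (fun x => ∫⁻ a, F a x ∂μ) w r = ∫⁻ a, lcircleMean (F a) w r ∂μ := by
  simp only [lcircleMean]
  rw [lintegral_lintegral_swap]
  exact (hF.comp (f := fun q : ℝ × α => (q.2, w + r * e q.1)) (by fun_prop)).aemeasurable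

lemma lowerSemicontinuousAt_lintegral {α X : Type*} [MeasurableSpace α] [TopologicalSpace X]
    [FirstCountableTopology X] {μ : Measure α} {F : α → X → ℝ≥0∞} {w : X}
    (hF : ∀ x, Measurable fun a => F a x) (h : ∀ a, LowerSemicontinuousAt (F a) w) :
    LowerSemicontinuousAt (fun x => ∫⁻ a, F a x ∂μ) w :=
  lowerSemicontinuousAt_iff_le_liminf.2 <|
    (lintegral_mono fun a => lowerSemicontinuousAt_iff_le_liminf.1 (h a)).trans
      (lintegral_liminf_le hF)

lemma lowerSemicontinuous_lcircleMean (hf : LowerSemicontinuous f) (r : ℝ) :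
    LowerSemicontinuous fun z => lcircleMean f z r := by
  have hfm := hf.measurable
  exact fun z => lowerSemicontinuousAt_lintegral (fun x => by fun_prop) fun θ =>
    (hf.comp (continuous_id.add continuous_const) : LowerSemicontinuous _) z

end lcircleMean

/-! ### Means with respect to a weight -/

/-- The mean `∫ a(z) f(w + z) dA(z)` of the translates of `f`, with weight `a`. -/
def weightedMean (a f : ℂ → ℝ≥0∞) (w : ℂ) : ℝ≥0∞ := ∫⁻ z, a z * f (w + z)

/-- A weight is radial if it depends only on the modulus; the means of such weights are
superpositions of circle means. -/
def IsRadial (a : ℂ → ℝ≥0∞) : Prop := ∀ z w : ℂ, ‖z‖ = ‖w‖ → a z = a w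

section weightedMean

variable {a b f g : ℂ → ℝ≥0∞} {w : ℂ}

lemma weightedMean_eq_lintegral_sub (a f : ℂ → ℝ≥0∞) (w : ℂ) :
    weightedMean a f w = ∫⁻ z, a (z - w) * f z := by
  rw [weightedMean, ← lintegral_add_left_eq_self (fun z => a (z - w) * f z) w]
  simp

@[fun_prop] lemma measurable_weightedMean (ha : Measurable a) (hf : Measurable f) :
    Measurable (weightedMean a f) := by
  unfold weightedMean
  exact Measurable.lintegral_prod_right' (f := fun q : ℂ × ℂ => a q.2 * f (q.1 + q.2)) (by fun_prop)

lemma weightedMean_add (ha : Measurable a) (hf : Measurable f) (g : ℂ → ℝ≥0∞) (w : ℂ) :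
    weightedMean a (fun x => f x + g x) w = weightedMean a f w + weightedMean a g w := by
  simp only [weightedMean, mul_add]
  rw [lintegral_add_left (by fun_prop)]

lemma weightedMean_add_left (ha : Measurable a) (hf : Measurable f) (b : ℂ → ℝ≥0∞) (w : ℂ) :
    weightedMean (fun x => a x + b x) f w = weightedMean a f w + weightedMean b f w := by
  simp only [weightedMean, add_mul]
  rw [lintegral_add_left (by fun_prop)]

lemma weightedMean_mono (h : ∀ z, a z ≠ 0 → f (w + z) ≤ g (w + z)) :
    weightedMean a f w ≤ weightedMean a g w := by
  refine lintegral_mono fun z => ?_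
  by_cases hz : a z = 0
  · simp [hz]
  · exact mul_le_mul_right (h z hz) _

lemma weightedMean_congr (h : ∀ z, a z ≠ 0 → f (w + z) = g (w + z)) :
    weightedMean a f w = weightedMean a g w :=
  (weightedMean_mono fun z hz => (h z hz).le).antisymm
    (weightedMean_mono fun z hz => (h z hz).ge)

lemma weightedMean_const (ha : Measurable a) (c : ℝ≥0∞) (w : ℂ) :
    weightedMean a (fun _ => c) w = (∫⁻ z, a z) * c :=
  lintegral_mul_const c ha

lemma lcircleMean_weightedMean (ha : Measurable a) (hf : Measurable f) (w : ℂ) (r : ℝ) :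
    lcircleMean (weightedMean a f) w r = weightedMean a (fun x => lcircleMean f x r) w := by
  unfold weightedMean
  rw [lcircleMean_lintegral (F := fun z x => a z * f (x + z)) (by fun_prop)]
  refine lintegral_congr fun z => ?_
  simp only [lcircleMean]
  rw [lintegral_const_mul _ (by fun_prop)]
  simp only [add_right_comm]

lemma weightedMean_lcircleMean_left (ha : Measurable a) (hf : Measurable f) (w : ℂ) (r : ℝ) :
    weightedMean (fun x => lcircleMean a x r) f w =
      weightedMean a (fun x => lcircleMean f x r) w :=
  calc weightedMean (fun x => lcircleMean a x r) f w
      = ∫⁻ z, ∫⁻ θ in Ioc (0 : ℝ) 1, a (z + r * e θ) * f (w + z) := by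
        refine lintegral_congr fun z => ?_
        exact (lintegral_mul_const _ (by fun_prop)).symm
    _ = ∫⁻ θ in Ioc (0 : ℝ) 1, ∫⁻ z, a (z + r * e θ) * f (w + z) :=
        lintegral_lintegral_swap (by fun_prop)
    _ = ∫⁻ θ in Ioc (0 : ℝ) 1, ∫⁻ z, a z * f (w + z - r * e θ) := by
        refine lintegral_congr fun θ => ?_
        rw [← lintegral_add_right_eq_self (fun z => a z * f (w + z - r * e θ)) (r * e θ)]
        simp only [← add_assoc, add_sub_cancel_right]
    _ = ∫⁻ z, ∫⁻ θ in Ioc (0 : ℝ) 1, a z * f (w + z - r * e θ) :=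
        lintegral_lintegral_swap (by fun_prop)
    _ = weightedMean a (fun x => lcircleMean f x r) w := by
        simp only [weightedMean, lcircleMean_eq_lintegral_sub]
        exact lintegral_congr fun z => lintegral_const_mul _ (by fun_prop)

lemma lintegral_weightedMean (ha : Measurable a) (hf : Measurable f) :
    ∫⁻ w, weightedMean a f w = (∫⁻ z, a z) * ∫⁻ z, f z := by
  unfold weightedMean
  rw [lintegral_lintegral_swap (by fun_prop), ← lintegral_mul_const _ ha]
  refine lintegral_congr fun z => ?_
  rw [lintegral_const_mul _ (by fun_prop), lintegral_add_right_eq_self f z]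

lemma norm_lt_of_weightedMean_ne_zero {δ ρ : ℝ} (ha : ∀ z, a z ≠ 0 → ‖z‖ < δ)
    (hf : ∀ z, f z ≠ 0 → ‖z‖ < ρ) (h : weightedMean a f w ≠ 0) : ‖w‖ < ρ + δ := by
  contrapose! h
  refine lintegral_eq_zero_of_ae_eq_zero (.of_forall fun z => mul_eq_zero.2 ?_)
  by_contra! hz
  have hwz : ‖w‖ ≤ ‖w + z‖ + ‖z‖ := by simpa using norm_sub_le (w + z) z
  linarith [ha z hz.1, hf _ hz.2]

lemma weightedMean_comm (ha : Measurable a) (hb : Measurable b) (hf : Measurable f) (w : ℂ) :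
    weightedMean a (weightedMean b f) w = weightedMean b (weightedMean a f) w :=
  calc weightedMean a (weightedMean b f) w
      = ∫⁻ z, ∫⁻ y, a z * (b y * f (w + z + y)) :=
        lintegral_congr fun z => (lintegral_const_mul _ (by fun_prop)).symm
    _ = ∫⁻ y, ∫⁻ z, a z * (b y * f (w + z + y)) := lintegral_lintegral_swap (by fun_prop)
    _ = ∫⁻ y, ∫⁻ z, b y * (a z * f (w + y + z)) := by
        simp only [mul_left_comm (a _), add_right_comm w]
    _ = weightedMean b (weightedMean a f) w :=
        lintegral_congr fun y => lintegral_const_mul _ (by fun_prop)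

lemma weightedMean_weightedMean (ha : Measurable a) (hb : Measurable b) (hf : Measurable f)
    (w : ℂ) :
    weightedMean a (weightedMean b f) w = ∫⁻ x, (∫⁻ y, a y * b (x - y)) * f (w + x) :=
  calc weightedMean a (weightedMean b f) w
      = ∫⁻ y, ∫⁻ x, a y * b (x - y) * f (w + x) := by
        refine lintegral_congr fun y => ?_
        rw [weightedMean, ← lintegral_const_mul _ (by fun_prop),
          ← lintegral_add_right_eq_self (fun x => a y * b (x - y) * f (w + x)) y]
        simp only [add_sub_cancel_right, mul_assoc, add_assoc, add_comm y]
    _ = ∫⁻ x, ∫⁻ y, a y * b (x - y) * f (w + x) := lintegral_lintegral_swap (by fun_prop)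
    _ = ∫⁻ x, (∫⁻ y, a y * b (x - y)) * f (w + x) :=
        lintegral_congr fun x => lintegral_mul_const _ (by fun_prop)

namespace IsRadial

lemma neg (h : IsRadial a) (z : ℂ) : a (-z) = a z := h _ _ (norm_neg z)

lemma weightedMean_weightedMean (h : IsRadial a) (ha : Measurable a) (hb : Measurable b)
    (hf : Measurable f) (w : ℂ) :
    weightedMean a (weightedMean b f) w = weightedMean (weightedMean a b) f w := by
  rw [EffectiveRiesz.weightedMean_weightedMean ha hb hf]
  refine lintegral_congr fun x => ?_
  rw [weightedMean, ← lintegral_neg_eq_self]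
  simp only [h.neg, sub_neg_eq_add]

lemma weightedMean_eq_lintegral_rotation (h : IsRadial a) (ha : Measurable a) (hf : Measurable f)
    (w : ℂ) (θ : ℝ) : weightedMean a f w = ∫⁻ z, a z * f (w + e θ * z) := by
  have rotation_eq (z : ℂ) : rotation (Circle.exp (2 * Real.pi * θ)) z = e θ * z := by
    rw [rotation_apply, e_eq_exp_mul_I, Circle.coe_exp]
  rw [weightedMean, ← (rotation (Circle.exp (2 * Real.pi * θ))).measurePreserving.lintegral_comp
    (f := fun z => a z * f (w + z)) (by fun_prop)]
  refine lintegral_congr fun z => ?_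
  rw [rotation_eq, h (e θ * z) z (by simp)]

lemma weightedMean_eq (h : IsRadial a) (ha : Measurable a) (hf : Measurable f) (w : ℂ) :
    weightedMean a f w = ∫⁻ z, a z * lcircleMean f w ‖z‖ :=
  calc weightedMean a f w
      = ∫⁻ θ in Ioc (0 : ℝ) 1, ∫⁻ z, a z * f (w + e θ * z) := by
        rw [← lintegral_congr (h.weightedMean_eq_lintegral_rotation ha hf w)]; simp
    _ = ∫⁻ z, ∫⁻ θ in Ioc (0 : ℝ) 1, a z * f (w + e θ * z) :=
        lintegral_lintegral_swap (by fun_prop)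
    _ = ∫⁻ z, a z * lcircleMean f w ‖z‖ := by
        refine lintegral_congr fun z => ?_
        rw [lintegral_const_mul _ (by fun_prop), lintegral_e_mul]

lemma weightedMean_le (h : IsRadial a) (ha : Measurable a) (hf : Measurable f)
    (hfw : ∀ z, z ≠ 0 → a z ≠ 0 → lcircleMean f w ‖z‖ ≤ f w) :
    weightedMean a f w ≤ (∫⁻ z, a z) * f w := by
  rw [h.weightedMean_eq ha hf, ← lintegral_mul_const _ ha]
  refine lintegral_mono fun z => ?_
  rcases eq_or_ne (a z) 0 with haz | haz
  · simp [haz]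
  rcases eq_or_ne z 0 with rfl | hz
  · simp
  · exact mul_le_mul_right (hfw z hz haz) _

lemma weightedMean_eq_of_lcircleMean_eq (h : IsRadial a) (ha : Measurable a) (hf : Measurable f)
    (hfw : ∀ z, z ≠ 0 → a z ≠ 0 → lcircleMean f w ‖z‖ = f w) :
    weightedMean a f w = (∫⁻ z, a z) * f w := by
  rw [h.weightedMean_eq ha hf, ← lintegral_mul_const _ ha]
  refine lintegral_congr fun z => ?_
  rcases eq_or_ne (a z) 0 with haz | haz
  · simp [haz]
  rcases eq_or_ne z 0 with rfl | hz
  · simp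
  · rw [hfw z hz haz]

end IsRadial

/-- `a` is a radial probability density supported in the disc of radius `δ`; as `δ → 0`, its means
form an approximate identity. -/
structure IsRadialDensity (a : ℂ → ℝ≥0∞) (δ : ℝ) : Prop where
  measurable : Measurable a
  isRadial : IsRadial a
  lintegral_eq_one : ∫⁻ z, a z = 1
  norm_lt : ∀ z, a z ≠ 0 → ‖z‖ < δ

lemma IsRadialDensity.weightedMean_le {δ : ℝ} (ha : IsRadialDensity a δ) (hf : Measurable f)
    (hfw : ∀ t, 0 < t → t < δ → lcircleMean f w t ≤ f w) : weightedMean a f w ≤ f w := by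
  simpa [ha.lintegral_eq_one] using ha.isRadial.weightedMean_le ha.measurable hf
    fun z hz haz => hfw _ (norm_pos_iff.2 hz) (ha.norm_lt z haz)

lemma IsRadialDensity.weightedMean_eq {δ : ℝ} (ha : IsRadialDensity a δ) (hf : Measurable f)
    (hfw : ∀ t, 0 < t → t < δ → lcircleMean f w t = f w) : weightedMean a f w = f w := by
  simpa [ha.lintegral_eq_one] using ha.isRadial.weightedMean_eq_of_lcircleMean_eq ha.measurable hf
    fun z hz haz => hfw _ (norm_pos_iff.2 hz) (ha.norm_lt z haz)

lemma tendsto_weightedMean {ι : Type*} {l : Filter ι} {a : ι → ℂ → ℝ≥0∞} {δ : ι → ℝ}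
    (hδ : Tendsto δ l (𝓝 0)) (ha : ∀ᶠ i in l, IsRadialDensity (a i) (δ i))
    (hf : Measurable f) (hlsc : LowerSemicontinuousAt f w) {ε : ℝ} (hε : 0 < ε)
    (hmean : ∀ t, 0 < t → t < ε → lcircleMean f w t ≤ f w) :
    Tendsto (fun i => weightedMean (a i) f w) l (𝓝 (f w)) := by
  refine tendsto_order.2 ⟨fun y hy => ?_, fun y hy => ?_⟩
  · obtain ⟨y', hyy', hy'⟩ := exists_between hy
    obtain ⟨d, hd, hball⟩ := Metric.eventually_nhds_iff.1 (hlsc y' hy')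
    filter_upwards [ha, hδ.eventually (gt_mem_nhds hd)] with i hai hid
    calc y < y' := hyy'
      _ = weightedMean (a i) (fun _ => y') w := by
          rw [weightedMean_const hai.measurable, hai.lintegral_eq_one, one_mul]
      _ ≤ weightedMean (a i) f w := weightedMean_mono fun z hz =>
          (hball (by simpa using (hai.norm_lt z hz).trans hid)).le
  · filter_upwards [ha, hδ.eventually (gt_mem_nhds hε)] with i hai hiε
    exact (hai.weightedMean_le hf fun t ht hti => hmean t ht (hti.trans hiε)).trans_lt hy

end weightedMean

/-! ### Circle means of real functions -/

section

variable {F : ℂ → ℝ≥0∞} {f : ℂ → ℝ} {z : ℂ} {r : ℝ}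

lemma circleMap_two_pi_mul (z : ℂ) (r θ : ℝ) : circleMap z r (2 * Real.pi * θ) = z + r * e θ := by
  rw [circleMap, e_eq_exp_mul_I]

lemma circleAverage_eq_integral_e (f : ℂ → ℝ) (z : ℂ) (r : ℝ) :
    Real.circleAverage f z r = ∫ θ in Ioc (0 : ℝ) 1, f (z + r * e θ) := by
  have h := intervalIntegral.integral_comp_mul_left (a := 0) (b := 1) (c := 2 * Real.pi)
    (fun θ => f (circleMap z r θ)) (by positivity)
  simp only [circleMap_two_pi_mul, mul_zero, mul_one] at h
  rw [Real.circleAverage_def, ← intervalIntegral.integral_of_le zero_le_one, h]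

lemma integrableOn_comp_e (hf : CircleIntegrable f z r) :
    IntegrableOn (fun θ => f (z + r * e θ)) (Ioc (0 : ℝ) 1) := by
  have h := IntervalIntegrable.comp_mul_left (c := 2 * Real.pi) hf
  simp only [circleMap_two_pi_mul] at h
  rwa [zero_div, div_self (by positivity), intervalIntegrable_iff_integrableOn_Ioc_of_le
    zero_le_one] at h

lemma ae_add_mul_e_ne (z a : ℂ) (hr : r ≠ 0) (s : Set ℝ) :
    ∀ᵐ θ ∂volume.restrict s, z + r * e θ ≠ a := by
  have hcount : {θ : ℝ | z + r * e θ = a}.Countable := by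
    simp only [← circleMap_two_pi_mul]
    exact ((countable_singleton a).preimage_circleMap z hr).preimage_of_injOn
      (mul_right_injective₀ Real.two_pi_pos.ne').injOn
  simpa [ae_iff] using hcount.measure_zero (volume.restrict s)

lemma lcircleMean_eq_ofReal (a : ℂ) (hr : 0 < r) (hf : CircleIntegrable f z r)
    (h0 : ∀ x ∈ sphere z r, x ≠ a → 0 ≤ f x)
    (hF : ∀ x ∈ sphere z r, x ≠ a → F x = ENNReal.ofReal (f x)) :
    lcircleMean F z r = ENNReal.ofReal (Real.circleAverage f z r) := by
  rw [circleAverage_eq_integral_e, ofReal_integral_eq_lintegral_ofReal (integrableOn_comp_e hf)]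
  · refine lintegral_congr_ae ?_
    filter_upwards [ae_add_mul_e_ne z a hr.ne' _] with θ hθ
      using hF _ (add_mul_e_mem_sphere z hr.le θ) hθ
  · filter_upwards [ae_add_mul_e_ne z a hr.ne' _] with θ hθ
      using h0 _ (add_mul_e_mem_sphere z hr.le θ) hθ

lemma ofReal_circleAverage_le_lcircleMean (a : ℂ) (hr : 0 < r) (hf : CircleIntegrable f z r)
    (hF : ∀ x ∈ sphere z r, x ≠ a → ENNReal.ofReal (f x) ≤ F x) :
    ENNReal.ofReal (Real.circleAverage f z r) ≤ lcircleMean F z r := by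
  have hi := integrableOn_comp_e hf
  rw [circleAverage_eq_integral_e]
  calc ENNReal.ofReal (∫ θ in Ioc (0 : ℝ) 1, f (z + r * e θ))
      ≤ ENNReal.ofReal (∫ θ in Ioc (0 : ℝ) 1, max (f (z + r * e θ)) 0) :=
        ENNReal.ofReal_le_ofReal (integral_mono hi hi.pos_part fun θ => le_max_left _ _)
    _ = ∫⁻ θ in Ioc (0 : ℝ) 1, ENNReal.ofReal (max (f (z + r * e θ)) 0) :=
        ofReal_integral_eq_lintegral_ofReal hi.pos_part (.of_forall fun θ => le_max_right _ _)
    _ ≤ lcircleMean F z r := by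
        refine lintegral_mono_ae ?_
        filter_upwards [ae_add_mul_e_ne z a hr.ne' _] with θ hθ
        simpa using hF _ (add_mul_e_mem_sphere z hr.le θ) hθ

lemma circleIntegrable_log_norm_sub (a z : ℂ) (r : ℝ) :
    CircleIntegrable (fun x => Real.log ‖a - x‖) z r :=
  MeromorphicOn.circleIntegrable_log_norm (f := fun x => a - x) (fun _ _ ↦ by fun_prop)

lemma log_add_posLog_inv_mul {t : ℝ} (hr : 0 < r) (ht : 0 ≤ t) :
    Real.log r + Real.posLog (r⁻¹ * t) = Real.log (max r t) := by
  rcases ht.eq_or_lt with rfl | ht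
  · simp [hr.le]
  rw [Real.posLog, Real.log_mul (inv_ne_zero hr.ne') ht.ne', Real.log_inv,
    Real.strictMonoOn_log.monotoneOn.map_max hr ht, ← max_add_add_left]
  congr 1 <;> ring

lemma circleIntegrable_of_harmonicOnNhd (hr : 0 < r) (hf : HarmonicOnNhd f (closedBall z r)) :
    CircleIntegrable f z r :=
  ContinuousOn.circleIntegrable hr.le fun x hx =>
    (hf x (sphere_subset_closedBall hx)).1.continuousAt.continuousWithinAt

lemma circleAverage_sub_log_norm_sub {g : ℂ → ℝ} (a : ℂ) (hr : 0 < r)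
    (hg : HarmonicOnNhd g (closedBall z r)) :
    Real.circleAverage (fun x => g x - Real.log ‖a - x‖) z r =
      g z - Real.log (max r ‖a - z‖) := by
  have hg' : HarmonicOnNhd g (closedBall z |r|) := by rwa [abs_of_pos hr]
  rw [Real.circleAverage_fun_sub (circleIntegrable_of_harmonicOnNhd hr hg)
    (circleIntegrable_log_norm_sub a z r), hg'.circleAverage_eq]
  simp only [norm_sub_rev a]
  rw [circleAverage_log_norm_sub_const_eq_log_radius_add_posLog hr.ne',
    log_add_posLog_inv_mul hr (norm_nonneg _)]

end

/-! ### The kernel `(a - log t)⁺` -/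

/-- The positive part of `a - log t` for `0 ≤ t`, with the value `⊤` at `t = 0`. All logarithmic
kernels below are of this form; going through `EReal` makes it continuous at `t = 0`. -/
def posSubLog (a t : ℝ) : ℝ≥0∞ := ((a : EReal) - ENNReal.log (ENNReal.ofReal t)).toENNReal

section

variable {a s t r : ℝ}

lemma posSubLog_of_pos (a : ℝ) (ht : 0 < t) :
    posSubLog a t = ENNReal.ofReal (a - Real.log t) := by
  rw [posSubLog, ENNReal.log_ofReal_of_pos ht, ← EReal.coe_sub, EReal.real_coe_toENNReal]

@[simp] lemma posSubLog_zero (a : ℝ) : posSubLog a 0 = ⊤ := by simp [posSubLog]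

lemma continuous_posSubLog : Continuous fun p : ℝ × ℝ => posSubLog p.1 p.2 := by
  refine EReal.continuous_toENNReal.comp (continuous_iff_continuousAt.2 fun p => ?_)
  refine ContinuousAt.comp (g := fun q : EReal × EReal => q.1 + q.2)
    (f := fun p : ℝ × ℝ => ((p.1 : EReal), -ENNReal.log (ENNReal.ofReal p.2)))
    (EReal.continuousAt_add (.inl (EReal.coe_ne_top _)) (.inl (EReal.coe_ne_bot _)))
    (Continuous.continuousAt ?_)
  exact (continuous_coe_real_ereal.comp continuous_fst).prodMk
    (continuous_neg.comp (ENNReal.continuous_log.comp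
      (ENNReal.continuous_ofReal.comp continuous_snd)))

lemma posSubLog_mono (h : a ≤ s) (ht : r ≤ t) : posSubLog a t ≤ posSubLog s r := by
  refine EReal.toENNReal_le_toENNReal (EReal.sub_le_sub (EReal.coe_le_coe_iff.2 h) ?_)
  gcongr

lemma ofReal_sub_log_le_posSubLog (a : ℝ) (hs : 0 < s) (ht : t ≤ s) :
    ENNReal.ofReal (a - Real.log s) ≤ posSubLog a t := by
  rw [← posSubLog_of_pos a hs]
  exact posSubLog_mono le_rfl ht

lemma posSubLog_le_add (a r : ℝ) (ht : 0 ≤ t) :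
    posSubLog a t ≤ ENNReal.ofReal (a - Real.log (max r t)) + posSubLog (Real.log r) t := by
  rcases ht.eq_or_lt with rfl | ht
  · simp
  rcases le_total t r with htr | hrt
  · rw [posSubLog_of_pos _ ht, posSubLog_of_pos _ ht, max_eq_left htr]
    exact le_of_eq_of_le (by ring_nf) ENNReal.ofReal_add_le
  · rw [posSubLog_of_pos _ ht, max_eq_right hrt]
    exact le_self_add

lemma posSubLog_eq_add (hr : 0 < r) (ht : 0 ≤ t) (ha : Real.log (max r t) ≤ a) :
    posSubLog a t = ENNReal.ofReal (a - Real.log (max r t)) + posSubLog (Real.log r) t := by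
  rcases ht.eq_or_lt with rfl | ht
  · simp
  rcases le_total t r with htr | hrt
  · rw [max_eq_left htr] at ha ⊢
    rw [posSubLog_of_pos _ ht, posSubLog_of_pos _ ht, ← ENNReal.ofReal_add (sub_nonneg.2 ha)
      (sub_nonneg.2 (Real.log_le_log ht htr))]
    congr 1; ring
  · rw [posSubLog_of_pos _ ht, posSubLog_of_pos _ ht, max_eq_right hrt,
      ENNReal.ofReal_of_nonpos (sub_nonpos.2 (Real.log_le_log hr hrt)), add_zero]

lemma posSubLog_le_add_ofReal (ht : 0 ≤ t) :
    posSubLog a t ≤ posSubLog s t + ENNReal.ofReal (a - s) := by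
  rcases ht.eq_or_lt with rfl | ht
  · simp
  rw [posSubLog_of_pos _ ht, posSubLog_of_pos _ ht]
  exact le_of_eq_of_le (by ring_nf) ENNReal.ofReal_add_le

end

section

variable {g : ℂ → ℝ} {z a : ℂ} {r : ℝ}

lemma posSubLog_norm_sub_of_ne (c : ℝ) {x : ℂ} (hx : x ≠ a) :
    posSubLog c ‖a - x‖ = ENNReal.ofReal (c - Real.log ‖a - x‖) :=
  posSubLog_of_pos _ (norm_pos_iff.2 (sub_ne_zero.2 hx.symm))

lemma circleIntegrable_sub_log_norm_sub (a : ℂ) (hr : 0 < r)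
    (hg : HarmonicOnNhd g (closedBall z r)) :
    CircleIntegrable (fun x => g x - Real.log ‖a - x‖) z r :=
  (circleIntegrable_of_harmonicOnNhd hr hg).sub (circleIntegrable_log_norm_sub a z r)

lemma lcircleMean_posSubLog (hr : 0 < r) (hg : HarmonicOnNhd g (closedBall z r))
    (hlog : ∀ x ∈ sphere z r, x ≠ a → Real.log ‖a - x‖ ≤ g x) :
    lcircleMean (fun x => posSubLog (g x) ‖a - x‖) z r =
      ENNReal.ofReal (g z - Real.log (max r ‖a - z‖)) := by
  rw [← circleAverage_sub_log_norm_sub a hr hg]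
  exact lcircleMean_eq_ofReal a hr (circleIntegrable_sub_log_norm_sub a hr hg)
    (fun x hx hxa => sub_nonneg.2 (hlog x hx hxa)) fun x _ hxa => posSubLog_norm_sub_of_ne _ hxa

lemma log_max_norm_sub_le (hr : 0 < r) (hg : HarmonicOnNhd g (closedBall z r))
    (hlog : ∀ x ∈ sphere z r, x ≠ a → Real.log ‖a - x‖ ≤ g x) :
    Real.log (max r ‖a - z‖) ≤ g z := by
  rw [← sub_nonneg, ← circleAverage_sub_log_norm_sub a hr hg, circleAverage_eq_integral_e]
  refine integral_nonneg_of_ae ?_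
  filter_upwards [ae_add_mul_e_ne z a hr.ne' _] with θ hθ
    using sub_nonneg.2 (hlog _ (add_mul_e_mem_sphere z hr.le θ) hθ)

lemma posSubLog_eq_lcircleMean_add (hr : 0 < r) (hg : HarmonicOnNhd g (closedBall z r))
    (hlog : ∀ x ∈ sphere z r, x ≠ a → Real.log ‖a - x‖ ≤ g x) :
    posSubLog (g z) ‖a - z‖ =
      lcircleMean (fun x => posSubLog (g x) ‖a - x‖) z r + posSubLog (Real.log r) ‖a - z‖ := by
  rw [lcircleMean_posSubLog hr hg hlog]
  exact posSubLog_eq_add hr (norm_nonneg _) (log_max_norm_sub_le hr hg hlog)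

lemma posSubLog_le_lcircleMean_add {F : ℂ → ℝ≥0∞} (hr : 0 < r)
    (hg : HarmonicOnNhd g (closedBall z r))
    (hF : ∀ x ∈ sphere z r, x ≠ a → posSubLog (g x) ‖a - x‖ ≤ F x) :
    posSubLog (g z) ‖a - z‖ ≤ lcircleMean F z r + posSubLog (Real.log r) ‖a - z‖ := by
  refine (posSubLog_le_add _ r (norm_nonneg _)).trans ?_
  rw [← circleAverage_sub_log_norm_sub a hr hg]
  gcongr
  refine ofReal_circleAverage_le_lcircleMean a hr (circleIntegrable_sub_log_norm_sub a hr hg)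
    fun x hx hxa => ?_
  rw [← posSubLog_norm_sub_of_ne _ hxa]
  exact hF x hx hxa

end

/-! ### The truncated logarithmic kernel -/

/-- The kernel `log⁺ (r / ‖z‖)`, the density that measures the failure of the mean value property
on circles of radius `r`. -/
def logKernel (r : ℝ) (z : ℂ) : ℝ≥0∞ := posSubLog (Real.log r) ‖z‖

section

variable {C r s : ℝ} {z : ℂ}

@[fun_prop] lemma measurable_logKernel (r : ℝ) : Measurable (logKernel r) :=
  (continuous_posSubLog.comp (continuous_const.prodMk continuous_norm)).measurable

lemma isRadial_logKernel (r : ℝ) : IsRadial (logKernel r) := fun z w h => by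
  rw [logKernel, logKernel, h]

@[simp] lemma logKernel_zero (r : ℝ) : logKernel r 0 = ⊤ := by simp [logKernel]

lemma logKernel_pos_iff (hr : 0 < r) : 0 < logKernel r z ↔ ‖z‖ < r := by
  rcases eq_or_ne z 0 with rfl | hz
  · simpa using hr
  rw [logKernel, posSubLog_of_pos _ (norm_pos_iff.2 hz), ENNReal.ofReal_pos, sub_pos,
    Real.log_lt_log_iff (norm_pos_iff.2 hz) hr]

lemma norm_lt_of_logKernel_ne_zero (hr : 0 < r) (h : logKernel r z ≠ 0) : ‖z‖ < r :=
  (logKernel_pos_iff hr).1 (pos_iff_ne_zero.2 h)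

lemma log_norm_le_log_of_mem_sphere {x : ℂ} (hC : ‖z‖ + r ≤ C) (hx : x ∈ sphere z r)
    (hx0 : x ≠ 0) : Real.log ‖0 - x‖ ≤ Real.log C := by
  rw [zero_sub, norm_neg]
  exact Real.log_le_log (norm_pos_iff.2 hx0) ((norm_le_of_mem_sphere hx).trans hC)

lemma logKernel_eq_lcircleMean_add (hr : 0 < r) (hC : ‖z‖ + r ≤ C) :
    logKernel C z = lcircleMean (logKernel C) z r + logKernel r z := by
  have h := posSubLog_eq_lcircleMean_add hr (harmonicOnNhd_const _)
    fun x => log_norm_le_log_of_mem_sphere (x := x) hC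
  simp only [zero_sub, norm_neg] at h
  exact h

lemma lcircleMean_logKernel_le (hr : 0 < r) (hC : ‖z‖ + r ≤ C) :
    lcircleMean (logKernel C) z r ≤ ENNReal.ofReal (Real.log C - Real.log r) := by
  have h := lcircleMean_posSubLog hr (harmonicOnNhd_const _)
    fun x => log_norm_le_log_of_mem_sphere (x := x) hC
  simp only [zero_sub, norm_neg] at h
  refine h.le.trans (ENNReal.ofReal_le_ofReal ?_)
  gcongr
  exact le_max_left _ _

lemma logKernel_eq_add_lcircleMean_lcircleMean (hr : 0 < r) (hs : 0 < s)
    (hC : ‖z‖ + r + s ≤ C) :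
    logKernel C z = logKernel s z + lcircleMean (logKernel r) z s +
      lcircleMean (fun x => lcircleMean (logKernel C) x r) z s := by
  have hmean : lcircleMean (logKernel C) z s =
      lcircleMean (fun x => lcircleMean (logKernel C) x r) z s + lcircleMean (logKernel r) z s := by
    rw [← lcircleMean_add (by fun_prop)]
    exact lcircleMean_congr hs.le fun x hx =>
      logKernel_eq_lcircleMean_add hr (by linarith [norm_le_of_mem_sphere hx])
  rw [logKernel_eq_lcircleMean_add hs (by linarith : ‖z‖ + s ≤ C), hmean]
  ring

lemma logKernel_add_lcircleMean_logKernel (hr : 0 < r) (hs : 0 < s) (z : ℂ) :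
    logKernel s z + lcircleMean (logKernel r) z s =
      lcircleMean (logKernel s) z r + logKernel r z := by
  set C := ‖z‖ + r + s with hC
  have hrs := logKernel_eq_add_lcircleMean_lcircleMean hr hs hC.ge
  have hsr := logKernel_eq_add_lcircleMean_lcircleMean hs hr (z := z) (C := C) (by linarith)
  rw [lcircleMean_comm (by fun_prop)] at hsr
  have hfin : lcircleMean (fun x => lcircleMean (logKernel C) x r) z s ≠ ⊤ := by
    refine ne_top_of_le_ne_top (b := ENNReal.ofReal (Real.log C - Real.log r)) (by simp) ?_
    rw [← lcircleMean_const (ENNReal.ofReal (Real.log C - Real.log r)) z s]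
    exact lcircleMean_mono hs.le fun x hx =>
      lcircleMean_logKernel_le hr (by linarith [norm_le_of_mem_sphere hx])
  rw [hrs, ENNReal.add_left_inj hfin] at hsr
  rw [hsr, add_comm]

lemma mul_max_log_sub_log_le (hr : 0 < r) {y : ℝ} (hy : 0 < y) :
    y * max (Real.log r - Real.log y) 0 ≤ (Ioc 0 r).indicator (fun _ => r) y := by
  by_cases hyr : y ≤ r
  · rw [indicator_of_mem (show y ∈ Ioc 0 r from ⟨hy, hyr⟩),
      max_eq_left (sub_nonneg.2 (Real.log_le_log hy hyr)), ← Real.log_div hr.ne' hy.ne']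
    calc y * Real.log (r / y) ≤ y * (r / y) := by
          gcongr; exact Real.log_le_self (by positivity)
      _ = r := by field_simp
  · rw [indicator_of_notMem (by simp [hyr]), max_eq_right, mul_zero]
    exact sub_nonpos.2 (Real.log_le_log hr (not_le.1 hyr).le)

lemma lintegral_logKernel_ne_top (hr : 0 < r) : ∫⁻ z, logKernel r z ≠ ⊤ := by
  have hint : Integrable fun z : ℂ => max (Real.log r - Real.log ‖z‖) 0 := by
    refine (integrable_fun_norm_addHaar volume (f := fun y => max (Real.log r - Real.log y) 0)).2 ?_
    rw [Complex.finrank_real_complex]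
    have hconst : IntegrableOn (fun _ : ℝ => r) (Ioc 0 r) := integrableOn_const (by simp)
    refine Integrable.mono' (hconst.integrable_indicator measurableSet_Ioc).integrableOn
      (by fun_prop) ?_
    refine (ae_restrict_iff' measurableSet_Ioi).2 (.of_forall fun y (hy : 0 < y) => ?_)
    simp only [Nat.add_one_sub_one, pow_one, smul_eq_mul]
    rw [Real.norm_of_nonneg (by positivity)]
    exact mul_max_log_sub_log_le hr hy
  have heq : ∫⁻ z, logKernel r z =
      ∫⁻ z : ℂ, ENNReal.ofReal (max (Real.log r - Real.log ‖z‖) 0) := by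
    refine lintegral_congr_ae ?_
    filter_upwards [Measure.ae_ne volume 0] with z hz
    simp [logKernel, posSubLog_of_pos _ (norm_pos_iff.2 hz), ENNReal.ofReal_max]
  rw [heq]
  exact hint.lintegral_lt_top.ne

lemma lintegral_logKernel_ne_zero (hr : 0 < r) : ∫⁻ z, logKernel r z ≠ 0 := by
  have hsupp : Function.support (logKernel r) = ball 0 r := by
    ext z
    rw [Function.mem_support, ← pos_iff_ne_zero, logKernel_pos_iff hr, mem_ball_zero_iff]
  rw [← pos_iff_ne_zero, lintegral_pos_iff_support (measurable_logKernel r), hsupp]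
  exact measure_ball_pos volume 0 hr

end

/-! ### The Green function of a disc -/

/-- The function `log ‖R² - z̄ w‖ - log R`, harmonic in `w`, which agrees with `log ‖z - w‖` when
`‖w‖ = R` and therefore is the regular part of the Green function of the disc of radius `R`. -/
def greenRegular (R : ℝ) (z w : ℂ) : ℝ :=
  Real.log ‖(R : ℂ) ^ 2 - starRingEnd ℂ z * w‖ - Real.log R

/-- The positive part of the Green function `log ‖(R² - z̄ w) / (R (z - w))‖` of the disc of
radius `R`. -/
def green (R : ℝ) (z w : ℂ) : ℝ≥0∞ := posSubLog (greenRegular R z w) ‖z - w‖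

section

variable {R S r : ℝ} {z w : ℂ}

lemma norm_sq_sub_conj_mul_comm (R : ℝ) (z w : ℂ) :
    ‖(R : ℂ) ^ 2 - starRingEnd ℂ z * w‖ = ‖(R : ℂ) ^ 2 - starRingEnd ℂ w * z‖ := by
  rw [← Complex.norm_conj]
  simp [mul_comm]

lemma norm_sq_sub_conj_mul_sq (R : ℝ) (z w : ℂ) :
    ‖(R : ℂ) ^ 2 - starRingEnd ℂ z * w‖ ^ 2 =
      (R * ‖z - w‖) ^ 2 + (R ^ 2 - ‖z‖ ^ 2) * (R ^ 2 - ‖w‖ ^ 2) := by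
  rw [← Complex.ofReal_pow, mul_pow]
  simp only [← Complex.normSq_eq_norm_sq, Complex.normSq_apply, Complex.sub_re, Complex.sub_im,
    Complex.mul_re, Complex.mul_im, Complex.conj_re, Complex.conj_im, Complex.ofReal_re,
    Complex.ofReal_im]
  ring

lemma mul_norm_sub_le_norm_sq_sub_conj_mul (hz : ‖z‖ ≤ R) (hw : ‖w‖ ≤ R) :
    R * ‖z - w‖ ≤ ‖(R : ℂ) ^ 2 - starRingEnd ℂ z * w‖ := by
  refine le_of_sq_le_sq ?_ (norm_nonneg _)
  rw [norm_sq_sub_conj_mul_sq]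
  have hz2 : ‖z‖ ^ 2 ≤ R ^ 2 := by gcongr
  have hw2 : ‖w‖ ^ 2 ≤ R ^ 2 := by gcongr
  linarith [mul_nonneg (sub_nonneg.2 hz2) (sub_nonneg.2 hw2)]

lemma norm_sq_sub_conj_mul_le_mul_norm_sub (hR : 0 ≤ R) (hz : R ≤ ‖z‖) (hw : ‖w‖ ≤ R) :
    ‖(R : ℂ) ^ 2 - starRingEnd ℂ z * w‖ ≤ R * ‖z - w‖ := by
  refine le_of_sq_le_sq ?_ (by positivity)
  rw [norm_sq_sub_conj_mul_sq]
  have hz2 : R ^ 2 ≤ ‖z‖ ^ 2 := by gcongr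
  have hw2 : ‖w‖ ^ 2 ≤ R ^ 2 := by gcongr
  nlinarith [mul_nonneg (sub_nonneg.2 hz2) (sub_nonneg.2 hw2)]

lemma sq_sub_mul_le_norm_sq_sub_conj_mul (R : ℝ) (z w : ℂ) :
    R ^ 2 - ‖z‖ * ‖w‖ ≤ ‖(R : ℂ) ^ 2 - starRingEnd ℂ z * w‖ := by
  have h := norm_sub_norm_le ((R : ℂ) ^ 2) (starRingEnd ℂ z * w)
  rwa [norm_mul, Complex.norm_conj, norm_pow, Complex.norm_real, Real.norm_eq_abs, sq_abs] at h

lemma norm_sq_sub_conj_mul_pos (h : ‖z‖ * ‖w‖ < R ^ 2) :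
    0 < ‖(R : ℂ) ^ 2 - starRingEnd ℂ z * w‖ :=
  (sub_pos.2 h).trans_le (sq_sub_mul_le_norm_sq_sub_conj_mul R z w)

lemma norm_mul_norm_lt_sq (hz : ‖z‖ < R) (hw : ‖w‖ ≤ R) : ‖z‖ * ‖w‖ < R ^ 2 := by
  nlinarith [norm_nonneg z, norm_nonneg w]

lemma greenRegular_comm (R : ℝ) (z w : ℂ) : greenRegular R z w = greenRegular R w z := by
  rw [greenRegular, greenRegular, norm_sq_sub_conj_mul_comm]

lemma greenRegular_zero (R : ℝ) (z : ℂ) : greenRegular R z 0 = Real.log R := by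
  simp [greenRegular]
  ring

lemma measurable_greenRegular (R : ℝ) : Measurable fun p : ℂ × ℂ => greenRegular R p.1 p.2 := by
  unfold greenRegular
  have hconj : Measurable fun z : ℂ => starRingEnd ℂ z := Complex.continuous_conj.measurable
  fun_prop

lemma continuousAt_greenRegular (hR : 0 < R) (h : ‖z‖ * ‖w‖ < R ^ 2) :
    ContinuousAt (fun p : ℝ × ℂ => greenRegular p.1 z p.2) (R, w) := by
  refine ContinuousAt.sub (ContinuousAt.log ?_ (norm_sq_sub_conj_mul_pos h).ne')
    (continuousAt_fst.log hR.ne')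
  exact Continuous.continuousAt (by fun_prop)

lemma harmonicAt_greenRegular (h : ‖z‖ * ‖w‖ < R ^ 2) : HarmonicAt (greenRegular R z) w :=
  (AnalyticAt.harmonicAt_log_norm (f := fun x => (R : ℂ) ^ 2 - starRingEnd ℂ z * x)
    (by fun_prop) (norm_pos_iff.1 (norm_sq_sub_conj_mul_pos h))).sub (harmonicAt_const _)

lemma harmonicOnNhd_greenRegular (h : ‖z‖ * (‖w‖ + r) < R ^ 2) :
    HarmonicOnNhd (greenRegular R z) (closedBall w r) := fun x hx => by
  refine harmonicAt_greenRegular (lt_of_le_of_lt ?_ h)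
  gcongr
  linarith [norm_le_norm_add_norm_sub' x w, mem_closedBall_iff_norm.1 hx]

lemma log_norm_sub_le_greenRegular (hR : 0 < R) (hz : ‖z‖ ≤ R) (hw : ‖w‖ ≤ R) (h : z ≠ w) :
    Real.log ‖z - w‖ ≤ greenRegular R z w := by
  have hzw : 0 < ‖z - w‖ := norm_pos_iff.2 (sub_ne_zero.2 h)
  rw [greenRegular, le_sub_iff_add_le', ← Real.log_mul hR.ne' hzw.ne']
  exact Real.log_le_log (by positivity) (mul_norm_sub_le_norm_sq_sub_conj_mul hz hw)

lemma log_sub_log_le_greenRegular (hSR : S < R) (hz : ‖z‖ < S) (hw : ‖w‖ < S) :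
    Real.log (R ^ 2 - S ^ 2) - Real.log R ≤ greenRegular R z w := by
  have hS : 0 < S := (norm_nonneg z).trans_lt hz
  refine sub_le_sub_right (Real.log_le_log (by nlinarith)
    (le_trans ?_ (sq_sub_mul_le_norm_sq_sub_conj_mul R z w))) _
  linarith [norm_mul_norm_lt_sq hz hw.le]

lemma greenRegular_le_log_two_mul (hz : ‖z‖ < R) (hw : ‖w‖ < R) :
    greenRegular R z w ≤ Real.log (2 * R) := by
  have hR : 0 < R := (norm_nonneg z).trans_lt hz
  rw [greenRegular, sub_le_iff_le_add, ← Real.log_mul (by positivity) hR.ne']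
  refine Real.log_le_log (norm_sq_sub_conj_mul_pos (norm_mul_norm_lt_sq hz hw.le)) ?_
  calc ‖(R : ℂ) ^ 2 - starRingEnd ℂ z * w‖ ≤ R ^ 2 + ‖z‖ * ‖w‖ := by
        have h := norm_sub_le ((R : ℂ) ^ 2) (starRingEnd ℂ z * w)
        rwa [norm_mul, Complex.norm_conj, norm_pow, Complex.norm_real, Real.norm_eq_abs,
          sq_abs] at h
    _ ≤ 2 * R * R := by linarith [norm_mul_norm_lt_sq hz hw.le]

lemma green_comm (R : ℝ) (z w : ℂ) : green R z w = green R w z := by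
  rw [green, green, greenRegular_comm, norm_sub_rev]

lemma green_zero_right (R : ℝ) (z : ℂ) : green R z 0 = logKernel R z := by
  rw [green, greenRegular_zero, sub_zero, logKernel]

lemma ofReal_log_div_le_green_zero (hR : 0 < R) (hS : 0 < S) (hz : ‖z‖ ≤ S) :
    ENNReal.ofReal (Real.log (R / S)) ≤ green R z 0 := by
  rw [green_zero_right, Real.log_div hR.ne' hS.ne']
  exact ofReal_sub_log_le_posSubLog _ hS hz

lemma measurable_green (R : ℝ) : Measurable fun p : ℂ × ℂ => green R p.1 p.2 := by
  have hpair : Measurable fun p : ℂ × ℂ => (greenRegular R p.1 p.2, ‖p.1 - p.2‖) :=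
    (measurable_greenRegular R).prodMk (by fun_prop)
  exact continuous_posSubLog.measurable.comp hpair

@[fun_prop] lemma measurable_green_left (R : ℝ) (w : ℂ) : Measurable fun z => green R z w :=
  Measurable.of_uncurry_right (f := green R) (measurable_green R)

lemma continuousAt_green (hz : ‖z‖ < R) (hw : ‖w‖ < R) : ContinuousAt (green R z) w := by
  have hreg : ContinuousAt (greenRegular R z) w :=
    (continuousAt_greenRegular ((norm_nonneg z).trans_lt hz) (norm_mul_norm_lt_sq hz hw.le)).comp
      (f := fun w => (R, w)) (by fun_prop)
  exact continuous_posSubLog.continuousAt.comp (hreg.prodMk (by fun_prop))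

lemma green_eq_lcircleMean_add (hr : 0 < r) (hz : ‖z‖ < R) (hw : ‖w‖ + r ≤ R) :
    green R z w = lcircleMean (green R z) w r + logKernel r (z - w) := by
  have hR : 0 < R := (norm_nonneg z).trans_lt hz
  refine posSubLog_eq_lcircleMean_add hr (harmonicOnNhd_greenRegular ?_) fun x hx hxz =>
    log_norm_sub_le_greenRegular hR hz.le ((norm_le_of_mem_sphere hx).trans hw) hxz.symm
  nlinarith [norm_nonneg z]

lemma green_eq_zero (hR : 0 < R) (hz : R ≤ ‖z‖) (hw : ‖w‖ ≤ R) (hzw : z ≠ w)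
    (h : ‖z‖ * ‖w‖ < R ^ 2) : green R z w = 0 := by
  have hpos : 0 < ‖z - w‖ := norm_pos_iff.2 (sub_ne_zero.2 hzw)
  rw [green, posSubLog_of_pos _ hpos, ENNReal.ofReal_eq_zero, sub_nonpos, greenRegular,
    sub_le_iff_le_add', ← Real.log_mul hR.ne' hpos.ne']
  exact Real.log_le_log (norm_sq_sub_conj_mul_pos h)
    (norm_sq_sub_conj_mul_le_mul_norm_sub hR.le hz hw)

lemma indicator_green_le_lcircleMean_add (hr : 0 < r) (hR : 0 < R) (hw : ‖w‖ ≤ R)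
    (h : ‖w‖ * (R + r) < R ^ 2) (z : ℂ) :
    (ball (0 : ℂ) R).indicator (fun z => green R z w) z ≤
      lcircleMean ((ball (0 : ℂ) R).indicator fun z => green R z w) z r + logKernel r (z - w) := by
  by_cases hz : z ∈ ball (0 : ℂ) R
  swap
  · simp [indicator_of_notMem hz]
  have hzR : ‖z‖ < R := by simpa using hz
  rw [indicator_of_mem hz, green_comm, isRadial_logKernel r _ _ (norm_sub_rev z w)]
  refine posSubLog_le_lcircleMean_add hr (harmonicOnNhd_greenRegular ?_) fun x hx hxw => ?_
  · exact lt_of_le_of_lt (by gcongr) h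
  · change green R w x ≤ _
    rw [green_comm]
    by_cases hxR : x ∈ ball (0 : ℂ) R
    · rw [indicator_of_mem hxR]
    · refine (green_eq_zero hR (by simpa using hxR) hw hxw (lt_of_le_of_lt ?_ h)).trans_le zero_le
      rw [mul_comm]
      gcongr
      linarith [norm_le_of_mem_sphere hx]

lemma green_le_logKernel_add (hz : ‖z‖ < R) (hw : ‖w‖ < R) :
    green R z w ≤ logKernel r (z - w) + ENNReal.ofReal (Real.log (2 * R) - Real.log r) :=
  (posSubLog_mono (greenRegular_le_log_two_mul hz hw) le_rfl).trans
    (posSubLog_le_add_ofReal (norm_nonneg _))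

end

/-! ### Continuous minorants of the Green function -/

/-- A continuous minorant of `z ↦ green S z w`, compactly supported in the disc of radius `S`: the
pole is cut off at distance `ε` and the argument of the other logarithm is bounded below by `c`. -/
def greenCut (S c ε : ℝ) (w z : ℂ) : ℝ :=
  max 0 (Real.log (max ‖(S : ℂ) ^ 2 - starRingEnd ℂ z * w‖ c) - Real.log S -
    Real.log (max ‖z - w‖ ε))

section

variable {R S S₁ c ε : ℝ} {z w : ℂ}

lemma continuous_greenCut (S : ℝ) (hc : 0 < c) (hε : 0 < ε) (w : ℂ) :
    Continuous (greenCut S c ε w) := by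
  have hlogReg : Continuous fun z : ℂ => Real.log (max ‖(S : ℂ) ^ 2 - starRingEnd ℂ z * w‖ c) :=
    Continuous.log (by fun_prop) fun z => (lt_max_of_lt_right hc).ne'
  have hlogPole : Continuous fun z : ℂ => Real.log (max ‖z - w‖ ε) :=
    Continuous.log (by fun_prop) fun z => (lt_max_of_lt_right hε).ne'
  unfold greenCut
  fun_prop

lemma greenCut_eq_zero (hS₁ : 0 < S₁) (hS : S₁ < S) (hw : ‖w‖ ≤ S₁) (hz : S ≤ ‖z‖) :
    greenCut S (S * (S - S₁)) ε w z = 0 := by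
  have hS0 : 0 < S := hS₁.trans hS
  have hdist : S - S₁ ≤ ‖z - w‖ := by linarith [norm_sub_norm_le z w]
  have hpos : 0 < max ‖z - w‖ ε := lt_max_of_lt_left (by linarith)
  refine max_eq_left ?_
  rw [sub_sub, sub_nonpos, ← Real.log_mul hS0.ne' hpos.ne']
  refine Real.log_le_log (lt_max_of_lt_right (mul_pos hS0 (sub_pos.2 hS))) ?_
  calc max ‖(S : ℂ) ^ 2 - starRingEnd ℂ z * w‖ (S * (S - S₁)) ≤ S * ‖z - w‖ :=
        max_le (norm_sq_sub_conj_mul_le_mul_norm_sub hS0.le hz (by linarith)) (by gcongr)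
    _ ≤ S * max ‖z - w‖ ε := by gcongr; exact le_max_left _ _

lemma mul_sub_le_norm_sq_sub_conj_mul (hw : ‖w‖ ≤ S₁) (hz : ‖z‖ ≤ S) :
    S * (S - S₁) ≤ ‖(S : ℂ) ^ 2 - starRingEnd ℂ z * w‖ := by
  refine le_trans ?_ (sq_sub_mul_le_norm_sq_sub_conj_mul S z w)
  linarith [mul_le_mul hz hw (norm_nonneg _) ((norm_nonneg _).trans hz)]

lemma ofReal_greenCut (hε : 0 < ε) (hw : ‖w‖ ≤ S₁) (hz : ‖z‖ ≤ S) :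
    ENNReal.ofReal (greenCut S (S * (S - S₁)) ε w z) =
      posSubLog (greenRegular S z w) (max ‖z - w‖ ε) := by
  rw [greenCut, max_eq_left (mul_sub_le_norm_sq_sub_conj_mul hw hz), ENNReal.ofReal_max,
    ENNReal.ofReal_zero, max_eq_right zero_le, posSubLog_of_pos _ (lt_max_of_lt_right hε),
    greenRegular]

lemma ofReal_greenCut_le_green (hε : 0 < ε) (hw : ‖w‖ ≤ S₁) (hz : ‖z‖ ≤ S) :
    ENNReal.ofReal (greenCut S (S * (S - S₁)) ε w z) ≤ green S z w := by
  rw [ofReal_greenCut hε hw hz]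
  exact posSubLog_mono le_rfl (le_max_left _ _)

lemma tendsto_ofReal_greenCut {ι : Type*} {l : Filter ι} {S ε : ι → ℝ} (hR : S₁ < R)
    (hw : ‖w‖ < S₁) (hz : ‖z‖ < S₁) (hS : Tendsto S l (𝓝 R)) (hε : Tendsto ε l (𝓝 0))
    (hε0 : ∀ i, 0 < ε i) :
    Tendsto (fun i => ENNReal.ofReal (greenCut (S i) (S i * (S i - S₁)) (ε i) w z)) l
      (𝓝 (green R z w)) := by
  have hR0 : 0 < R := (norm_nonneg z).trans_lt (hz.trans hR)
  have hreg : Tendsto (fun i => greenRegular (S i) z w) l (𝓝 (greenRegular R z w)) :=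
    Tendsto.comp (f := fun i => (S i, w))
      (continuousAt_greenRegular hR0 (norm_mul_norm_lt_sq (hz.trans hR) (hw.trans hR).le))
      (hS.prodMk_nhds tendsto_const_nhds)
  have hdist : Tendsto (fun i => max ‖z - w‖ (ε i)) l (𝓝 ‖z - w‖) := by
    simpa using (tendsto_const_nhds (x := ‖z - w‖)).max hε
  have hpos : Tendsto (fun i => posSubLog (greenRegular (S i) z w) (max ‖z - w‖ (ε i))) l
      (𝓝 (green R z w)) :=
    Tendsto.comp (f := fun i => (greenRegular (S i) z w, max ‖z - w‖ (ε i)))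
      (continuous_posSubLog.tendsto (greenRegular R z w, ‖z - w‖)) (hreg.prodMk_nhds hdist)
  refine hpos.congr' ?_
  filter_upwards [hS.eventually (lt_mem_nhds hR)] with i hi
  exact (ofReal_greenCut (hε0 i) hw.le (hz.le.trans hi.le)).symm

end

/-! ### The converse of the mean value property -/

section

variable {E F : Type*} [NormedAddCommGroup E] [NormedSpace ℝ E] [NormedAddCommGroup F]
  [NormedSpace ℝ F]

lemma hasFDerivAt_sub_sub_half_smul {f : E → F} {f' : E →L[ℝ] F} {L : E →L[ℝ] E →L[ℝ] F}
    (hL : ∀ x y, L x y = L y x) {z y : E} (hf : DifferentiableAt ℝ f (z + y)) :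
    HasFDerivAt (fun y => f (z + y) - f z - f' y - (1 / 2 : ℝ) • L y y)
      (fderiv ℝ f (z + y) - f' - L y) y := by
  have hquad : HasFDerivAt (fun y => L y y) (L y + L.flip y) y := by
    simpa using (L.hasFDerivAt (x := y)).clm_apply (hasFDerivAt_id y)
  have hflip : L.flip y = L y := by ext x; exact hL x y
  have hhalf : (1 / 2 : ℝ) • (L y + L.flip y) = L y := by
    rw [hflip, ← two_smul ℝ, smul_smul]
    norm_num
  rw [← hhalf]
  have hshift : HasFDerivAt (fun y => f (z + y)) (fderiv ℝ f (z + y)) y :=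
    (hasFDerivAt_comp_add_left z).2 hf.hasFDerivAt
  exact ((hshift.sub_const (f z)).sub f'.hasFDerivAt).sub (hquad.const_smul (1 / 2 : ℝ))

lemma isLittleO_taylor_two {f : E → F} {z : E} (hf : ContDiffAt ℝ 2 f z) :
    (fun h => f (z + h) - f z - fderiv ℝ f z h - (1 / 2 : ℝ) • fderiv ℝ (fderiv ℝ f) z h h)
      =o[𝓝 0] fun h => ‖h‖ ^ 2 := by
  have hsymm : IsSymmSndFDerivAt ℝ f z := hf.isSymmSndFDerivAt (by simp)
  have hfderiv : HasFDerivAt (fderiv ℝ f) (fderiv ℝ (fderiv ℝ f) z) z :=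
    ((hf.fderiv_right (m := 1) (by norm_num)).differentiableAt (by simp)).hasFDerivAt
  have hdiff : ∀ᶠ h in 𝓝 (0 : E), DifferentiableAt ℝ f (z + h) := by
    have hadd : Tendsto (fun h => z + h) (𝓝 0) (𝓝 z) := by
      simpa using (continuous_const_add z).tendsto 0
    exact hadd.eventually
      ((hf.eventually (by simp)).mono fun x hx => hx.differentiableAt (by simp))
  refine Asymptotics.isLittleO_iff.2 fun ε hε => ?_
  obtain ⟨δ, hδ, hball⟩ := Metric.eventually_nhds_iff_ball.1
    (((hasFDerivAt_iff_isLittleO_nhds_zero.1 hfderiv).def hε).and hdiff)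
  filter_upwards [ball_mem_nhds 0 hδ] with h hh
  have hsub : ∀ y ∈ closedBall (0 : E) ‖h‖, y ∈ ball (0 : E) δ := fun y hy => by
    simp only [mem_closedBall_zero_iff, mem_ball_zero_iff] at hy hh ⊢
    exact hy.trans_lt hh
  have hmvt := (convex_closedBall (0 : E) ‖h‖).norm_image_sub_le_of_norm_hasFDerivWithin_le
    (C := ε * ‖h‖) (x := 0) (y := h)
    (fun y hy => (hasFDerivAt_sub_sub_half_smul (f' := fderiv ℝ f z) hsymm
      (hball y (hsub y hy)).2).hasFDerivWithinAt)
    (fun y hy => (hball y (hsub y hy)).1.trans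
      (mul_le_mul_of_nonneg_left (mem_closedBall_zero_iff.1 hy) hε.le)) (by simp) (by simp)
  simpa [pow_two, mul_assoc] using hmvt

end

section

variable {f : ℂ → ℝ} {z : ℂ}

lemma apply_eq_re_mul (l : ℂ →L[ℝ] ℝ) (x : ℂ) :
    l x = ((l 1 - l Complex.I * Complex.I) * x).re := by
  have hx : x = x.re • (1 : ℂ) + x.im • Complex.I := by apply Complex.ext <;> simp
  conv_lhs => rw [hx]
  simp only [map_add, map_smul, smul_eq_mul, Complex.mul_re, Complex.sub_re, Complex.sub_im,
    Complex.mul_im, Complex.ofReal_re, Complex.ofReal_im, Complex.I_re, Complex.I_im]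
  ring

lemma apply_apply_eq_re_mul_sq_add {L : ℂ →L[ℝ] ℂ →L[ℝ] ℝ} (hL : ∀ x y, L x y = L y x) (x : ℂ) :
    L x x = (((L 1 1 - L Complex.I Complex.I) / 2 - L 1 Complex.I * Complex.I : ℂ) * x ^ 2).re +
      (L 1 1 + L Complex.I Complex.I) / 2 * ‖x‖ ^ 2 := by
  have hx : x = x.re • (1 : ℂ) + x.im • Complex.I := by apply Complex.ext <;> simp
  have hexpand : L x x = x.re ^ 2 * L 1 1 + 2 * x.re * x.im * L 1 Complex.I +
      x.im ^ 2 * L Complex.I Complex.I := by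
    conv_lhs => rw [hx]
    simp only [map_add, map_smul, add_apply, smul_apply, smul_eq_mul,
      hL Complex.I 1]
    ring
  have hcoeff : ((L 1 1 - L Complex.I Complex.I) / 2 - L 1 Complex.I * Complex.I : ℂ) =
      ⟨(L 1 1 - L Complex.I Complex.I) / 2, -L 1 Complex.I⟩ := by
    apply Complex.ext <;> simp
  rw [hexpand, hcoeff, ← Complex.normSq_eq_norm_sq, Complex.normSq_apply]
  simp only [pow_two, Complex.mul_re, Complex.mul_im]
  ring

lemma exists_harmonic_isLittleO (hf : ContDiffAt ℝ 2 f z) :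
    ∃ P : ℂ → ℝ, (∀ x, HarmonicAt P x) ∧ P z = f z ∧
      (fun x => f x - P x - Laplacian.laplacian f z / 4 * ‖x - z‖ ^ 2)
        =o[𝓝 z] fun x => ‖x - z‖ ^ 2 := by
  set l := fderiv ℝ f z
  set L := fderiv ℝ (fderiv ℝ f) z
  have hsymm : ∀ x y, L x y = L y x := hf.isSymmSndFDerivAt (by simp)
  have hlap : Laplacian.laplacian f z = L 1 1 + L Complex.I Complex.I := by
    simp [laplacian_eq_iteratedFDeriv_complexPlane, iteratedFDeriv_two_apply, L]
  let b : ℂ := l 1 - l Complex.I * Complex.I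
  let c : ℂ := (L 1 1 - L Complex.I Complex.I) / 2 - L 1 Complex.I * Complex.I
  refine ⟨fun x => (f z + b * (x - z) + c * (x - z) ^ 2 / 2 : ℂ).re,
    fun x => AnalyticAt.harmonicAt_re (by fun_prop), by simp, ?_⟩
  have hsub : Tendsto (fun x => x - z) (𝓝 z) (𝓝 0) := by
    simpa using (continuous_sub_right z).tendsto z
  refine ((isLittleO_taylor_two hf).comp_tendsto hsub).congr_left fun x => ?_
  have hlin : l (x - z) = (b * (x - z)).re := apply_eq_re_mul l (x - z)
  have hquad := apply_apply_eq_re_mul_sq_add hsymm (x - z)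
  simp only [Function.comp_apply, add_sub_cancel, smul_eq_mul, Complex.add_re, Complex.ofReal_re,
    Complex.div_ofNat_re]
  rw [hlin, hquad, hlap]
  ring

lemma laplacian_eq_zero_of_circleAverage_eq (hf : ContDiffAt ℝ 2 f z)
    (hmean : ∀ᶠ r in 𝓝[>] (0 : ℝ), Real.circleAverage f z r = f z) :
    Laplacian.laplacian f z = 0 := by
  obtain ⟨P, hP, hPz, hlittle⟩ := exists_harmonic_isLittleO hf
  set lap := Laplacian.laplacian f z
  refine abs_eq_zero.1 (le_antisymm (le_of_forall_pos_le_add fun ε hε => ?_) (abs_nonneg _))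
  have hnear : ∀ᶠ x in 𝓝 z, ContinuousAt f x ∧
      |f x - P x - lap / 4 * ‖x - z‖ ^ 2| ≤ ε / 4 * ‖x - z‖ ^ 2 := by
    filter_upwards [hf.eventually (by simp), hlittle.def (c := ε / 4) (by positivity)] with x hx hox
    exact ⟨hx.continuousAt, by simpa using hox⟩
  obtain ⟨δ, hδ, hball⟩ := Metric.eventually_nhds_iff.1 hnear
  obtain ⟨r, hr, hrmean, hrδ⟩ := (eventually_mem_nhdsWithin.and
    (hmean.and (nhdsWithin_le_nhds (gt_mem_nhds hδ)))).exists
  have hr : 0 < r := hr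
  have hsphere : ∀ x ∈ sphere z |r|, ContinuousAt f x ∧
      |f x - P x - lap / 4 * r ^ 2| ≤ ε / 4 * r ^ 2 := fun x hx => by
    rw [abs_of_pos hr, mem_sphere] at hx
    simpa [← dist_eq_norm, hx] using hball (hx.trans_lt hrδ)
  have hPint : CircleIntegrable P z r :=
    circleIntegrable_of_harmonicOnNhd hr fun x _ => hP x
  have hfint : CircleIntegrable f z r :=
    ContinuousOn.circleIntegrable' fun x hx => (hsphere x hx).1.continuousWithinAt
  have hzero : Real.circleAverage (fun x => f x - P x) z r = 0 := by
    rw [Real.circleAverage_fun_sub hfint hPint, hrmean,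
      InnerProductSpace.HarmonicOnNhd.circleAverage_eq fun x _ => hP x, hPz, sub_self]
  have hupper := Real.circleAverage_mono_on_of_le_circle (a := (lap + ε) / 4 * r ^ 2)
    (hfint.sub hPint) fun x hx => by
      simp only [Pi.sub_apply]; linarith [(abs_le.1 (hsphere x hx).2).2]
  have hlower := Real.circleAverage_mono (circleIntegrable_const ((lap - ε) / 4 * r ^ 2) z r)
    (hfint.sub hPint) fun x hx => by
      simp only [Pi.sub_apply]; linarith [(abs_le.1 (hsphere x hx).2).1]
  rw [Real.circleAverage_const] at hlower
  have hr2 : 0 < r ^ 2 := by positivity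
  rw [zero_add, abs_le]
  constructor
  · nlinarith [hzero.symm.trans_le hupper]
  · nlinarith [hlower.trans_eq hzero]

end

/-! ### Radial mollifiers -/

/-- A smooth radial function which is positive exactly on the disc of radius `δ`. -/
def bump (δ : ℝ) (z : ℂ) : ℝ := Real.smoothTransition (1 - ‖z‖ ^ 2 / δ ^ 2)

/-- The smooth radial probability density proportional to `bump δ`. -/
def realMollifier (δ : ℝ) (z : ℂ) : ℝ := bump δ z / ∫ y, bump δ y

/-- `realMollifier` as a `[0, ∞]`-valued weight. -/
def mollifier (δ : ℝ) (z : ℂ) : ℝ≥0∞ := ENNReal.ofReal (realMollifier δ z)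

section

variable {δ r : ℝ} {z w : ℂ} {f : ℂ → ℝ≥0∞}

lemma contDiff_bump {n : ℕ∞} (δ : ℝ) : ContDiff ℝ n (bump δ) :=
  Real.smoothTransition.contDiff.comp (contDiff_const.sub ((contDiff_norm_sq ℝ).div_const _))

lemma bump_nonneg (δ : ℝ) (z : ℂ) : 0 ≤ bump δ z := Real.smoothTransition.nonneg _

lemma bump_ne_zero_iff (hδ : 0 < δ) : bump δ z ≠ 0 ↔ ‖z‖ < δ := by
  rw [bump, ne_eq, Real.smoothTransition.zero_iff_nonpos, not_le, sub_pos,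
    div_lt_one (by positivity), sq_lt_sq₀ (norm_nonneg _) hδ.le]

lemma hasCompactSupport_bump (hδ : 0 < δ) : HasCompactSupport (bump δ) :=
  HasCompactSupport.intro (isCompact_closedBall 0 δ) fun z hz => by
    by_contra h
    exact hz (by simpa using ((bump_ne_zero_iff hδ).1 h).le)

lemma integral_bump_pos (hδ : 0 < δ) : 0 < ∫ y, bump δ y :=
  (contDiff_bump (n := 0) δ).continuous.integral_pos_of_hasCompactSupport_nonneg_nonzero
    (hasCompactSupport_bump hδ) (bump_nonneg δ) ((bump_ne_zero_iff (z := 0) hδ).2 (by simpa))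

lemma contDiff_realMollifier {n : ℕ∞} (δ : ℝ) : ContDiff ℝ n (realMollifier δ) :=
  (contDiff_bump δ).div_const _

lemma continuous_realMollifier (δ : ℝ) : Continuous (realMollifier δ) :=
  (contDiff_realMollifier (n := 0) δ).continuous

lemma hasCompactSupport_realMollifier (hδ : 0 < δ) : HasCompactSupport (realMollifier δ) :=
  (hasCompactSupport_bump hδ).mul_right (f' := fun _ => (∫ y, bump δ y)⁻¹)

lemma realMollifier_nonneg (hδ : 0 < δ) (z : ℂ) : 0 ≤ realMollifier δ z :=
  div_nonneg (bump_nonneg δ z) (integral_bump_pos hδ).le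

lemma realMollifier_neg (δ : ℝ) (z : ℂ) : realMollifier δ (-z) = realMollifier δ z := by
  simp [realMollifier, bump]

lemma isRadialDensity_mollifier (hδ : 0 < δ) : IsRadialDensity (mollifier δ) δ where
  measurable := (continuous_realMollifier δ).measurable.ennreal_ofReal
  isRadial z w h := by simp [mollifier, realMollifier, bump, h]
  lintegral_eq_one := by
    have hint : Integrable (realMollifier δ) :=
      (continuous_realMollifier δ).integrable_of_hasCompactSupport
        (hasCompactSupport_realMollifier hδ)
    simp only [mollifier]
    rw [← ofReal_integral_eq_lintegral_ofReal hint (.of_forall (realMollifier_nonneg hδ))]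
    simp only [realMollifier]
    rw [integral_div, div_self (integral_bump_pos hδ).ne', ENNReal.ofReal_one]
  norm_lt z h := by
    refine (bump_ne_zero_iff hδ).1 fun h0 => h ?_
    simp [mollifier, realMollifier, h0]

lemma weightedMean_mollifier_ne_top (hδ : 0 < δ) (hint : ∫⁻ z, f z ≠ ⊤) (w : ℂ) :
    weightedMean (mollifier δ) f w ≠ ⊤ := by
  obtain ⟨C, hC⟩ := (hasCompactSupport_realMollifier hδ).exists_bound_of_continuous
    (continuous_realMollifier δ)
  refine ne_top_of_le_ne_top (ENNReal.mul_ne_top (ENNReal.ofReal_ne_top (r := C)) hint) ?_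
  calc weightedMean (mollifier δ) f w
      ≤ ∫⁻ z, ENNReal.ofReal C * f (w + z) := lintegral_mono fun z =>
        mul_le_mul_left (ENNReal.ofReal_le_ofReal ((Real.le_norm_self _).trans (hC z))) _
    _ = ENNReal.ofReal C * ∫⁻ z, f z := by
        rw [lintegral_const_mul' _ _ ENNReal.ofReal_ne_top, lintegral_add_left_eq_self f w]

lemma ofReal_toReal_weightedMean_mollifier (hδ : 0 < δ) (hint : ∫⁻ z, f z ≠ ⊤) (w : ℂ) :
    ENNReal.ofReal (weightedMean (mollifier δ) f w).toReal = weightedMean (mollifier δ) f w :=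
  ENNReal.ofReal_toReal (weightedMean_mollifier_ne_top hδ hint w)

lemma toReal_weightedMean_mollifier (hδ : 0 < δ) (hf : Measurable f) (hint : ∫⁻ z, f z ≠ ⊤)
    (w : ℂ) : (weightedMean (mollifier δ) f w).toReal =
      convolution (fun z => (f z).toReal) (realMollifier δ) (ContinuousLinearMap.mul ℝ ℝ)
        volume w := by
  have hmeas : Measurable fun z => mollifier δ (z - w) * f z :=
    ((isRadialDensity_mollifier hδ).measurable.comp (measurable_sub_const w)).mul hf
  rw [convolution_def, weightedMean_eq_lintegral_sub, ← integral_toReal hmeas.aemeasurable]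
  · refine integral_congr_ae (.of_forall fun z => ?_)
    simp only [ENNReal.toReal_mul, ContinuousLinearMap.mul_apply']
    rw [mollifier, ENNReal.toReal_ofReal (realMollifier_nonneg hδ _), ← realMollifier_neg, neg_sub,
      mul_comm]
  · refine ae_lt_top hmeas ?_
    rw [← weightedMean_eq_lintegral_sub]
    exact weightedMean_mollifier_ne_top hδ hint w

lemma contDiff_toReal_weightedMean_mollifier {n : ℕ∞} (hδ : 0 < δ) (hf : Measurable f)
    (hint : ∫⁻ z, f z ≠ ⊤) : ContDiff ℝ n fun w => (weightedMean (mollifier δ) f w).toReal := by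
  have hloc : LocallyIntegrable fun z => (f z).toReal :=
    (integrable_toReal_of_lintegral_ne_top hf.aemeasurable hint).locallyIntegrable
  simp only [toReal_weightedMean_mollifier hδ hf hint]
  exact (hasCompactSupport_realMollifier hδ).contDiff_convolution_right
    (ContinuousLinearMap.mul ℝ ℝ) hloc (contDiff_realMollifier δ)

lemma continuous_weightedMean_mollifier (hδ : 0 < δ) (hf : Measurable f)
    (hint : ∫⁻ z, f z ≠ ⊤) : Continuous (weightedMean (mollifier δ) f) :=
  (ENNReal.continuous_ofReal.comp
    (contDiff_toReal_weightedMean_mollifier (n := 0) hδ hf hint).continuous).congr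
    (ofReal_toReal_weightedMean_mollifier hδ hint)

lemma lcircleMean_weightedMean_mollifier (hδ : 0 < δ) (hf : Measurable f) (hint : ∫⁻ z, f z ≠ ⊤)
    (w : ℂ) (hr : 0 < r) : lcircleMean (weightedMean (mollifier δ) f) w r =
      ENNReal.ofReal
        (Real.circleAverage (fun x => (weightedMean (mollifier δ) f x).toReal) w r) :=
  lcircleMean_eq_ofReal w hr
    ((contDiff_toReal_weightedMean_mollifier (n := 0) hδ hf
      hint).continuous.continuousOn.circleIntegrable hr.le)
    (fun _ _ _ => ENNReal.toReal_nonneg)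
    fun x _ _ => (ofReal_toReal_weightedMean_mollifier hδ hint x).symm

end

/-! ### Vague limits of bounded families of measures -/

/-- The measures `ν i` converge to `μ` along `l` when tested against nonnegative continuous
functions with compact support. -/
def VaguelyTendsto {X ι : Type*} [TopologicalSpace X] [MeasurableSpace X] (ν : ι → Measure X)
    (l : Filter ι) (μ : Measure X) : Prop :=
  ∀ f : X → ℝ, Continuous f → HasCompactSupport f → (∀ z, 0 ≤ f z) →
    Tendsto (fun i => ∫⁻ z, ENNReal.ofReal (f z) ∂ν i) l (𝓝 (∫⁻ z, ENNReal.ofReal (f z) ∂μ))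

section

open CompactlySupported

variable {X ι : Type*} [TopologicalSpace X] [MeasurableSpace X] {ν : ι → Measure X} {C : ℝ≥0∞}

lemma exists_tendsto_integral_of_measure_univ_le (U : Ultrafilter ι) (hC : C ≠ ⊤)
    (hν : ∀ i, ν i univ ≤ C) (f : C_c(X, ℝ)) :
    ∃ y, Tendsto (fun i => ∫ z, f z ∂ν i) U (𝓝 y) := by
  have hfin : ∀ i, IsFiniteMeasure (ν i) := fun i => ⟨(hν i).trans_lt hC.lt_top⟩
  obtain ⟨M, hM⟩ := f.hasCompactSupport.exists_bound_of_continuous f.continuous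
  have hbound : ∀ i, ∫ z, f z ∂ν i ∈ closedBall (0 : ℝ) (|M| * C.toReal) := fun i => by
    rw [mem_closedBall_zero_iff]
    refine (norm_integral_le_of_norm_le_const (C := |M|)
      (.of_forall fun z => (hM z).trans (le_abs_self M))).trans ?_
    gcongr
    exact ENNReal.toReal_mono hC (hν i)
  obtain ⟨y, -, hy⟩ := (isCompact_closedBall (0 : ℝ) (|M| * C.toReal)).ultrafilter_le_nhds
    (U.map fun i => ∫ z, f z ∂ν i) (le_principal_iff.2 (Ultrafilter.mem_map.2 (univ_mem' hbound)))
  exact ⟨y, hy⟩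

variable [BorelSpace X]

lemma exists_positiveLinearMap_tendsto_integral (U : Ultrafilter ι) (hC : C ≠ ⊤)
    (hν : ∀ i, ν i univ ≤ C) :
    ∃ Λ : C_c(X, ℝ) →ₚ[ℝ] ℝ, ∀ f : C_c(X, ℝ), Tendsto (fun i => ∫ z, f z ∂ν i) U (𝓝 (Λ f)) := by
  have hfin : ∀ i, IsFiniteMeasure (ν i) := fun i => ⟨(hν i).trans_lt hC.lt_top⟩
  have hint : ∀ (f : C_c(X, ℝ)) (i), Integrable f (ν i) := fun f i =>
    f.continuous.integrable_of_hasCompactSupport f.hasCompactSupport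
  choose Λ hΛ using exists_tendsto_integral_of_measure_univ_le U hC hν
  have hadd : ∀ f g, Λ (f + g) = Λ f + Λ g := fun f g =>
    tendsto_nhds_unique (hΛ (f + g)) <| ((hΛ f).add (hΛ g)).congr fun i =>
      (integral_add (hint f i) (hint g i)).symm
  have hsmul : ∀ (c : ℝ) f, Λ (c • f) = c • Λ f := fun c f =>
    tendsto_nhds_unique (hΛ (c • f)) <| ((hΛ f).const_smul c).congr fun i =>
      (integral_smul c f).symm
  exact ⟨PositiveLinearMap.mk₀ { toFun := Λ, map_add' := hadd, map_smul' := hsmul }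
    fun f hf => ge_of_tendsto' (hΛ f) fun i => integral_nonneg hf, hΛ⟩

lemma exists_vaguelyTendsto [T2Space X] [LocallyCompactSpace X] (U : Ultrafilter ι)
    (hC : C ≠ ⊤) (hν : ∀ i, ν i univ ≤ C) :
    ∃ μ : Measure X, IsFiniteMeasureOnCompacts μ ∧ VaguelyTendsto ν U μ := by
  have hfin : ∀ i, IsFiniteMeasure (ν i) := fun i => ⟨(hν i).trans_lt hC.lt_top⟩
  obtain ⟨Λ, hΛ⟩ := exists_positiveLinearMap_tendsto_integral U hC hν
  refine ⟨RealRMK.rieszMeasure Λ, inferInstance, fun f hf hfsupp hf0 => ?_⟩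
  have hofReal : ∀ (m : Measure X) [IsFiniteMeasureOnCompacts m],
      ENNReal.ofReal (∫ z, f z ∂m) = ∫⁻ z, ENNReal.ofReal (f z) ∂m := fun m _ =>
    ofReal_integral_eq_lintegral_ofReal (hf.integrable_of_hasCompactSupport hfsupp)
      (.of_forall hf0)
  let fc : C_c(X, ℝ) := ⟨⟨f, hf⟩, hfsupp⟩
  have hrep : ∫ z, f z ∂(RealRMK.rieszMeasure Λ) = Λ fc := RealRMK.integral_rieszMeasure Λ fc
  rw [← hofReal, hrep]
  exact (ENNReal.tendsto_ofReal (hΛ fc)).congr fun i => hofReal (ν i)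

end

/-! ### Superharmonic functions and their mean value defects -/

/-- `p` is superharmonic and nonnegative on the disc of radius `R`, vanishes outside it, and is
finite at the centre. -/
structure IsSuperharmonicDisc (p : ℂ → ℝ≥0∞) (R : ℝ) : Prop where
  lsc : LowerSemicontinuous p
  mean : ∀ (z : ℂ) (r : ℝ), 0 < r → ‖z‖ + r < R → lcircleMean p z r ≤ p z
  outside : ∀ z, R ≤ ‖z‖ → p z = 0
  finite : p 0 ≠ ⊤

/-- The amount by which the value of `p` at `z` exceeds its mean over the circle of radius `r`. -/
def defect (p : ℂ → ℝ≥0∞) (r : ℝ) (z : ℂ) : ℝ≥0∞ := p z - lcircleMean p z r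

@[fun_prop] lemma measurable_defect {p : ℂ → ℝ≥0∞} (hp : Measurable p) (r : ℝ) :
    Measurable (defect p r) := by
  unfold defect; fun_prop

namespace IsSuperharmonicDisc

variable {p α : ℂ → ℝ≥0∞} {R S r ρ δ : ℝ} {w : ℂ}

lemma measurable (hp : IsSuperharmonicDisc p R) : Measurable p := hp.lsc.measurable

lemma defect_add {z : ℂ} (hp : IsSuperharmonicDisc p R) (hr : 0 < r) (hz : ‖z‖ + r < R) :
    defect p r z + lcircleMean p z r = p z :=
  tsub_add_cancel_of_le (hp.mean z r hr hz)

lemma lintegral_ne_top (hp : IsSuperharmonicDisc p R) : ∫⁻ z, p z ≠ ⊤ := by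
  set a : ℂ → ℝ≥0∞ := (ball (0 : ℂ) R).indicator 1 with ha_def
  have ha : Measurable a := measurable_one.indicator measurableSet_ball
  have hrad : IsRadial a := fun z w h => by simp [a, indicator, h]
  have hlt : ∀ z, a z ≠ 0 → ‖z‖ < R := fun z hz => by
    simpa using mem_of_indicator_ne_zero hz
  have heq : ∫⁻ z, p z = weightedMean a p 0 := by
    refine lintegral_congr fun z => ?_
    by_cases hz : ‖z‖ < R
    · simp [a, hz]
    · simp [a, hp.outside z (not_lt.1 hz)]
  have hvol : ∫⁻ z, a z ≠ ⊤ := by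
    rw [ha_def, lintegral_indicator_one measurableSet_ball]
    exact measure_ball_lt_top.ne
  rw [heq]
  exact ne_top_of_le_ne_top (ENNReal.mul_ne_top hvol hp.finite)
    (hrad.weightedMean_le ha hp.measurable fun z h0 hz =>
      hp.mean 0 _ (norm_pos_iff.2 h0) (by simpa using hlt z hz))

lemma weightedMean_logKernel_le (hp : IsSuperharmonicDisc p R) (hr : 0 < r) (hw : ‖w‖ + r ≤ R) :
    weightedMean (logKernel r) p w ≤ (∫⁻ z, logKernel r z) * p w :=
  (isRadial_logKernel r).weightedMean_le (measurable_logKernel r) hp.measurable fun z h0 hz =>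
    hp.mean w _ (norm_pos_iff.2 h0) (by linarith [norm_lt_of_logKernel_ne_zero hr hz])

lemma weightedMean_logKernel_ne_top (hp : IsSuperharmonicDisc p R) (hr : 0 < r)
    (hw : ‖w‖ + r ≤ R) (hpw : p w ≠ ⊤) : weightedMean (logKernel r) p w ≠ ⊤ :=
  ne_top_of_le_ne_top (ENNReal.mul_ne_top (lintegral_logKernel_ne_top hr) hpw)
    (hp.weightedMean_logKernel_le hr hw)

lemma lcircleMean_weightedMean_le (hp : IsSuperharmonicDisc p R) (hα : IsRadialDensity α δ)
    (hr : 0 < r) (hw : ‖w‖ + δ + r ≤ R) :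
    lcircleMean (weightedMean α p) w r ≤ weightedMean α p w := by
  rw [lcircleMean_weightedMean hα.measurable hp.measurable]
  refine weightedMean_mono fun z hz => hp.mean _ _ hr ?_
  linarith [norm_add_le w z, hα.norm_lt z hz]

lemma lintegral_green_mul_ne_top (hp : IsSuperharmonicDisc p R) (hSR : S ≤ R) (hw : ‖w‖ < S)
    (hpw : p w ≠ ⊤) : ∫⁻ z in ball 0 S, green S z w * p z ≠ ⊤ := by
  have hpm := hp.measurable
  have hs : 0 < R - ‖w‖ := by linarith
  set c := ENNReal.ofReal (Real.log (2 * S) - Real.log (R - ‖w‖))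
  refine ne_top_of_le_ne_top (ENNReal.add_ne_top.2
    ⟨hp.weightedMean_logKernel_ne_top hs (by simp) hpw,
      ENNReal.mul_ne_top (a := c) ENNReal.ofReal_ne_top hp.lintegral_ne_top⟩) ?_
  calc ∫⁻ z in ball 0 S, green S z w * p z
      ≤ ∫⁻ z in ball 0 S, (logKernel (R - ‖w‖) (z - w) * p z + c * p z) := by
        refine setLIntegral_mono' measurableSet_ball fun z hz => ?_
        rw [← add_mul]
        exact mul_le_mul_left (green_le_logKernel_add (mem_ball_zero_iff.1 hz) hw) _
    _ ≤ ∫⁻ z, (logKernel (R - ‖w‖) (z - w) * p z + c * p z) := setLIntegral_le_lintegral _ _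
    _ = weightedMean (logKernel (R - ‖w‖)) p w + c * ∫⁻ z, p z := by
        rw [weightedMean_eq_lintegral_sub, lintegral_add_left (by fun_prop),
          lintegral_const_mul _ hpm]

lemma lintegral_green_mul_le (hp : IsSuperharmonicDisc p R) (hw : ‖w‖ < S) (hr : 0 < r)
    (hrR : S + r ≤ R) (h : ‖w‖ * (S + r) < S ^ 2) :
    ∫⁻ z in ball 0 S, green S z w * p z ≤
      (∫⁻ z in ball 0 S, green S z w * lcircleMean p z r) + (∫⁻ z, logKernel r z) * p w := by
  have hpm := hp.measurable
  have hS : 0 < S := (norm_nonneg w).trans_lt hw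
  set φ : ℂ → ℝ≥0∞ := (ball (0 : ℂ) S).indicator fun z => green S z w
  have hφm : Measurable φ := (measurable_green_left S w).indicator measurableSet_ball
  have restrict_eq (f : ℂ → ℝ≥0∞) : ∫⁻ z in ball 0 S, green S z w * f z = ∫⁻ z, φ z * f z := by
    rw [← lintegral_indicator measurableSet_ball]
    simp only [φ, indicator_mul_left]
  have move_mean : ∫⁻ z, lcircleMean φ z r * p z = ∫⁻ z, φ z * lcircleMean p z r := by
    simpa only [weightedMean, zero_add] using weightedMean_lcircleMean_left hφm hpm 0 r
  rw [restrict_eq, restrict_eq]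
  calc ∫⁻ z, φ z * p z
      ≤ ∫⁻ z, (lcircleMean φ z r * p z + logKernel r (z - w) * p z) := by
        refine lintegral_mono fun z => ?_
        rw [← add_mul]
        exact mul_le_mul_left (indicator_green_le_lcircleMean_add hr hS hw.le h z) _
    _ = (∫⁻ z, φ z * lcircleMean p z r) + weightedMean (logKernel r) p w := by
        rw [lintegral_add_left (by fun_prop), move_mean, weightedMean_eq_lintegral_sub]
    _ ≤ (∫⁻ z, φ z * lcircleMean p z r) + (∫⁻ z, logKernel r z) * p w := by
        gcongr
        exact hp.weightedMean_logKernel_le hr (by linarith)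

lemma lintegral_green_mul_defect_le (hp : IsSuperharmonicDisc p R) (hw : ‖w‖ < S) (hr : 0 < r)
    (hrR : S + r ≤ R) (h : ‖w‖ * (S + r) < S ^ 2) :
    ∫⁻ z in ball 0 S, green S z w * defect p r z ≤ (∫⁻ z, logKernel r z) * p w := by
  have hpm := hp.measurable
  rcases eq_or_ne (p w) ⊤ with hpw | hpw
  · rw [hpw, ENNReal.mul_top (lintegral_logKernel_ne_zero hr)]
    exact le_top
  have hsplit : (∫⁻ z in ball 0 S, green S z w * lcircleMean p z r) +
      ∫⁻ z in ball 0 S, green S z w * defect p r z = ∫⁻ z in ball 0 S, green S z w * p z := by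
    rw [← lintegral_add_left (by fun_prop)]
    refine setLIntegral_congr_fun measurableSet_ball fun z hz => ?_
    have hzr : ‖z‖ + r < R := by linarith [mem_ball_zero_iff.1 hz]
    simp only [← mul_add, add_comm (lcircleMean p z r), hp.defect_add hr hzr]
  have hfin : ∫⁻ z in ball 0 S, green S z w * lcircleMean p z r ≠ ⊤ :=
    ne_top_of_le_ne_top (hp.lintegral_green_mul_ne_top (by linarith) hw hpw)
      (hsplit ▸ le_self_add)
  refine (ENNReal.add_le_add_iff_left hfin).1 ?_
  rw [hsplit]
  exact hp.lintegral_green_mul_le hw hr hrR h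

lemma weightedMean_logKernel_eq_add (hp : IsSuperharmonicDisc p R) (hα : IsRadialDensity α δ)
    (hr : 0 < r) (hρ : 0 < ρ) (hw : ‖w‖ + ρ + δ + r ≤ R) :
    weightedMean (logKernel ρ) (weightedMean α p) w =
      weightedMean (weightedMean α (logKernel ρ)) (defect p r) w +
        weightedMean (logKernel ρ) (fun x => lcircleMean (weightedMean α p) x r) w := by
  have hpm := hp.measurable
  have hαm := hα.measurable
  rw [← hα.isRadial.weightedMean_weightedMean hαm (by fun_prop) (by fun_prop),
    weightedMean_comm hαm (by fun_prop) (by fun_prop),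
    ← weightedMean_add (by fun_prop) (by fun_prop)]
  refine weightedMean_congr fun x hx => ?_
  rw [lcircleMean_weightedMean hαm hpm, ← weightedMean_add hαm (by fun_prop)]
  refine weightedMean_congr fun y hy => (hp.defect_add hr ?_).symm
  linarith [norm_add_le (w + x) y, norm_add_le w x, norm_lt_of_logKernel_ne_zero hρ hx,
    hα.norm_lt y hy]

/-- Exchanging the roles of `r` and `ρ` in the mean value defects turns defects of `p` at scale `r`
into defects of a regularisation of `p` at scale `ρ`. -/
lemma weightedMean_defect_add (hp : IsSuperharmonicDisc p R) (hα : IsRadialDensity α δ)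
    (hr : 0 < r) (hρ : 0 < ρ) (hw : ‖w‖ + ρ + δ + r ≤ R)
    (hfin : weightedMean (logKernel ρ) (weightedMean α p) w ≠ ⊤) :
    weightedMean (weightedMean α (logKernel ρ)) (defect p r) w +
        weightedMean (logKernel r) (fun x => lcircleMean (weightedMean α p) x ρ) w =
      weightedMean (logKernel r) (weightedMean α p) w := by
  have hpm := hp.measurable
  have hαm := hα.measurable
  set u := weightedMean α p
  have hum : Measurable u := by fun_prop
  have hsymm : weightedMean (logKernel ρ) u w +
        weightedMean (logKernel r) (fun x => lcircleMean u x ρ) w =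
      weightedMean (logKernel ρ) (fun x => lcircleMean u x r) w +
        weightedMean (logKernel r) u w := by
    rw [← weightedMean_lcircleMean_left (by fun_prop) hum,
      ← weightedMean_lcircleMean_left (by fun_prop) hum,
      ← weightedMean_add_left (by fun_prop) hum, ← weightedMean_add_left (by fun_prop) hum]
    simp only [logKernel_add_lcircleMean_logKernel hr hρ]
  have hsplit := hp.weightedMean_logKernel_eq_add hα hr hρ hw
  have hfin' : weightedMean (logKernel ρ) (fun x => lcircleMean u x r) w ≠ ⊤ :=
    ne_top_of_le_ne_top hfin (hsplit ▸ le_add_self)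
  refine (ENNReal.add_right_inj hfin').1 ?_
  rw [← hsymm, hsplit]
  ring

lemma weightedMean_logKernel_mollifier_ne_top (hp : IsSuperharmonicDisc p R) (hρ : 0 < ρ)
    (hδ : 0 < δ) (w : ℂ) : weightedMean (logKernel ρ) (weightedMean (mollifier δ) p) w ≠ ⊤ := by
  have hpm := hp.measurable
  rw [weightedMean_comm (by fun_prop) (isRadialDensity_mollifier hδ).measurable hpm]
  refine weightedMean_mollifier_ne_top hδ ?_ w
  rw [lintegral_weightedMean (by fun_prop) hpm]
  exact ENNReal.mul_ne_top (lintegral_logKernel_ne_top hρ) hp.lintegral_ne_top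

end IsSuperharmonicDisc

/-! ### The Riesz measure -/

/-- The logarithmic kernel normalised to a probability density. -/
def logDensity (r : ℝ) (z : ℂ) : ℝ≥0∞ := (∫⁻ y, logKernel r y)⁻¹ * logKernel r z

/-- The mean value defect of `p` at scale `r`, as a measure on the closed disc of radius `S`,
normalised so that its potentials stay bounded as `r → 0`. -/
def defectMeasure (p : ℂ → ℝ≥0∞) (S r : ℝ) : Measure ℂ :=
  (∫⁻ z, logKernel r z)⁻¹ • (volume.restrict (closedBall 0 S)).withDensity (defect p r)

section

variable {p f : ℂ → ℝ≥0∞} {R R₁ S S₁ r : ℝ} {w : ℂ}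

lemma isRadialDensity_logDensity (hr : 0 < r) : IsRadialDensity (logDensity r) r where
  measurable := (measurable_logKernel r).const_mul _
  isRadial z w h := by rw [logDensity, logDensity, isRadial_logKernel r z w h]
  lintegral_eq_one := by
    simp only [logDensity]
    rw [lintegral_const_mul _ (measurable_logKernel r),
      ENNReal.inv_mul_cancel (lintegral_logKernel_ne_zero hr) (lintegral_logKernel_ne_top hr)]
  norm_lt _ hz := norm_lt_of_logKernel_ne_zero hr (mul_ne_zero_iff.1 hz).2

lemma weightedMean_logDensity (hf : Measurable f) (r : ℝ) (w : ℂ) :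
    weightedMean (logDensity r) f w =
      (∫⁻ z, logKernel r z)⁻¹ * weightedMean (logKernel r) f w := by
  simp only [weightedMean, logDensity, mul_assoc]
  exact lintegral_const_mul _ (by fun_prop)

lemma lintegral_defectMeasure (hp : Measurable p) (S r : ℝ) (hf : Measurable f) :
    ∫⁻ z, f z ∂defectMeasure p S r =
      (∫⁻ z, logKernel r z)⁻¹ * ∫⁻ z in closedBall 0 S, f z * defect p r z := by
  rw [defectMeasure, lintegral_smul_measure,
    lintegral_withDensity_eq_lintegral_mul _ (measurable_defect hp r) hf, smul_eq_mul]
  simp only [Pi.mul_apply, mul_comm]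

lemma ae_defectMeasure_norm_le (p : ℂ → ℝ≥0∞) (S r : ℝ) :
    ∀ᵐ z ∂defectMeasure p S r, ‖z‖ ≤ S := by
  have hrestrict : ∀ᵐ z ∂volume.restrict (closedBall (0 : ℂ) S), ‖z‖ ≤ S := by
    filter_upwards [ae_restrict_mem measurableSet_closedBall] with z hz
    exact mem_closedBall_zero_iff.1 hz
  exact Measure.ae_smul_measure ((withDensity_absolutelyContinuous _ _).ae_le hrestrict) _

lemma lintegral_sub_defectMeasure (hp : Measurable p) (hf : Measurable f) (r : ℝ)
    (hsupp : ∀ z, f z ≠ 0 → ‖w‖ + ‖z‖ ≤ S) :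
    ∫⁻ z, f (z - w) ∂defectMeasure p S r =
      (∫⁻ z, logKernel r z)⁻¹ * weightedMean f (defect p r) w := by
  rw [lintegral_defectMeasure hp _ _ (by fun_prop), weightedMean_eq_lintegral_sub,
    setLIntegral_eq_of_support_subset]
  intro z hz
  have hz' := hsupp (z - w) (mul_ne_zero_iff.1 hz).1
  have hnorm : ‖z‖ ≤ ‖w‖ + ‖z - w‖ := by simpa using norm_add_le w (z - w)
  simpa using hnorm.trans hz'

lemma VaguelyTendsto.lintegral_weightedMean_mollifier {ι : Type*} {l : Filter ι}
    {ν : ι → Measure ℂ} {μ : Measure ℂ} {ρ δ : ℝ} (hμ : VaguelyTendsto ν l μ) (hρ : 0 < ρ)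
    (hδ : 0 < δ) (w : ℂ) :
    Tendsto (fun i => ∫⁻ z, weightedMean (mollifier δ) (logKernel ρ) (z - w) ∂ν i) l
      (𝓝 (∫⁻ z, weightedMean (mollifier δ) (logKernel ρ) (z - w) ∂μ)) := by
  have hfin := lintegral_logKernel_ne_top hρ
  set κ := weightedMean (mollifier δ) (logKernel ρ)
  have hcont : Continuous fun z => (κ (z - w)).toReal :=
    (contDiff_toReal_weightedMean_mollifier (n := 0) hδ (measurable_logKernel ρ)
      hfin).continuous.comp (continuous_sub_right w)
  have hsupp : HasCompactSupport fun z => (κ (z - w)).toReal := by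
    refine HasCompactSupport.intro (isCompact_closedBall w (ρ + δ)) fun z hz => ?_
    contrapose! hz
    have hne : κ (z - w) ≠ 0 := fun h => hz (by simp [h])
    have hnorm := norm_lt_of_weightedMean_ne_zero (isRadialDensity_mollifier hδ).norm_lt
      (fun z => norm_lt_of_logKernel_ne_zero hρ) hne
    simpa [dist_eq_norm] using hnorm.le
  simpa only [κ, ofReal_toReal_weightedMean_mollifier hδ hfin] using
    hμ _ hcont hsupp fun z => ENNReal.toReal_nonneg

namespace IsSuperharmonicDisc

lemma lintegral_green_defectMeasure_le (hp : IsSuperharmonicDisc p R) (hS : S₁ < S) (hw : ‖w‖ < S)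
    (hr : 0 < r) (hrR : S + r ≤ R) (h : ‖w‖ * (S + r) < S ^ 2) :
    ∫⁻ z, green S z w ∂defectMeasure p S₁ r ≤ p w := by
  have hI0 := lintegral_logKernel_ne_zero hr
  have hI := lintegral_logKernel_ne_top hr
  rw [lintegral_defectMeasure hp.measurable _ _ (by fun_prop), mul_comm, ← div_eq_mul_inv,
    ENNReal.div_le_iff hI0 hI, mul_comm (p w)]
  exact (lintegral_mono_set (closedBall_subset_ball hS)).trans
    (hp.lintegral_green_mul_defect_le hw hr hrR h)

lemma defectMeasure_univ_le (hp : IsSuperharmonicDisc p R) (hS₁ : 0 < S₁) (hS : S₁ < S)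
    (hr : 0 < r) (hrR : S + r ≤ R) :
    defectMeasure p S₁ r univ ≤ p 0 / ENNReal.ofReal (Real.log (S / S₁)) := by
  have hS0 : 0 < S := hS₁.trans hS
  have hlog : 0 < Real.log (S / S₁) := Real.log_pos ((one_lt_div hS₁).2 hS)
  rw [ENNReal.le_div_iff_mul_le (.inl (ENNReal.ofReal_pos.2 hlog).ne') (.inl (by simp)), mul_comm]
  calc ENNReal.ofReal (Real.log (S / S₁)) * defectMeasure p S₁ r univ
      = ∫⁻ _, ENNReal.ofReal (Real.log (S / S₁)) ∂defectMeasure p S₁ r := (lintegral_const _).symm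
    _ ≤ ∫⁻ z, green S z 0 ∂defectMeasure p S₁ r := by
        refine lintegral_mono_ae ?_
        filter_upwards [ae_defectMeasure_norm_le p S₁ r] with z hz
        exact ofReal_log_div_le_green_zero hS0 hS₁ hz
    _ ≤ p 0 :=
        hp.lintegral_green_defectMeasure_le hS (by simpa) hr hrR (by simpa using by positivity)

section VagueLimit

variable {ι : Type*} {l : Filter ι} [l.NeBot] {s : ι → ℝ} {μ : Measure ℂ}

lemma lintegral_greenCut_le (hp : IsSuperharmonicDisc p R) (hs : Tendsto s l (𝓝[>] 0))
    (hμ : VaguelyTendsto (fun i => defectMeasure p R₁ (s i)) l μ) (hR₁S : R₁ < S) (hSR : S < R)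
    (hw : ‖w‖ < R₁) {ε : ℝ} (hε : 0 < ε) :
    ∫⁻ z, ENNReal.ofReal (greenCut S (S * (S - R₁)) ε w z) ∂μ ≤ p w := by
  have hR₁ : 0 < R₁ := (norm_nonneg w).trans_lt hw
  have hcut : 0 < S * (S - R₁) := mul_pos (hR₁.trans hR₁S) (by linarith)
  have hsupp : HasCompactSupport (greenCut S (S * (S - R₁)) ε w) :=
    HasCompactSupport.intro (isCompact_closedBall 0 S) fun z hz =>
      greenCut_eq_zero hR₁ hR₁S hw.le (by simpa using (not_le.1 (by simpa using hz)).le)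
  have hs0 : Tendsto s l (𝓝 0) := hs.mono_right nhdsWithin_le_nhds
  have hwS : ∀ᶠ i in l, ‖w‖ * (S + s i) < S ^ 2 :=
    ((hs0.const_add S).const_mul ‖w‖).eventually (gt_mem_nhds (by nlinarith [norm_nonneg w]))
  refine le_of_tendsto (hμ _ (continuous_greenCut S hcut hε w) hsupp fun z => le_max_left _ _) ?_
  filter_upwards [hwS, hs0.eventually (gt_mem_nhds (sub_pos.2 hSR)),
    hs.eventually self_mem_nhdsWithin] with i hwi hiR hi
  refine le_trans (lintegral_mono_ae ?_)
    (hp.lintegral_green_defectMeasure_le hR₁S (hw.trans hR₁S) hi (by linarith) hwi)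
  filter_upwards [ae_defectMeasure_norm_le p R₁ (s i)] with z hz
  exact ofReal_greenCut_le_green hε hw.le (hz.trans hR₁S.le)

lemma setLIntegral_green_le (hp : IsSuperharmonicDisc p R) (hR : R₁ < R)
    (hs : Tendsto s l (𝓝[>] 0))
    (hμ : VaguelyTendsto (fun i => defectMeasure p R₁ (s i)) l μ) (hw : ‖w‖ < R₁) :
    ∫⁻ z in ball 0 R₁, green R z w ∂μ ≤ p w := by
  obtain ⟨S, -, hS, hSlim⟩ := exists_seq_strictMono_tendsto' hR
  have hε : Tendsto (fun k => R - S k) atTop (𝓝 0) := by simpa using hSlim.const_sub R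
  set cut : ℕ → ℂ → ℝ≥0∞ := fun k z =>
    ENNReal.ofReal (greenCut (S k) (S k * (S k - R₁)) (R - S k) w z)
  have hcut : ∀ k, ∫⁻ z, cut k z ∂μ ≤ p w := fun k =>
    hp.lintegral_greenCut_le hs hμ (hS k).1 (hS k).2 hw (sub_pos.2 (hS k).2)
  have hmeas : ∀ k, Measurable (cut k) := fun k => by unfold cut greenCut; fun_prop
  calc ∫⁻ z in ball 0 R₁, green R z w ∂μ
      = ∫⁻ z in ball 0 R₁, liminf (fun k => cut k z) atTop ∂μ :=
        setLIntegral_congr_fun measurableSet_ball fun z hz =>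
          (tendsto_ofReal_greenCut hR hw (mem_ball_zero_iff.1 hz) hSlim hε
            fun k => sub_pos.2 (hS k).2).liminf_eq.symm
    _ ≤ ∫⁻ z, liminf (fun k => cut k z) atTop ∂μ := setLIntegral_le_lintegral _ _
    _ ≤ liminf (fun k => ∫⁻ z, cut k z ∂μ) atTop := lintegral_liminf_le hmeas
    _ ≤ p w := liminf_le_of_le (by isBoundedDefault) fun b hb =>
        let ⟨k, hk⟩ := hb.exists; hk.trans (hcut k)

lemma lintegral_add_lcircleMean_mollifier (hp : IsSuperharmonicDisc p R) (hR : R₁ < R)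
    (hs : Tendsto s l (𝓝[>] 0)) (hμ : VaguelyTendsto (fun i => defectMeasure p R₁ (s i)) l μ)
    {ρ δ : ℝ} (hρ : 0 < ρ) (hδ : 0 < δ) (hw : ‖w‖ + ρ + δ < R₁) :
    (∫⁻ z, weightedMean (mollifier δ) (logKernel ρ) (z - w) ∂μ) +
        lcircleMean (weightedMean (mollifier δ) p) w ρ =
      weightedMean (mollifier δ) p w := by
  have hpm := hp.measurable
  have hα := isRadialDensity_mollifier hδ
  have hαm := hα.measurable
  set u := weightedMean (mollifier δ) p
  set κ := weightedMean (mollifier δ) (logKernel ρ)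
  have hκm : Measurable κ := by fun_prop
  have hu : Continuous u := continuous_weightedMean_mollifier hδ hpm hp.lintegral_ne_top
  have hum := hu.measurable
  have hs0 : Tendsto s l (𝓝 0) := hs.mono_right nhdsWithin_le_nhds
  have hspos : ∀ᶠ i in l, 0 < s i := hs.eventually self_mem_nhdsWithin
  have hdens := hspos.mono fun i hi => isRadialDensity_logDensity hi
  have hulim := tendsto_weightedMean hs0 hdens hum (hu.lowerSemicontinuous w)
    (sub_pos.2 hR) fun t ht htR => hp.lcircleMean_weightedMean_le hα ht (w := w) (by linarith)
  have hmeanlim := tendsto_weightedMean (f := fun x => lcircleMean u x ρ) hs0 hdens (by fun_prop)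
    (lowerSemicontinuous_lcircleMean hu.lowerSemicontinuous ρ w) (sub_pos.2 hR) fun t ht htR => by
      rw [lcircleMean_comm hum]
      refine lcircleMean_mono hρ.le fun x hx => hp.lcircleMean_weightedMean_le hα ht ?_
      linarith [norm_le_of_mem_sphere hx]
  refine tendsto_nhds_unique_of_eventuallyEq
    ((hμ.lintegral_weightedMean_mollifier hρ hδ w).add hmeanlim) hulim ?_
  filter_upwards [hspos, hs0.eventually (gt_mem_nhds (sub_pos.2 hR))] with i hi hiR
  rw [weightedMean_logDensity (by fun_prop), weightedMean_logDensity hum,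
    ← hp.weightedMean_defect_add hα hi hρ (w := w) (by linarith)
      (hp.weightedMean_logKernel_mollifier_ne_top hρ hδ w), mul_add,
    lintegral_sub_defectMeasure hpm hκm (s i) fun z hz => ?_]
  linarith [norm_lt_of_weightedMean_ne_zero hα.norm_lt
    (fun z => norm_lt_of_logKernel_ne_zero hρ) hz]

end VagueLimit

lemma exists_rieszMeasure (hp : IsSuperharmonicDisc p R) (hR₁ : 0 < R₁) (hR : R₁ < R) :
    ∃ μ : Measure ℂ, IsFiniteMeasureOnCompacts μ ∧
      (∀ w, ‖w‖ < R₁ → ∫⁻ z in ball 0 R₁, green R z w ∂μ ≤ p w) ∧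
      ∀ (w : ℂ) (ρ δ : ℝ), 0 < ρ → 0 < δ → ‖w‖ + ρ + δ < R₁ →
        (∫⁻ z, weightedMean (mollifier δ) (logKernel ρ) (z - w) ∂μ) +
          lcircleMean (weightedMean (mollifier δ) p) w ρ = weightedMean (mollifier δ) p w := by
  obtain ⟨S, hR₁S, hSR⟩ := exists_between hR
  obtain ⟨s, -, hs, hslim⟩ := exists_seq_strictAnti_tendsto' (sub_pos.2 hSR)
  have hlim : Tendsto s (hyperfilter ℕ) (𝓝[>] 0) :=
    (tendsto_nhdsWithin_iff.2 ⟨hslim, .of_forall fun n => (hs n).1⟩).mono_left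
      Nat.hyperfilter_le_atTop
  have hlog : 0 < Real.log (S / R₁) := Real.log_pos ((one_lt_div hR₁).2 hR₁S)
  obtain ⟨μ, hμfin, hμ⟩ := exists_vaguelyTendsto (hyperfilter ℕ)
    (ENNReal.div_ne_top hp.finite (ENNReal.ofReal_pos.2 hlog).ne')
    fun n => hp.defectMeasure_univ_le hR₁ hR₁S (hs n).1 (by linarith [(hs n).2])
  exact ⟨μ, hμfin, fun w hw => hp.setLIntegral_green_le hR hlim hμ hw,
    fun w ρ δ hρ hδ hw => hp.lintegral_add_lcircleMean_mollifier hR hlim hμ hρ hδ hw⟩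

end IsSuperharmonicDisc

end

/-! ### The Riesz decomposition -/

/-- The Green potential, for the disc of radius `R`, of `μ` restricted to the disc of radius `S`. -/
def greenPotential (μ : Measure ℂ) (R S : ℝ) (w : ℂ) : ℝ≥0∞ :=
  ∫⁻ z in ball 0 S, green R z w ∂μ

/-- The part of `p` on the disc of radius `S` that is not accounted for by the Green potential. -/
def rieszRemainder (p : ℂ → ℝ≥0∞) (μ : Measure ℂ) (R S : ℝ) : ℂ → ℝ≥0∞ :=
  (ball (0 : ℂ) S).indicator fun w => p w - greenPotential μ R S w

lemma IsRadial.weightedMean_lintegral_sub {a f : ℂ → ℝ≥0∞} (h : IsRadial a) (ha : Measurable a)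
    (hf : Measurable f) (ν : Measure ℂ) [SFinite ν] (w : ℂ) :
    weightedMean a (fun x => ∫⁻ z, f (z - x) ∂ν) w = ∫⁻ z, weightedMean a f (z - w) ∂ν :=
  calc weightedMean a (fun x => ∫⁻ z, f (z - x) ∂ν) w
      = ∫⁻ y, (∫⁻ z, a y * f (z - (w + y)) ∂ν) :=
        lintegral_congr fun y => (lintegral_const_mul _ (by fun_prop)).symm
    _ = ∫⁻ z, (∫⁻ y, a y * f (z - (w + y))) ∂ν := lintegral_lintegral_swap (by fun_prop)
    _ = ∫⁻ z, weightedMean a f (z - w) ∂ν := by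
        refine lintegral_congr fun z => ?_
        rw [weightedMean, ← lintegral_neg_eq_self]
        simp only [h.neg, ← sub_sub, sub_neg_eq_add]

section greenPotential

variable {μ : Measure ℂ} {α : ℂ → ℝ≥0∞} {R S ρ δ : ℝ} {w : ℂ}

lemma lowerSemicontinuousAt_greenPotential (hS : S < R) (hw : ‖w‖ < R) :
    LowerSemicontinuousAt (greenPotential μ R S) w := by
  have heq : greenPotential μ R S =
      fun x => ∫⁻ z, (ball (0 : ℂ) S).indicator (fun z => green R z x) z ∂μ := by
    ext x
    rw [greenPotential, lintegral_indicator measurableSet_ball]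
  rw [heq]
  refine lowerSemicontinuousAt_lintegral
    (F := fun z x => (ball (0 : ℂ) S).indicator (fun z => green R z x) z)
    (fun x => (measurable_green_left R x).indicator measurableSet_ball) fun z => ?_
  by_cases hz : z ∈ ball (0 : ℂ) S
  · simp only [indicator_of_mem hz]
    exact (continuousAt_green ((mem_ball_zero_iff.1 hz).trans hS) hw).lowerSemicontinuousAt
  · simp only [indicator_of_notMem hz]
    exact continuousAt_const.lowerSemicontinuousAt

variable [IsFiniteMeasureOnCompacts μ]

instance isFiniteMeasure_restrict_ball : IsFiniteMeasure (μ.restrict (ball 0 S)) :=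
  ⟨by simpa using measure_ball_lt_top⟩

@[fun_prop] lemma measurable_greenPotential : Measurable (greenPotential μ R S) := by
  unfold greenPotential
  simp_rw [green_comm R]
  exact (measurable_green R).lintegral_prod_right'

lemma greenPotential_eq_lcircleMean_add (hS : S ≤ R) (hρ : 0 < ρ) (hw : ‖w‖ + ρ ≤ R) :
    greenPotential μ R S w =
      lcircleMean (greenPotential μ R S) w ρ + ∫⁻ z in ball 0 S, logKernel ρ (z - w) ∂μ := by
  unfold greenPotential
  rw [lcircleMean_lintegral (measurable_green R), ← lintegral_add_right _ (by fun_prop)]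
  exact setLIntegral_congr_fun measurableSet_ball fun z hz =>
    green_eq_lcircleMean_add hρ ((mem_ball_zero_iff.1 hz).trans_le hS) hw

lemma weightedMean_greenPotential_eq_lcircleMean_add (hα : IsRadialDensity α δ) (hS : S ≤ R)
    (hρ : 0 < ρ) (hw : ‖w‖ + ρ + δ ≤ R) :
    weightedMean α (greenPotential μ R S) w =
      lcircleMean (weightedMean α (greenPotential μ R S)) w ρ +
        ∫⁻ z in ball 0 S, weightedMean α (logKernel ρ) (z - w) ∂μ := by
  have hαm := hα.measurable
  rw [← hα.isRadial.weightedMean_lintegral_sub hαm (by fun_prop),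
    lcircleMean_weightedMean hαm (by fun_prop), ← weightedMean_add hαm (by fun_prop)]
  refine weightedMean_congr fun z hz => greenPotential_eq_lcircleMean_add hS hρ ?_
  linarith [norm_add_le w z, hα.norm_lt z hz]

end greenPotential

section MeanValueProperty

variable {q : ℂ → ℝ≥0∞} {S : ℝ}

lemma weightedMean_mollifier_eq_of_mean (hq : Measurable q)
    (hmean : ∀ (w : ℂ) (ρ δ : ℝ), 0 < ρ → 0 < δ → ‖w‖ + ρ + δ < S →
      lcircleMean (weightedMean (mollifier δ) q) w ρ = weightedMean (mollifier δ) q w)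
    {w : ℂ} {δ δ' : ℝ} (hδ : 0 < δ) (hδ' : 0 < δ') (hw : ‖w‖ + δ + δ' < S) :
    weightedMean (mollifier δ) q w = weightedMean (mollifier δ') q w := by
  have absorb : ∀ s t, 0 < s → 0 < t → ‖w‖ + s + t < S →
      weightedMean (mollifier t) (weightedMean (mollifier s) q) w =
        weightedMean (mollifier s) q w := fun s t hs ht hst =>
    (isRadialDensity_mollifier ht).weightedMean_eq
      (measurable_weightedMean (isRadialDensity_mollifier hs).measurable hq)
      fun ρ hρ hρt => hmean w ρ s hρ hs (by linarith)
  rw [← absorb δ δ' hδ hδ' hw, weightedMean_comm (isRadialDensity_mollifier hδ').measurable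
    (isRadialDensity_mollifier hδ).measurable hq, absorb δ' δ hδ' hδ (by linarith)]

lemma harmonicAt_toReal_weightedMean_mollifier (hq : Measurable q) (hint : ∫⁻ z, q z ≠ ⊤)
    (hmean : ∀ (w : ℂ) (ρ δ : ℝ), 0 < ρ → 0 < δ → ‖w‖ + ρ + δ < S →
      lcircleMean (weightedMean (mollifier δ) q) w ρ = weightedMean (mollifier δ) q w)
    {w : ℂ} {δ : ℝ} (hδ : 0 < δ) (hw : ‖w‖ + δ < S) :
    HarmonicAt (fun x => (weightedMean (mollifier δ) q x).toReal) w := by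
  have hsmooth := contDiff_toReal_weightedMean_mollifier (n := 2) hδ hq hint
  refine ⟨hsmooth.contDiffAt, ?_⟩
  have hnear : ∀ᶠ x : ℂ in 𝓝 w, ‖x‖ < S - δ :=
    continuous_norm.continuousAt.eventually (gt_mem_nhds (by linarith))
  filter_upwards [hnear] with x hx
  refine laplacian_eq_zero_of_circleAverage_eq hsmooth.contDiffAt ?_
  filter_upwards [nhdsWithin_le_nhds (gt_mem_nhds (sub_pos.2 hx)), self_mem_nhdsWithin]
    with r hr (hr0 : 0 < r)
  have hxr := hmean x r δ hr0 hδ (by linarith)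
  rw [lcircleMean_weightedMean_mollifier hδ hq hint x hr0] at hxr
  rw [← hxr, ENNReal.toReal_ofReal]
  rw [circleAverage_eq_integral_e]
  exact integral_nonneg fun θ => ENNReal.toReal_nonneg

lemma exists_harmonic_of_lcircleMean_weightedMean_eq (hq : Measurable q) (hint : ∫⁻ z, q z ≠ ⊤)
    (hmean : ∀ (w : ℂ) (ρ δ : ℝ), 0 < ρ → 0 < δ → ‖w‖ + ρ + δ < S →
      lcircleMean (weightedMean (mollifier δ) q) w ρ = weightedMean (mollifier δ) q w) :
    ∃ H : ℂ → ℝ, HarmonicOnNhd H (ball 0 S) ∧ (∀ w, 0 ≤ H w) ∧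
      ∀ (w : ℂ) (δ : ℝ), 0 < δ → δ < (S - ‖w‖) / 2 →
        weightedMean (mollifier δ) q w = ENNReal.ofReal (H w) := by
  set H : ℂ → ℝ := fun w => (weightedMean (mollifier ((S - ‖w‖) / 3)) q w).toReal
  have hH : ∀ (w : ℂ) (δ : ℝ), 0 < δ → δ < (S - ‖w‖) / 2 →
      weightedMean (mollifier δ) q w = ENNReal.ofReal (H w) := fun w δ hδ hw => by
    rw [ofReal_toReal_weightedMean_mollifier (by linarith) hint]
    exact weightedMean_mollifier_eq_of_mean hq hmean hδ (by linarith) (by linarith)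
  refine ⟨H, fun w hw => ?_, fun w => ENNReal.toReal_nonneg, hH⟩
  have hwS : 0 < S - ‖w‖ := sub_pos.2 (mem_ball_zero_iff.1 hw)
  have hcont : ContinuousAt (fun x : ℂ => (S - ‖x‖) / 2) w := by fun_prop
  have hnear : ∀ᶠ x : ℂ in 𝓝 w, (S - ‖w‖) / 3 < (S - ‖x‖) / 2 :=
    hcont.eventually (lt_mem_nhds (by linarith))
  refine (harmonicAt_congr_nhds ?_).2 (harmonicAt_toReal_weightedMean_mollifier hq hint hmean
    (div_pos hwS three_pos) (by linarith))
  filter_upwards [hnear] with x hx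
  rw [hH x _ (div_pos hwS three_pos) hx, ENNReal.toReal_ofReal ENNReal.toReal_nonneg]

lemma exists_harmonic_of_lcircleMean_eq (hq : Measurable q) (hint : ∫⁻ z, q z ≠ ⊤)
    (hmean : ∀ (w : ℂ) (ρ : ℝ), 0 < ρ → ‖w‖ + ρ < S → lcircleMean q w ρ = q w) :
    ∃ H : ℂ → ℝ, HarmonicOnNhd H (ball 0 S) ∧ (∀ w, 0 ≤ H w) ∧
      ∀ w, ‖w‖ < S → q w = ENNReal.ofReal (H w) := by
  obtain ⟨H, hH, hH0, hHq⟩ := exists_harmonic_of_lcircleMean_weightedMean_eq hq hint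
    fun w ρ δ hρ hδ hw => by
      have hα := isRadialDensity_mollifier hδ
      rw [lcircleMean_weightedMean hα.measurable hq]
      refine weightedMean_congr fun z hz => hmean _ ρ hρ ?_
      linarith [norm_add_le w z, hα.norm_lt z hz]
  refine ⟨H, hH, hH0, fun w hw => ?_⟩
  have hδ : 0 < (S - ‖w‖) / 3 := by linarith
  rw [← hHq w _ hδ (by linarith)]
  exact ((isRadialDensity_mollifier hδ).weightedMean_eq hq
    fun t ht htδ => hmean w t ht (by linarith)).symm

end MeanValueProperty

section rieszRemainder

variable {p α : ℂ → ℝ≥0∞} {μ : Measure ℂ} {R S ρ δ : ℝ} {w : ℂ}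

lemma greenPotential_add_rieszRemainder (hle : greenPotential μ R S w ≤ p w) (hw : ‖w‖ < S) :
    greenPotential μ R S w + rieszRemainder p μ R S w = p w := by
  rw [rieszRemainder, indicator_of_mem (mem_ball_zero_iff.2 hw), add_tsub_cancel_of_le hle]

lemma lintegral_rieszRemainder_ne_top (hp : ∫⁻ z, p z ≠ ⊤) :
    ∫⁻ z, rieszRemainder p μ R S z ≠ ⊤ :=
  ne_top_of_le_ne_top hp (lintegral_mono fun z =>
    (indicator_le_self _ _ z).trans tsub_le_self)

variable [IsFiniteMeasureOnCompacts μ]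

lemma measurable_rieszRemainder (hp : Measurable p) :
    Measurable (rieszRemainder p μ R S) :=
  (hp.sub measurable_greenPotential).indicator measurableSet_ball

lemma weightedMean_eq_greenPotential_add_rieszRemainder (hα : IsRadialDensity α δ)
    (hle : ∀ w, ‖w‖ < S → greenPotential μ R S w ≤ p w) (hw : ‖w‖ + δ ≤ S) :
    weightedMean α p w =
      weightedMean α (greenPotential μ R S) w + weightedMean α (rieszRemainder p μ R S) w := by
  rw [← weightedMean_add hα.measurable measurable_greenPotential]
  refine weightedMean_congr fun z hz => ?_
  have hwz : ‖w + z‖ < S := by linarith [norm_add_le w z, hα.norm_lt z hz]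
  exact (greenPotential_add_rieszRemainder (hle _ hwz) hwz).symm

lemma lcircleMean_weightedMean_rieszRemainder (hα : IsRadialDensity α δ) (hR : S ≤ R)
    (hle : ∀ w, ‖w‖ < S → greenPotential μ R S w ≤ p w) (hρ : 0 < ρ) (hw : ‖w‖ + ρ + δ ≤ S)
    (hfin : weightedMean α p w ≠ ⊤)
    (hdefect : (∫⁻ z, weightedMean α (logKernel ρ) (z - w) ∂μ) +
      lcircleMean (weightedMean α p) w ρ = weightedMean α p w) :
    lcircleMean (weightedMean α (rieszRemainder p μ R S)) w ρ =
      weightedMean α (rieszRemainder p μ R S) w := by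
  have hαm := hα.measurable
  set P := greenPotential μ R S
  set q := rieszRemainder p μ R S
  set κ := ∫⁻ z, weightedMean α (logKernel ρ) (z - w) ∂μ with hκ
  have hsplit := weightedMean_eq_greenPotential_add_rieszRemainder hα hle (w := w) (by linarith)
  have hmeansplit : lcircleMean (weightedMean α p) w ρ =
      lcircleMean (weightedMean α P) w ρ + lcircleMean (weightedMean α q) w ρ := by
    rw [← lcircleMean_add (by fun_prop)]
    refine lcircleMean_congr hρ.le fun x hx => ?_
    exact weightedMean_eq_greenPotential_add_rieszRemainder hα hle
      (by linarith [norm_le_of_mem_sphere hx])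
  have hP : weightedMean α P w = lcircleMean (weightedMean α P) w ρ + κ := by
    rw [weightedMean_greenPotential_eq_lcircleMean_add hα hR hρ (by linarith), hκ]
    congr 1
    refine setLIntegral_eq_of_support_subset fun z hz => ?_
    have hzw := norm_lt_of_weightedMean_ne_zero hα.norm_lt
      (fun z => norm_lt_of_logKernel_ne_zero hρ) hz
    have hnorm : ‖z‖ ≤ ‖w‖ + ‖z - w‖ := by simpa using norm_add_le w (z - w)
    exact mem_ball_zero_iff.2 (by linarith)
  have hPfin : weightedMean α P w ≠ ⊤ := ne_top_of_le_ne_top hfin (hsplit ▸ le_self_add)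
  refine (ENNReal.add_right_inj hPfin).1 ?_
  rw [← hsplit, ← hdefect, hmeansplit, hP]
  ring

lemma IsSuperharmonicDisc.eq_greenPotential_add_of_weightedMean_mollifier_eq
    (hp : IsSuperharmonicDisc p R) (hR : S < R)
    (hle : ∀ w, ‖w‖ < S → greenPotential μ R S w ≤ p w) (hw : ‖w‖ < S) {c : ℝ≥0∞}
    (hc : ∀ δ, 0 < δ → δ < (S - ‖w‖) / 2 →
      weightedMean (mollifier δ) (rieszRemainder p μ R S) w = c) :
    p w = greenPotential μ R S w + c := by
  have hid : Tendsto id (𝓝[>] (0 : ℝ)) (𝓝 0) := nhdsWithin_le_nhds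
  have hdens : ∀ᶠ δ in 𝓝[>] (0 : ℝ), IsRadialDensity (mollifier δ) (id δ) := by
    filter_upwards [self_mem_nhdsWithin] with δ hδ using isRadialDensity_mollifier hδ
  have hplim := tendsto_weightedMean hid hdens hp.measurable (hp.lsc w) (sub_pos.2 hw)
    fun t ht htS => hp.mean w t ht (by linarith)
  have hPlim := tendsto_weightedMean hid hdens measurable_greenPotential
    (lowerSemicontinuousAt_greenPotential (μ := μ) hR (hw.trans hR)) (sub_pos.2 hw)
    fun t ht htS => by
      rw [greenPotential_eq_lcircleMean_add hR.le ht (by linarith)]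
      exact le_self_add
  have hS : 0 < (S - ‖w‖) / 2 := by linarith
  refine tendsto_nhds_unique_of_eventuallyEq hplim (hPlim.add_const c) ?_
  filter_upwards [self_mem_nhdsWithin, nhdsWithin_le_nhds (gt_mem_nhds hS)] with δ hδ hδS
  rw [weightedMean_eq_greenPotential_add_rieszRemainder (isRadialDensity_mollifier hδ) hle
    (by linarith), hc δ hδ hδS]

end rieszRemainder

theorem IsSuperharmonicDisc.exists_riesz_decomposition {p : ℂ → ℝ≥0∞} {R R₁ : ℝ}
    (hp : IsSuperharmonicDisc p R) (hR₁ : 0 < R₁) (hR : R₁ < R) :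
    ∃ (μ : Measure ℂ) (H : ℂ → ℝ), IsFiniteMeasureOnCompacts μ ∧
      HarmonicOnNhd H (ball 0 R₁) ∧ (∀ w, 0 ≤ H w) ∧
      ∀ w, ‖w‖ < R₁ → p w = greenPotential μ R R₁ w + ENNReal.ofReal (H w) := by
  have hpm := hp.measurable
  obtain ⟨μ, hμ, hle, hdefect⟩ := hp.exists_rieszMeasure hR₁ hR
  obtain ⟨H, hH, hH0, hHq⟩ := exists_harmonic_of_lcircleMean_weightedMean_eq
    (measurable_rieszRemainder hpm) (lintegral_rieszRemainder_ne_top hp.lintegral_ne_top)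
    fun w ρ δ hρ hδ hw => lcircleMean_weightedMean_rieszRemainder
      (isRadialDensity_mollifier hδ) hR.le hle hρ hw.le
      (weightedMean_mollifier_ne_top hδ hp.lintegral_ne_top w) (hdefect w ρ δ hρ hδ hw)
  exact ⟨μ, H, hμ, hH, hH0, fun w hw =>
    hp.eq_greenPotential_add_of_weightedMean_mollifier_eq hR hle hw (hHq w)⟩

/-! ### Averages of harmonic functions -/

section HarmonicIntegral

lemma lcircleMean_ofReal_of_harmonicOnNhd {f : ℂ → ℝ} {z : ℂ} {r : ℝ} (hr : 0 < r)
    (hf : HarmonicOnNhd f (closedBall z r)) (h0 : ∀ x ∈ sphere z r, 0 ≤ f x) :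
    lcircleMean (fun x => ENNReal.ofReal (f x)) z r = ENNReal.ofReal (f z) := by
  rw [lcircleMean_eq_ofReal z hr (circleIntegrable_of_harmonicOnNhd hr hf)
    (fun x hx _ => h0 x hx) fun _ _ _ => rfl,
    InnerProductSpace.HarmonicOnNhd.circleAverage_eq]
  rwa [abs_of_pos hr]

variable {α : Type*} [MeasurableSpace α] {ν : Measure α} [IsFiniteMeasure ν] {F : α → ℂ → ℝ}
  {S C : ℝ}

lemma lintegral_indicator_ball_lintegral_ne_top
    (hC : ∀ᵐ a ∂ν, ∀ w ∈ ball (0 : ℂ) S, F a w ≤ C) :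
    ∫⁻ w, (ball (0 : ℂ) S).indicator (fun w => ∫⁻ a, ENNReal.ofReal (F a w) ∂ν) w ≠ ⊤ := by
  rw [lintegral_indicator measurableSet_ball]
  refine ne_top_of_le_ne_top ?_ (setLIntegral_mono' (g := fun _ => ENNReal.ofReal C * ν univ)
    measurableSet_ball fun w hw => ?_)
  · rw [setLIntegral_const]
    exact ENNReal.mul_ne_top (by finiteness) measure_ball_lt_top.ne
  · rw [← lintegral_const]
    exact lintegral_mono_ae (hC.mono fun a ha => ENNReal.ofReal_le_ofReal (ha w hw))

lemma exists_harmonic_eq_lintegral_ofReal (hF : Measurable (Function.uncurry F))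
    (hharm : ∀ᵐ a ∂ν, HarmonicOnNhd (F a) (ball 0 S))
    (h0 : ∀ᵐ a ∂ν, ∀ w ∈ ball (0 : ℂ) S, 0 ≤ F a w)
    (hC : ∀ᵐ a ∂ν, ∀ w ∈ ball (0 : ℂ) S, F a w ≤ C) :
    ∃ H : ℂ → ℝ, HarmonicOnNhd H (ball 0 S) ∧ (∀ w, 0 ≤ H w) ∧
      ∀ w ∈ ball (0 : ℂ) S, ∫⁻ a, ENNReal.ofReal (F a w) ∂ν = ENNReal.ofReal (H w) := by
  set P : ℂ → ℝ≥0∞ := fun w => ∫⁻ a, ENNReal.ofReal (F a w) ∂ν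
  have hP : Measurable P :=
    (hF.comp measurable_swap).ennreal_ofReal.lintegral_prod_right'
  have hmean : ∀ w ρ, 0 < ρ → ‖w‖ + ρ < S →
      lcircleMean ((ball (0 : ℂ) S).indicator P) w ρ = (ball (0 : ℂ) S).indicator P w := by
    intro w ρ hρ hw
    have hsub : closedBall w ρ ⊆ ball (0 : ℂ) S :=
      closedBall_subset_ball' (by simpa [add_comm] using hw)
    calc lcircleMean ((ball (0 : ℂ) S).indicator P) w ρ = lcircleMean P w ρ :=
          lcircleMean_congr hρ.le fun x hx =>
            indicator_of_mem (hsub (sphere_subset_closedBall hx)) _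
      _ = ∫⁻ a, lcircleMean (fun x => ENNReal.ofReal (F a x)) w ρ ∂ν :=
          lcircleMean_lintegral (F := fun a x => ENNReal.ofReal (F a x)) hF.ennreal_ofReal w ρ
      _ = P w := by
          refine lintegral_congr_ae ?_
          filter_upwards [hharm, h0] with a ha ha0
          exact lcircleMean_ofReal_of_harmonicOnNhd hρ (ha.mono hsub) fun x hx =>
            ha0 x (hsub (sphere_subset_closedBall hx))
      _ = (ball (0 : ℂ) S).indicator P w :=
          (indicator_of_mem (hsub (mem_closedBall_self hρ.le)) _).symm
  obtain ⟨H, hH, hH0, hPH⟩ := exists_harmonic_of_lcircleMean_eq (hP.indicator measurableSet_ball)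
    (lintegral_indicator_ball_lintegral_ne_top hC) hmean
  refine ⟨H, hH, hH0, fun w hw => ?_⟩
  rw [← hPH w (mem_ball_zero_iff.1 hw), indicator_of_mem hw]

theorem harmonicOnNhd_integral (hF : Measurable (Function.uncurry F))
    (hharm : ∀ᵐ a ∂ν, HarmonicOnNhd (F a) (ball 0 S))
    (hC : ∀ᵐ a ∂ν, ∀ w ∈ ball (0 : ℂ) S, |F a w| ≤ C) :
    HarmonicOnNhd (fun w => ∫ a, F a w ∂ν) (ball 0 S) := by
  have hFC : Measurable (Function.uncurry fun a w => F a w + C) := hF.add_const C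
  obtain ⟨H, hH, hH0, hFH⟩ := exists_harmonic_eq_lintegral_ofReal (C := C + C) hFC
    (hharm.mono fun a ha => ha.add (harmonicOnNhd_const C))
    (hC.mono fun a ha w hw => by linarith [neg_le_of_abs_le (ha w hw)])
    (hC.mono fun a ha w hw => by linarith [le_of_abs_le (ha w hw)])
  have hint : ∀ w ∈ ball (0 : ℂ) S, Integrable (fun a => F a w) ν := fun w hw =>
    Integrable.of_bound (Measurable.of_uncurry_right hF).aestronglyMeasurable C
      (hC.mono fun a ha => ha w hw)
  have heq : EqOn (fun w => ∫ a, F a w ∂ν) (fun w => H w - ν.real univ * C) (ball 0 S) := by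
    intro w hw
    have hpos : 0 ≤ᵐ[ν] fun a => F a w + C :=
      hC.mono fun a ha => by simpa using by linarith [neg_le_of_abs_le (ha w hw)]
    have hreal : ∫ a, (F a w + C) ∂ν = H w := by
      rw [integral_eq_lintegral_of_nonneg_ae hpos
        ((hint w hw).add (integrable_const C)).aestronglyMeasurable, hFH w hw,
        ENNReal.toReal_ofReal (hH0 w)]
    rw [integral_add (hint w hw) (integrable_const C), integral_const, smul_eq_mul] at hreal
    exact eq_sub_of_add_eq hreal
  exact fun w hw => (harmonicAt_congr_nhds (heq.eventuallyEq_of_mem (isOpen_ball.mem_nhds hw))).2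
    ((hH w hw).sub (harmonicAt_const _))

end HarmonicIntegral

/-! ### Harnack's inequality -/

lemma le_mul_of_harmonicOnNhd_closedBall {g : ℂ → ℝ} {s T : ℝ}
    (hg : HarmonicOnNhd g (closedBall 0 s)) (h0 : ∀ z ∈ closedBall (0 : ℂ) s, 0 ≤ g z)
    (hTs : T < s) {w : ℂ} (hw : ‖w‖ ≤ T) : g w ≤ (s + T) / (s - T) * g 0 := by
  have hT : 0 ≤ T := (norm_nonneg w).trans hw
  have hs : 0 < s := hT.trans_lt hTs
  have hwball : w ∈ ball (0 : ℂ) s := mem_ball_zero_iff.2 (hw.trans_lt hTs)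
  have hgabs : HarmonicOnNhd g (closedBall 0 |s|) := by rwa [abs_of_pos hs]
  have hgcont : ContinuousOn g (sphere 0 |s|) :=
    hgabs.continuousOn.mono sphere_subset_closedBall
  have hkercont : ContinuousOn ((Complex.re ∘ herglotzRieszKernel 0 w) • g) (sphere 0 |s|) :=
    (Complex.continuous_re.comp_continuousOn
      (continuousOn_herglotzRieszKernel_sphere hwball)).smul hgcont
  calc g w
      = Real.circleAverage ((Complex.re ∘ herglotzRieszKernel 0 w) • g) 0 s :=
        (hg.circleAverage_re_herglotzRieszKernel_smul hwball).symm
    _ ≤ Real.circleAverage (fun z => (s + T) / (s - T) * g z) 0 s := by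
        refine Real.circleAverage_mono hkercont.circleIntegrable'
          (continuousOn_const.mul hgcont).circleIntegrable' fun z hz => ?_
        rw [abs_of_pos hs] at hz
        have hkernel : (herglotzRieszKernel 0 w z).re ≤ (s + T) / (s - T) :=
          (re_herglotzRieszKernel_le hz hwball).trans (by rw [sub_zero]; gcongr)
        exact mul_le_mul_of_nonneg_right hkernel (h0 z (sphere_subset_closedBall hz))
    _ = (s + T) / (s - T) * Real.circleAverage g 0 s :=
        Real.circleAverage_fun_smul (a := (s + T) / (s - T))
    _ = (s + T) / (s - T) * g 0 := by
        rw [InnerProductSpace.HarmonicOnNhd.circleAverage_eq hgabs]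

lemma le_mul_of_harmonicOnNhd_ball {g : ℂ → ℝ} {S T : ℝ} (hg : HarmonicOnNhd g (ball 0 S))
    (h0 : ∀ z ∈ ball (0 : ℂ) S, 0 ≤ g z) (hT : T < S) {w : ℂ} (hw : ‖w‖ ≤ T) :
    g w ≤ (S + T) / (S - T) * g 0 := by
  have hcont : ContinuousAt (fun s => (s + T) / (s - T) * g 0) S :=
    ((continuousAt_id.add continuousAt_const).div (continuousAt_id.sub continuousAt_const)
      (sub_ne_zero.2 hT.ne')).mul continuousAt_const
  refine ge_of_tendsto (x := 𝓝[<] S) (hcont.tendsto.mono_left nhdsWithin_le_nhds) ?_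
  filter_upwards [Ioo_mem_nhdsLT hT] with s hs
  exact le_mul_of_harmonicOnNhd_closedBall (hg.mono (closedBall_subset_ball hs.2))
    (fun z hz => h0 z (closedBall_subset_ball hs.2 hz)) hs.1 hw

/-! ### The Poisson kernel on the unit circle -/

/-- The squared distance between the points `T e(t + x)` and `e(t)`. -/
def poissonDenom (T x : ℝ) : ℝ := T ^ 2 + 1 - 2 * T * Real.cos (2 * Real.pi * x)

/-- The Poisson kernel of the disc of radius `T` at points of the unit circle, as a function of
the difference of the arguments, measured in full turns. -/
def poissonCircle (T x : ℝ) : ℝ := (T ^ 2 - 1) / poissonDenom T x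

/-- The derivative of `poissonCircle T`. -/
def poissonCircleDeriv (T x : ℝ) : ℝ :=
  -((T ^ 2 - 1) * (4 * Real.pi * T) * Real.sin (2 * Real.pi * x)) / poissonDenom T x ^ 2

/-- The second derivative of `poissonCircle T`. -/
def poissonCircleDeriv₂ (T x : ℝ) : ℝ :=
  -((T ^ 2 - 1) * (8 * Real.pi ^ 2 * T) *
      (2 * T * Real.cos (2 * Real.pi * x) ^ 2 + (T ^ 2 + 1) * Real.cos (2 * Real.pi * x) - 4 * T)) /
    poissonDenom T x ^ 3

/-- The positive root of `2 T c ^ 2 + (T ^ 2 + 1) c - 4 T`, which is the cosine at the points where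
the second derivative of `poissonCircle T` changes sign. -/
def criticalCos (T : ℝ) : ℝ := (√(T ^ 4 + 34 * T ^ 2 + 1) - 1 - T ^ 2) / (4 * T)

/-- The point of `[0, 1 / 2]` where the second derivative of `poissonCircle T` changes sign. -/
def criticalPoint (T : ℝ) : ℝ := Real.arccos (criticalCos T) / (2 * Real.pi)

section poissonCircle

variable {T x : ℝ}

lemma poissonDenom_pos (hT : 1 < T) (x : ℝ) : 0 < poissonDenom T x := by
  unfold poissonDenom
  nlinarith [Real.cos_le_one (2 * Real.pi * x)]

lemma hasDerivAt_cos_two_pi_mul (x : ℝ) : HasDerivAt (fun x => Real.cos (2 * Real.pi * x))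
    (-Real.sin (2 * Real.pi * x) * (2 * Real.pi)) x := by
  simpa using ((hasDerivAt_id x).const_mul (2 * Real.pi)).cos

lemma hasDerivAt_sin_two_pi_mul (x : ℝ) : HasDerivAt (fun x => Real.sin (2 * Real.pi * x))
    (Real.cos (2 * Real.pi * x) * (2 * Real.pi)) x := by
  simpa using ((hasDerivAt_id x).const_mul (2 * Real.pi)).sin

lemma hasDerivAt_poissonDenom (T x : ℝ) :
    HasDerivAt (poissonDenom T) (4 * Real.pi * T * Real.sin (2 * Real.pi * x)) x :=
  (((hasDerivAt_cos_two_pi_mul x).const_mul (2 * T)).const_sub (T ^ 2 + 1)).congr_deriv (by ring)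

lemma hasDerivAt_poissonCircle (hT : 1 < T) (x : ℝ) :
    HasDerivAt (poissonCircle T) (poissonCircleDeriv T x) x := by
  refine ((hasDerivAt_const x (T ^ 2 - 1)).div (hasDerivAt_poissonDenom T x)
    (poissonDenom_pos hT x).ne').congr_deriv ?_
  rw [poissonCircleDeriv]
  ring

lemma hasDerivAt_poissonCircleDeriv (hT : 1 < T) (x : ℝ) :
    HasDerivAt (poissonCircleDeriv T) (poissonCircleDeriv₂ T x) x := by
  have hD := (poissonDenom_pos hT x).ne'
  have hnum := ((hasDerivAt_sin_two_pi_mul x).const_mul ((T ^ 2 - 1) * (4 * Real.pi * T))).neg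
  refine (hnum.div ((hasDerivAt_poissonDenom T x).pow 2) (pow_ne_zero 2 hD)).congr_deriv ?_
  simp only [poissonCircleDeriv₂, Pi.neg_apply, Pi.pow_apply]
  rw [div_eq_div_iff (pow_ne_zero _ (pow_ne_zero _ hD)) (pow_ne_zero _ hD), poissonDenom]
  have hsin := Real.sin_sq (2 * Real.pi * x)
  generalize Real.sin (2 * Real.pi * x) = s at *
  generalize Real.cos (2 * Real.pi * x) = c at *
  push_cast
  linear_combination (-(T ^ 2 - 1) * (4 * Real.pi * T) * (-2) * (4 * Real.pi * T) *
    (T ^ 2 + 1 - 2 * T * c) ^ 4) * hsin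

lemma continuous_poissonCircleDeriv (hT : 1 < T) : Continuous (poissonCircleDeriv T) :=
  continuous_iff_continuousAt.2 fun x => (hasDerivAt_poissonCircleDeriv hT x).continuousAt

lemma continuous_poissonCircleDeriv₂ (hT : 1 < T) : Continuous (poissonCircleDeriv₂ T) := by
  have hdenom : Continuous (poissonDenom T) :=
    continuous_iff_continuousAt.2 fun x => (hasDerivAt_poissonDenom T x).continuousAt
  exact Continuous.div (by fun_prop) (hdenom.pow 3) fun x =>
    pow_ne_zero _ (poissonDenom_pos hT x).ne'

lemma periodic_poissonDenom (T : ℝ) : Function.Periodic (poissonDenom T) 1 := fun x => by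
  simp only [poissonDenom, mul_add, mul_one, Real.cos_add_two_pi]

lemma periodic_poissonCircleDeriv (T : ℝ) : Function.Periodic (poissonCircleDeriv T) 1 :=
  fun x => by
    simp only [poissonCircleDeriv, periodic_poissonDenom T x, mul_add, mul_one,
      Real.sin_add_two_pi]

lemma periodic_poissonCircleDeriv₂ (T : ℝ) : Function.Periodic (poissonCircleDeriv₂ T) 1 :=
  fun x => by
    simp only [poissonCircleDeriv₂, periodic_poissonDenom T x, mul_add, mul_one,
      Real.cos_add_two_pi]

lemma poissonDenom_one_sub (T x : ℝ) : poissonDenom T (1 - x) = poissonDenom T x := by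
  simp only [poissonDenom, mul_sub, mul_one, Real.cos_two_pi_sub]

lemma poissonCircleDeriv_one_sub (T x : ℝ) :
    poissonCircleDeriv T (1 - x) = -poissonCircleDeriv T x := by
  simp only [poissonCircleDeriv, poissonDenom_one_sub, mul_sub, mul_one, Real.sin_two_pi_sub]
  ring

lemma poissonCircleDeriv₂_one_sub (T x : ℝ) :
    poissonCircleDeriv₂ T (1 - x) = poissonCircleDeriv₂ T x := by
  simp only [poissonCircleDeriv₂, poissonDenom_one_sub, mul_sub, mul_one, Real.cos_two_pi_sub]

end poissonCircle

/-! ### `L¹` norms of the derivatives of the Poisson kernel -/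

section IntegralAbs

variable {f f' : ℝ → ℝ} {a b : ℝ}

lemma integral_abs_eq_sub_of_nonneg (hab : a ≤ b) (hf : ∀ x, HasDerivAt f (f' x) x)
    (hf' : Continuous f') (h0 : ∀ x ∈ Icc a b, 0 ≤ f' x) :
    ∫ x in a..b, |f' x| = f b - f a := by
  rw [← intervalIntegral.integral_eq_sub_of_hasDerivAt (fun x _ => hf x)
    (hf'.intervalIntegrable a b)]
  refine intervalIntegral.integral_congr fun x hx => abs_of_nonneg (h0 x ?_)
  rwa [uIcc_of_le hab] at hx

lemma integral_abs_eq_sub_of_nonpos (hab : a ≤ b) (hf : ∀ x, HasDerivAt f (f' x) x)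
    (hf' : Continuous f') (h0 : ∀ x ∈ Icc a b, f' x ≤ 0) :
    ∫ x in a..b, |f' x| = f a - f b := by
  have hneg := integral_abs_eq_sub_of_nonneg hab (fun x => (hf x).neg) hf'.neg
    fun x hx => neg_nonneg.2 (h0 x hx)
  simpa [abs_neg, neg_add_eq_sub] using hneg

lemma integral_eq_two_mul_of_one_sub (hf : Continuous f) (hsymm : ∀ x, f (1 - x) = f x) :
    ∫ x in (0 : ℝ)..1, f x = 2 * ∫ x in (0 : ℝ)..(1 / 2), f x := by
  have hreflect : ∫ x in (1 / 2 : ℝ)..1, f x = ∫ x in (0 : ℝ)..(1 / 2), f x := by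
    have := intervalIntegral.integral_comp_sub_left (a := (0 : ℝ)) (b := 1 / 2) f 1
    simp only [hsymm] at this
    rw [this]
    norm_num
  rw [← intervalIntegral.integral_add_adjacent_intervals (hf.intervalIntegrable 0 (1 / 2))
    (hf.intervalIntegrable _ _), hreflect, two_mul]

end IntegralAbs

section PoissonNorm

variable {T x : ℝ}

lemma poissonCircleDeriv_nonpos (hT : 1 < T) (hx : x ∈ Icc (0 : ℝ) (1 / 2)) :
    poissonCircleDeriv T x ≤ 0 := by
  have hT1 : 0 ≤ T ^ 2 - 1 := by nlinarith
  have hx0 : 0 ≤ x := hx.1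
  have hsin : 0 ≤ Real.sin (2 * Real.pi * x) :=
    Real.sin_nonneg_of_nonneg_of_le_pi (by positivity) (by nlinarith [hx.2, Real.pi_pos])
  exact div_nonpos_of_nonpos_of_nonneg (neg_nonpos.2 (by positivity)) (sq_nonneg _)

lemma integral_abs_poissonCircleDeriv (hT : 1 < T) :
    ∫ x in (0 : ℝ)..1, |poissonCircleDeriv T x| = 8 * T / (T ^ 2 - 1) := by
  have hcont := continuous_poissonCircleDeriv hT
  have hhalf : poissonDenom T (1 / 2) = (T + 1) ^ 2 := by
    rw [poissonDenom, show 2 * Real.pi * (1 / 2) = Real.pi by ring, Real.cos_pi]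
    ring
  have hzero : poissonDenom T 0 = (T - 1) ^ 2 := by
    rw [poissonDenom, mul_zero, Real.cos_zero]
    ring
  have hT_sub : T - 1 ≠ 0 := by linarith
  have hT_add : T + 1 ≠ 0 := by linarith
  rw [integral_eq_two_mul_of_one_sub hcont.abs
      fun x => by rw [poissonCircleDeriv_one_sub, abs_neg],
    integral_abs_eq_sub_of_nonpos (by norm_num) (hasDerivAt_poissonCircle hT) hcont
      fun x => poissonCircleDeriv_nonpos hT,
    poissonCircle, poissonCircle, hhalf, hzero, show T ^ 2 - 1 = (T - 1) * (T + 1) by ring]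
  field_simp
  ring

lemma four_mul_criticalCos (hT : 0 < T) :
    4 * T * criticalCos T = √(T ^ 4 + 34 * T ^ 2 + 1) - 1 - T ^ 2 :=
  mul_div_cancel₀ _ (by positivity)

lemma criticalCos_pos (hT : 0 < T) : 0 < criticalCos T := by
  refine div_pos ?_ (by positivity)
  have : T ^ 2 + 1 < √(T ^ 4 + 34 * T ^ 2 + 1) := Real.lt_sqrt_of_sq_lt (by nlinarith)
  linarith

lemma criticalCos_lt_one (hT : 1 < T) : criticalCos T < 1 := by
  have hT0 : 0 < T := by linarith
  refine (div_lt_one (by positivity)).2 ?_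
  have : √(T ^ 4 + 34 * T ^ 2 + 1) < T ^ 2 + 1 + 4 * T := by
    rw [Real.sqrt_lt' (by positivity)]
    nlinarith [mul_pos hT0 (pow_pos (sub_pos.2 hT) 2)]
  linarith

lemma quadratic_eq_sub_criticalCos_mul (hT : 0 < T) (c : ℝ) :
    2 * T * c ^ 2 + (T ^ 2 + 1) * c - 4 * T =
      (c - criticalCos T) * (2 * T * (c + criticalCos T) + (T ^ 2 + 1)) := by
  have hsqrt : √(T ^ 4 + 34 * T ^ 2 + 1) ^ 2 = T ^ 4 + 34 * T ^ 2 + 1 :=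
    Real.sq_sqrt (by positivity)
  have hcrit := four_mul_criticalCos hT
  have hroot : 2 * T * criticalCos T ^ 2 + (T ^ 2 + 1) * criticalCos T - 4 * T = 0 := by
    refine (mul_eq_zero.1 (?_ : 8 * T * _ = 0)).resolve_left (by positivity)
    linear_combination (4 * T * criticalCos T + √(T ^ 4 + 34 * T ^ 2 + 1) + T ^ 2 + 1) * hcrit +
      hsqrt
  linear_combination hroot

lemma quadratic_cofactor_pos (hT : 1 < T) (x : ℝ) :
    0 < 2 * T * (Real.cos (2 * Real.pi * x) + criticalCos T) + (T ^ 2 + 1) := by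
  have hT0 : 0 < T := by linarith
  nlinarith [mul_pos hT0 (criticalCos_pos hT0), Real.neg_one_le_cos (2 * Real.pi * x)]

lemma poissonCircleDeriv₂_nonpos (hT : 1 < T) (hx : criticalCos T ≤ Real.cos (2 * Real.pi * x)) :
    poissonCircleDeriv₂ T x ≤ 0 := by
  have hT1 : 0 ≤ T ^ 2 - 1 := by nlinarith
  rw [poissonCircleDeriv₂, quadratic_eq_sub_criticalCos_mul (by linarith)]
  have hfactor := mul_nonneg (sub_nonneg.2 hx) (quadratic_cofactor_pos hT x).le
  exact div_nonpos_of_nonpos_of_nonneg (neg_nonpos.2 (mul_nonneg (by positivity) hfactor))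
    (pow_pos (poissonDenom_pos hT x) _).le

lemma poissonCircleDeriv₂_nonneg (hT : 1 < T) (hx : Real.cos (2 * Real.pi * x) ≤ criticalCos T) :
    0 ≤ poissonCircleDeriv₂ T x := by
  have hT1 : 0 ≤ T ^ 2 - 1 := by nlinarith
  rw [poissonCircleDeriv₂, quadratic_eq_sub_criticalCos_mul (by linarith)]
  have hfactor := mul_nonpos_of_nonpos_of_nonneg (sub_nonpos.2 hx) (quadratic_cofactor_pos hT x).le
  exact div_nonneg (neg_nonneg.2 (mul_nonpos_of_nonneg_of_nonpos (by positivity) hfactor))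
    (pow_pos (poissonDenom_pos hT x) _).le

lemma two_pi_mul_criticalPoint (T : ℝ) :
    2 * Real.pi * criticalPoint T = Real.arccos (criticalCos T) :=
  mul_div_cancel₀ _ (by positivity)

lemma cos_criticalPoint (hT : 1 < T) :
    Real.cos (2 * Real.pi * criticalPoint T) = criticalCos T := by
  rw [two_pi_mul_criticalPoint, Real.cos_arccos
    (by linarith [criticalCos_pos (zero_lt_one.trans hT)]) (criticalCos_lt_one hT).le]

lemma criticalPoint_mem_Icc (T : ℝ) : criticalPoint T ∈ Icc (0 : ℝ) (1 / 2) := by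
  constructor
  · exact div_nonneg (Real.arccos_nonneg _) (by positivity)
  · rw [criticalPoint, div_le_iff₀ (by positivity)]
    linarith [Real.arccos_le_pi (criticalCos T)]

lemma cos_two_pi_mul_le_cos {y : ℝ} (hx : 0 ≤ x) (hxy : x ≤ y) (hy : y ≤ 1 / 2) :
    Real.cos (2 * Real.pi * y) ≤ Real.cos (2 * Real.pi * x) :=
  Real.cos_le_cos_of_nonneg_of_le_pi (by positivity) (by nlinarith [Real.pi_pos]) (by gcongr)

lemma integral_abs_poissonCircleDeriv₂_eq (hT : 1 < T) :
    ∫ x in (0 : ℝ)..1, |poissonCircleDeriv₂ T x| =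
      -4 * poissonCircleDeriv T (criticalPoint T) := by
  obtain ⟨hcrit0, hcrit⟩ := criticalPoint_mem_Icc T
  have hcont := continuous_poissonCircleDeriv₂ hT
  have hinner : ∫ x in (0 : ℝ)..criticalPoint T, |poissonCircleDeriv₂ T x| =
      poissonCircleDeriv T 0 - poissonCircleDeriv T (criticalPoint T) :=
    integral_abs_eq_sub_of_nonpos hcrit0 (hasDerivAt_poissonCircleDeriv hT) hcont fun x hx =>
      poissonCircleDeriv₂_nonpos hT (cos_criticalPoint hT ▸ cos_two_pi_mul_le_cos hx.1 hx.2 hcrit)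
  have houter : ∫ x in criticalPoint T..(1 / 2), |poissonCircleDeriv₂ T x| =
      poissonCircleDeriv T (1 / 2) - poissonCircleDeriv T (criticalPoint T) :=
    integral_abs_eq_sub_of_nonneg hcrit (hasDerivAt_poissonCircleDeriv hT) hcont fun x hx =>
      poissonCircleDeriv₂_nonneg hT (cos_criticalPoint hT ▸ cos_two_pi_mul_le_cos hcrit0 hx.1 hx.2)
  have hzero : poissonCircleDeriv T 0 = 0 := by simp [poissonCircleDeriv]
  have hhalf : poissonCircleDeriv T (1 / 2) = 0 := by
    rw [poissonCircleDeriv, show 2 * Real.pi * (1 / 2) = Real.pi by ring, Real.sin_pi]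
    simp
  rw [integral_eq_two_mul_of_one_sub hcont.abs fun x => by rw [poissonCircleDeriv₂_one_sub],
    ← intervalIntegral.integral_add_adjacent_intervals (hcont.abs.intervalIntegrable _ _)
      (hcont.abs.intervalIntegrable _ _), hinner, houter, hzero, hhalf]
  ring

lemma integral_abs_poissonCircleDeriv₂ (hT : 1 < T) :
    ∫ x in (0 : ℝ)..1, |poissonCircleDeriv₂ T x| =
      16 * Real.pi * (T ^ 2 - 1) * √(16 * T ^ 2 - (√(T ^ 4 + 34 * T ^ 2 + 1) - 1 - T ^ 2) ^ 2) /
        (3 * T ^ 2 + 3 - √(T ^ 4 + 34 * T ^ 2 + 1)) ^ 2 := by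
  have hT0 : 0 < T := by linarith
  have hcrit := four_mul_criticalCos hT0
  have hsqrt : √(16 * T ^ 2 - (√(T ^ 4 + 34 * T ^ 2 + 1) - 1 - T ^ 2) ^ 2) =
      4 * T * √(1 - criticalCos T ^ 2) := by
    rw [← hcrit, show 16 * T ^ 2 - (4 * T * criticalCos T) ^ 2 =
      (4 * T) ^ 2 * (1 - criticalCos T ^ 2) by ring, Real.sqrt_mul (by positivity),
      Real.sqrt_sq (by positivity)]
  have hdenom : 3 * T ^ 2 + 3 - √(T ^ 4 + 34 * T ^ 2 + 1) =
      2 * (T ^ 2 + 1 - 2 * T * criticalCos T) := by linear_combination hcrit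
  have : T ^ 2 + 1 - 2 * T * criticalCos T ≠ 0 := by nlinarith [criticalCos_lt_one hT]
  rw [integral_abs_poissonCircleDeriv₂_eq hT, poissonCircleDeriv, poissonDenom,
    cos_criticalPoint hT, two_pi_mul_criticalPoint, Real.sin_arccos, hsqrt, hdenom]
  field_simp
  ring

end PoissonNorm

/-! ### Derivative bounds on the unit circle -/

lemma exists_norm_le_of_periodic {k : ℝ → ℝ} (hk : Continuous k) (hper : Function.Periodic k 1) :
    ∃ C, ∀ x, ‖k x‖ ≤ C := by
  obtain ⟨C, hC⟩ := (isCompact_Icc (a := (0 : ℝ)) (b := 1)).exists_bound_of_continuousOn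
    hk.continuousOn
  refine ⟨C, fun x => ?_⟩
  obtain ⟨y, hy, hxy⟩ := hper.exists_mem_Ico₀ one_pos x
  rw [hxy]
  exact hC y (Ico_subset_Icc_self hy)

lemma hasDerivAt_integral_mul_of_periodic {k k' g : ℝ → ℝ} (hk : ∀ x, HasDerivAt k (k' x) x)
    (hk' : Continuous k') (hper : Function.Periodic k' 1) (hg : Continuous g) (φ : ℝ) :
    HasDerivAt (fun φ => ∫ t in (0 : ℝ)..1, k (φ - t) * g t)
      (∫ t in (0 : ℝ)..1, k' (φ - t) * g t) φ := by
  have hkc : Continuous k := continuous_iff_continuousAt.2 fun x => (hk x).continuousAt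
  obtain ⟨C, hC⟩ := exists_norm_le_of_periodic hk' hper
  refine (intervalIntegral.hasDerivAt_integral_of_dominated_loc_of_deriv_le
    (F := fun φ t => k (φ - t) * g t) (F' := fun φ t => k' (φ - t) * g t)
    (bound := fun t => C * ‖g t‖) univ_mem ?_ ?_ ?_ ?_ ?_ ?_).2
  · exact Eventually.of_forall fun x => (by fun_prop : Continuous _).aestronglyMeasurable
  · exact (by fun_prop : Continuous _).intervalIntegrable _ _
  · exact (by fun_prop : Continuous _).aestronglyMeasurable
  · refine Eventually.of_forall fun t _ x _ => ?_
    rw [norm_mul]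
    exact mul_le_mul_of_nonneg_right (hC _) (norm_nonneg _)
  · exact (by fun_prop : Continuous _).intervalIntegrable _ _
  · refine Eventually.of_forall fun t _ x _ => ?_
    exact ((hk (x - t)).comp_sub_const x t).mul_const (g t)

lemma abs_integral_mul_le_of_periodic {k g : ℝ → ℝ} (hk : Continuous k)
    (hper : Function.Periodic k 1) (hg : Continuous g) {A : ℝ} (hA : ∀ t, |g t| ≤ A) (φ : ℝ) :
    |∫ t in (0 : ℝ)..1, k (φ - t) * g t| ≤ A * ∫ t in (0 : ℝ)..1, |k t| := by
  have htranslate : ∫ t in (0 : ℝ)..1, |k (φ - t)| = ∫ t in (0 : ℝ)..1, |k t| := by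
    have habs : Function.Periodic (fun t => |k t|) 1 := fun x => by simp only [hper x]
    rw [intervalIntegral.integral_comp_sub_left (fun t => |k t|) φ]
    simpa using habs.intervalIntegral_add_eq (φ - 1) 0
  calc |∫ t in (0 : ℝ)..1, k (φ - t) * g t|
      ≤ ∫ t in (0 : ℝ)..1, |k (φ - t) * g t| :=
        intervalIntegral.abs_integral_le_integral_abs zero_le_one
    _ ≤ ∫ t in (0 : ℝ)..1, A * |k (φ - t)| := by
        refine intervalIntegral.integral_mono_on zero_le_one
          ((by fun_prop : Continuous _).intervalIntegrable _ _)
          ((by fun_prop : Continuous _).intervalIntegrable _ _) fun t _ => ?_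
        rw [abs_mul, mul_comm A]
        exact mul_le_mul_of_nonneg_left (hA t) (abs_nonneg _)
    _ = A * ∫ t in (0 : ℝ)..1, |k t| := by
        rw [intervalIntegral.integral_const_mul, htranslate]

lemma norm_mul_e_sub_e_sq (T t φ : ℝ) : ‖(T : ℂ) * e t - e φ‖ ^ 2 = poissonDenom T (φ - t) := by
  rw [← Complex.normSq_eq_norm_sq, e_eq_exp_mul_I, e_eq_exp_mul_I, Complex.normSq_apply]
  simp only [Complex.sub_re, Complex.sub_im, Complex.re_ofReal_mul, Complex.im_ofReal_mul,
    Complex.exp_ofReal_mul_I_re, Complex.exp_ofReal_mul_I_im, poissonDenom, mul_sub, Real.cos_sub]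
  linear_combination T ^ 2 * Real.sin_sq_add_cos_sq (2 * Real.pi * t) +
    Real.sin_sq_add_cos_sq (2 * Real.pi * φ)

section CircleDerivatives

variable {h : ℂ → ℝ} {T A c : ℝ}

lemma norm_mul_e (hT : 0 ≤ T) (t : ℝ) : ‖(T : ℂ) * e t‖ = T := by
  rw [norm_mul, norm_e, mul_one, Complex.norm_real, Real.norm_of_nonneg hT]

lemma eq_integral_poissonCircle (hT : 1 < T) (hh : HarmonicOnNhd h (closedBall 0 T)) (φ : ℝ) :
    h (e φ) = ∫ t in (0 : ℝ)..1, poissonCircle T (φ - t) * h (T * e t) := by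
  have hpoisson := hh.circleAverage_poissonKernel_smul (w := e φ) (by simpa [norm_e] using hT)
  rw [circleAverage_eq_integral_e, ← intervalIntegral.integral_of_le zero_le_one] at hpoisson
  rw [← hpoisson]
  refine intervalIntegral.integral_congr fun t _ => ?_
  simp only [Pi.smul_apply', smul_eq_mul, poissonKernel_def, zero_add, sub_zero, norm_e,
    norm_mul_e (zero_le_one.trans hT.le), norm_mul_e_sub_e_sq, poissonCircle, one_pow]

lemma continuous_comp_mul_e (hT : 0 ≤ T) (hh : HarmonicOnNhd h (closedBall 0 T)) :
    Continuous fun t : ℝ => h (T * e t) :=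
  hh.continuousOn.comp_continuous (f := fun t : ℝ => (T : ℂ) * e t)
    (continuous_const.mul continuous_e) fun t => by rw [mem_closedBall_zero_iff, norm_mul_e hT]

/-- Subtracting the constant `c` before differentiating under the integral sign lets the derivative
be estimated by the oscillation of `h` alone. -/
lemma deriv_comp_e (hT : 1 < T) (hh : HarmonicOnNhd h (closedBall 0 T)) (c : ℝ) :
    deriv (fun t : ℝ => h (e t)) =
      fun φ => ∫ t in (0 : ℝ)..1, poissonCircleDeriv T (φ - t) * (h (T * e t) - c) := by
  have hcent : HarmonicOnNhd (fun w => h w - c) (closedBall 0 T) :=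
    hh.sub (harmonicOnNhd_const c)
  have hformula : (fun t : ℝ => h (e t)) =
      fun φ => (∫ t in (0 : ℝ)..1, poissonCircle T (φ - t) * (h (T * e t) - c)) + c :=
    funext fun φ => by rw [← eq_integral_poissonCircle hT hcent φ, sub_add_cancel]
  rw [hformula]
  exact funext fun φ => ((hasDerivAt_integral_mul_of_periodic (hasDerivAt_poissonCircle hT)
    (continuous_poissonCircleDeriv hT) (periodic_poissonCircleDeriv T)
    (continuous_comp_mul_e (by linarith) hcent) φ).add_const c).deriv

lemma abs_iteratedDeriv_one_comp_e_le (hT : 1 < T) (hh : HarmonicOnNhd h (closedBall 0 T))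
    (hA : ∀ w : ℂ, ‖w‖ ≤ T → |h w - c| ≤ A) (φ : ℝ) :
    |iteratedDeriv 1 (fun t : ℝ => h (e t)) φ| ≤ A * (8 * T / (T ^ 2 - 1)) := by
  have hT0 : 0 ≤ T := by linarith
  rw [iteratedDeriv_one, deriv_comp_e hT hh c, ← integral_abs_poissonCircleDeriv hT]
  exact abs_integral_mul_le_of_periodic (continuous_poissonCircleDeriv hT)
    (periodic_poissonCircleDeriv T) ((continuous_comp_mul_e hT0 hh).sub continuous_const)
    (fun t => hA _ (norm_mul_e hT0 t).le) φ

lemma abs_iteratedDeriv_two_comp_e_le (hT : 1 < T) (hh : HarmonicOnNhd h (closedBall 0 T))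
    (hA : ∀ w : ℂ, ‖w‖ ≤ T → |h w - c| ≤ A) (φ : ℝ) :
    |iteratedDeriv 2 (fun t : ℝ => h (e t)) φ| ≤ A * (16 * Real.pi * (T ^ 2 - 1) *
        √(16 * T ^ 2 - (√(T ^ 4 + 34 * T ^ 2 + 1) - 1 - T ^ 2) ^ 2) /
      (3 * T ^ 2 + 3 - √(T ^ 4 + 34 * T ^ 2 + 1)) ^ 2) := by
  have hT0 : 0 ≤ T := by linarith
  have hcont : Continuous fun t : ℝ => h (T * e t) - c :=
    (continuous_comp_mul_e hT0 hh).sub continuous_const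
  rw [iteratedDeriv_succ, iteratedDeriv_one, deriv_comp_e hT hh c,
    (hasDerivAt_integral_mul_of_periodic (hasDerivAt_poissonCircleDeriv hT)
      (continuous_poissonCircleDeriv₂ hT) (periodic_poissonCircleDeriv₂ T) hcont φ).deriv,
    ← integral_abs_poissonCircleDeriv₂ hT]
  exact abs_integral_mul_le_of_periodic (continuous_poissonCircleDeriv₂ hT)
    (periodic_poissonCircleDeriv₂ T) hcont (fun t => hA _ (norm_mul_e hT0 t).le) φ

end CircleDerivatives

/-! ### Extended integrals of functions bounded above -/

lemma coe_sub_coe_sub (b : ℝ) (x : EReal) : (b : EReal) - (b - x) = x := by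
  induction x with
  | bot => simp
  | top => simp
  | coe x => rw [← EReal.coe_sub, ← EReal.coe_sub, sub_sub_cancel]

lemma coe_sub_toENNReal_coe_sub {b : ℝ} {x : EReal} (h : x ≤ b) :
    (b : EReal) - ((b - x).toENNReal : EReal) = x := by
  rw [EReal.coe_toENNReal (EReal.sub_nonneg (by simp) (by simp) |>.2 h), coe_sub_coe_sub]

lemma toENNReal_coe_sub_add_toENNReal {x : EReal} {b : ℝ} (h : x ≤ b) :
    (b - x).toENNReal + x.toENNReal + ENNReal.ofReal (-b) =
      ENNReal.ofReal b + (-x).toENNReal := by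
  induction x with
  | bot => simp
  | top => simp at h
  | coe a =>
    have hab : a ≤ b := EReal.coe_le_coe_iff.1 h
    rw [← EReal.coe_sub, ← EReal.coe_neg]
    simp only [EReal.real_coe_toENNReal]
    rw [← ENNReal.toReal_eq_toReal_iff' (by finiteness) (by finiteness)]
    simp only [ENNReal.toReal_add, ENNReal.ofReal_ne_top, ENNReal.add_ne_top, ne_eq,
      not_false_eq_true, and_self, ENNReal.toReal_ofReal']
    grind

lemma coe_sub_coe_of_add_eq {a b c d g : ℝ≥0∞} (ha : a ≠ ⊤) (hb : b ≠ ⊤) (hc : c ≠ ⊤)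
    (h : g + a + c = b + d) :
    (a : EReal) - d = ((b.toReal - c.toReal : ℝ) : EReal) - g := by
  lift a to NNReal using ha
  lift b to NNReal using hb
  lift c to NNReal using hc
  induction g with
  | top =>
    obtain rfl : d = ⊤ := by simpa [eq_comm] using h
    simp
  | coe g =>
    have hd : d ≠ ⊤ := by
      rintro rfl
      simp [← ENNReal.coe_add] at h
    lift d to NNReal using hd
    have hreal : (g : ℝ) + a + c = b + d := by exact_mod_cast h
    simp only [EReal.coe_nnreal_eq_coe_real, ENNReal.coe_toReal, ← EReal.coe_sub,
      EReal.coe_eq_coe_iff]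
    linarith

lemma extIntegral_eq_sub {α : Type*} [MeasurableSpace α] {ν : Measure α} {f : α → EReal}
    {b : α → ℝ} (hf : Measurable f) (hb : Integrable b ν) (hfb : ∀ᵐ x ∂ν, f x ≤ b x) :
    extIntegral ν f = ((∫ x, b x ∂ν : ℝ) : EReal) -
      ((∫⁻ x, (b x - f x).toENNReal ∂ν : ℝ≥0∞) : EReal) := by
  have hbm : AEMeasurable b ν := hb.aestronglyMeasurable.aemeasurable
  have hb_pos : ∫⁻ x, ENNReal.ofReal (b x) ∂ν ≠ ⊤ := hb.lintegral_lt_top.ne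
  have hb_neg : ∫⁻ x, ENNReal.ofReal (-b x) ∂ν ≠ ⊤ := hb.neg.lintegral_lt_top.ne
  have hf_pos : ∫⁻ x, (f x).toENNReal ∂ν ≠ ⊤ := by
    refine ne_top_of_le_ne_top hb_pos (lintegral_mono_ae ?_)
    filter_upwards [hfb] with x hx
    simpa using EReal.toENNReal_le_toENNReal hx
  rw [extIntegral, integral_eq_lintegral_pos_part_sub_lintegral_neg_part hb]
  refine coe_sub_coe_of_add_eq hf_pos hb_pos hb_neg ?_
  have hbm_neg : AEMeasurable (fun x => ENNReal.ofReal (-b x)) ν := hbm.neg.ennreal_ofReal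
  rw [← lintegral_add_right _ hf.ereal_toENNReal, ← lintegral_add_right' _ hbm_neg,
    ← lintegral_add_left' hbm.ennreal_ofReal]
  exact lintegral_congr_ae (hfb.mono fun x hx => toENNReal_coe_sub_add_toENNReal hx)

/-! ### Reduction to superharmonic functions -/

/-- The nonnegative superharmonic function `B - v`, extended by zero outside the open disc of
radius `R`. -/
def superPart (v : ℂ → EReal) (B R : ℝ) : ℂ → ℝ≥0∞ :=
  (ball (0 : ℂ) R).indicator fun z => ((B : EReal) - v z).toENNReal

section superPart

variable {v : ℂ → EReal} {B R m : ℝ}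

lemma superPart_of_norm_lt {z : ℂ} (hz : ‖z‖ < R) :
    superPart v B R z = ((B : EReal) - v z).toENNReal :=
  indicator_of_mem (mem_ball_zero_iff.2 hz) _

lemma superPart_eq_ofReal {z : ℂ} {t : ℝ} (hz : ‖z‖ < R) (hv : v z = t) :
    superPart v B R z = ENNReal.ofReal (B - t) := by
  rw [superPart_of_norm_lt hz, hv, ← EReal.coe_sub, EReal.real_coe_toENNReal]

lemma continuous_toENNReal_coe_sub (B : ℝ) :
    Continuous fun x : EReal => ((B : EReal) - x).toENNReal := by
  refine EReal.continuous_toENNReal.comp (continuous_iff_continuousAt.2 fun x => ?_)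
  change ContinuousAt (fun x : EReal => (B : EReal) + -x) x
  exact ContinuousAt.comp (f := fun x : EReal => ((B : EReal), -x))
    (EReal.continuousAt_add (Or.inl (EReal.coe_ne_top B)) (Or.inl (EReal.coe_ne_bot B)))
    (continuousAt_const.prodMk continuous_neg.continuousAt)

lemma antitone_toENNReal_coe_sub (B : ℝ) :
    Antitone fun x : EReal => ((B : EReal) - x).toENNReal := fun _ _ h =>
  EReal.toENNReal_le_toENNReal (EReal.sub_le_sub le_rfl h)

namespace SubharmonicOn

lemma lowerSemicontinuous_superPart (hv : SubharmonicOn v (closedBall 0 R)) :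
    LowerSemicontinuous (superPart v B R) := fun z y hy => by
  have hz : z ∈ ball (0 : ℂ) R := mem_of_indicator_ne_zero (ne_bot_of_gt hy)
  have husc : UpperSemicontinuousWithinAt v (closedBall 0 R) z :=
    hv.upperSemicontinuousOn z (ball_subset_closedBall hz)
  have hlsc := (continuous_toENNReal_coe_sub B).continuousAt
    |>.comp_upperSemicontinuousWithinAt_antitone husc (antitone_toENNReal_coe_sub B)
  have hev := hlsc y (hy.trans_eq (superPart_of_norm_lt (mem_ball_zero_iff.1 hz)))
  rw [nhdsWithin_eq_nhds.2 (mem_of_superset (isOpen_ball.mem_nhds hz) ball_subset_closedBall)]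
    at hev
  filter_upwards [hev, isOpen_ball.mem_nhds hz] with x hx hxR
  rwa [superPart_of_norm_lt (mem_ball_zero_iff.1 hxR)]

lemma lcircleMean_superPart_le (hv : SubharmonicOn v (closedBall 0 R))
    (hB : ∀ z ∈ closedBall (0 : ℂ) R, v z ≤ B) {z : ℂ} {r : ℝ} (hr : 0 < r) (hzr : ‖z‖ + r < R) :
    lcircleMean (superPart v B R) z r ≤ superPart v B R z := by
  have hlt : ∀ θ : ℝ, ‖z + r * e θ‖ < R := fun θ =>
    (norm_le_of_mem_sphere (add_mul_e_mem_sphere z hr.le θ)).trans_lt hzr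
  have hmem : ∀ θ : ℝ, z + r * e θ ∈ closedBall (0 : ℂ) R := fun θ =>
    mem_closedBall_zero_iff.2 (hlt θ).le
  have hmeas : Measurable fun θ : ℝ => v (z + r * e θ) := by
    have hcircle : Continuous fun θ : ℝ => z + r * e θ := by fun_prop
    exact UpperSemicontinuous.measurable (upperSemicontinuousOn_univ_iff.1
      (hv.upperSemicontinuousOn.comp hcircle.continuousOn fun θ _ => hmem θ))
  have hmean : circleMean v z r = B - (lcircleMean (superPart v B R) z r : EReal) := by
    rw [circleMean, extIntegral_eq_sub (b := fun _ => B) hmeas (integrable_const _)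
      (.of_forall fun θ => hB _ (hmem θ)), lcircleMean]
    simp [superPart_of_norm_lt (hlt _)]
  have hle := hv.le_circleMean z r hr (closedBall_subset_closedBall' (by simpa using by linarith))
  rw [hmean] at hle
  calc lcircleMean (superPart v B R) z r
      = ((B : EReal) - (B - (lcircleMean (superPart v B R) z r : EReal))).toENNReal := by
        rw [coe_sub_coe_sub, EReal.toENNReal_coe]
    _ ≤ ((B : EReal) - v z).toENNReal := antitone_toENNReal_coe_sub B hle
    _ = superPart v B R z := (superPart_of_norm_lt (by linarith)).symm

theorem isSuperharmonicDisc_superPart (hv : SubharmonicOn v (closedBall 0 R))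
    (hB : ∀ z ∈ closedBall (0 : ℂ) R, v z ≤ B) (hm : v 0 = m) (hR : 0 < R) :
    IsSuperharmonicDisc (superPart v B R) R where
  lsc := hv.lowerSemicontinuous_superPart
  mean _ _ hr hzr := hv.lcircleMean_superPart_le hB hr hzr
  outside _ hz := indicator_of_notMem (by simpa using hz) _
  finite := by
    rw [superPart_eq_ofReal (by simpa using hR) hm]
    exact ENNReal.ofReal_ne_top

end SubharmonicOn

end superPart

/-! ### Logarithmic and Green potentials -/

section potential

variable {μ : Measure ℂ} {R S : ℝ} {z w : ℂ}

lemma log_enorm_sub_le_greenRegular (hR : 0 < R) (hz : ‖z‖ ≤ R) (hw : ‖w‖ ≤ R) :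
    ENNReal.log ‖z - w‖ₑ ≤ greenRegular R z w := by
  rcases eq_or_ne z w with rfl | hne
  · simp
  · rw [← ofReal_norm, ENNReal.log_ofReal_of_pos (norm_pos_iff.2 (sub_ne_zero.2 hne)),
      EReal.coe_le_coe_iff]
    exact log_norm_sub_le_greenRegular hR hz hw hne

lemma toENNReal_greenRegular_sub_log_enorm (R : ℝ) (z w : ℂ) :
    ((greenRegular R z w : EReal) - ENNReal.log ‖z - w‖ₑ).toENNReal = green R z w := by
  rw [green, posSubLog, ofReal_norm]

lemma ae_restrict_ball_norm_lt (μ : Measure ℂ) (S : ℝ) :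
    ∀ᵐ z ∂μ.restrict (ball 0 S), ‖z‖ < S :=
  (ae_restrict_mem measurableSet_ball).mono fun _ => mem_ball_zero_iff.1

variable [IsFiniteMeasureOnCompacts μ]

lemma integrable_greenRegular (hSR : S < R) (hw : ‖w‖ < S) :
    Integrable (fun z => greenRegular R z w) (μ.restrict (ball 0 S)) := by
  refine Integrable.of_mem_Icc (Real.log (R ^ 2 - S ^ 2) - Real.log R) (Real.log (2 * R))
    (Measurable.of_uncurry_right (f := greenRegular R) (measurable_greenRegular R)).aemeasurable ?_
  filter_upwards [ae_restrict_ball_norm_lt μ S] with z hz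
  exact ⟨log_sub_log_le_greenRegular hSR hz hw,
    greenRegular_le_log_two_mul (hz.trans hSR) (hw.trans hSR)⟩

lemma logPotential_eq_sub_greenPotential (hSR : S < R) (hw : ‖w‖ < S) :
    logPotential μ (ball 0 S) w =
      ((∫ z in ball 0 S, greenRegular R z w ∂μ : ℝ) : EReal) - greenPotential μ R S w := by
  have hR : 0 < R := (norm_nonneg w).trans_lt (hw.trans hSR)
  have hmeas : Measurable fun z : ℂ => ENNReal.log ‖z - w‖ₑ :=
    ENNReal.measurable_log.comp (by fun_prop)
  rw [logPotential, extIntegral_eq_sub hmeas (integrable_greenRegular hSR hw)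
    ((ae_restrict_ball_norm_lt μ S).mono fun z hz =>
      log_enorm_sub_le_greenRegular hR (hz.trans hSR).le (hw.trans hSR).le)]
  simp only [toENNReal_greenRegular_sub_log_enorm, greenPotential]

end potential

/-! ### The harmonic part of a subharmonic function -/

section

variable {μ : Measure ℂ} [IsFiniteMeasureOnCompacts μ] {R S : ℝ} {w : ℂ}

lemma harmonicOnNhd_integral_greenRegular (hSR : S < R) :
    HarmonicOnNhd (fun w => ∫ z in ball 0 S, greenRegular R z w ∂μ) (ball 0 S) := by
  refine harmonicOnNhd_integral (measurable_greenRegular R)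
    (C := max |Real.log (R ^ 2 - S ^ 2) - Real.log R| |Real.log (2 * R)|) ?_ ?_
  · filter_upwards [ae_restrict_ball_norm_lt μ S] with z hz w hw
    exact harmonicAt_greenRegular
      (norm_mul_norm_lt_sq (hz.trans hSR) ((mem_ball_zero_iff.1 hw).trans hSR).le)
  · filter_upwards [ae_restrict_ball_norm_lt μ S] with z hz w hw
    have hwS : ‖w‖ < S := mem_ball_zero_iff.1 hw
    exact abs_le_max_abs_abs (log_sub_log_le_greenRegular hSR hz hwS)
      (greenRegular_le_log_two_mul (hz.trans hSR) (hwS.trans hSR))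

lemma integral_greenRegular_zero (μ : Measure ℂ) (R S : ℝ) :
    ∫ z in ball 0 S, greenRegular R z 0 ∂μ = μ.real (ball 0 S) * Real.log R := by
  simp only [greenRegular_zero, integral_const, measureReal_restrict_apply_univ, smul_eq_mul]

lemma measureReal_mul_log_sub_log_le_integral_greenRegular (hSR : S < R) (hw : ‖w‖ < S) :
    μ.real (ball 0 S) * (Real.log (R ^ 2 - S ^ 2) - Real.log R) ≤
      ∫ z in ball 0 S, greenRegular R z w ∂μ := by
  rw [← smul_eq_mul, ← setIntegral_const]
  exact setIntegral_mono_on (integrable_const _) (integrable_greenRegular hSR hw)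
    measurableSet_ball fun z hz => log_sub_log_le_greenRegular hSR (mem_ball_zero_iff.1 hz) hw

lemma ofReal_measureReal_mul_log_le_greenPotential_zero (hS : 0 < S) (hR : 0 < R) :
    ENNReal.ofReal (μ.real (ball 0 S) * Real.log (R / S)) ≤ greenPotential μ R S 0 := by
  rw [ENNReal.ofReal_mul measureReal_nonneg, ofReal_measureReal measure_ball_lt_top.ne, mul_comm,
    ← setLIntegral_const]
  exact setLIntegral_mono' measurableSet_ball fun z hz =>
    ofReal_log_div_le_green_zero hR hS (mem_ball_zero_iff.1 hz).le

end

/-- The harmonic summand of `v` when `B - v` is the sum of the Green potential of `μ` and the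
harmonic function `H` on the disc of radius `S`. -/
def harmonicPart (B : ℝ) (H : ℂ → ℝ) (μ : Measure ℂ) (R S : ℝ) (w : ℂ) : ℝ :=
  B - H w - ∫ z in ball 0 S, greenRegular R z w ∂μ

lemma coe_sub_coe_add_ofReal (b i : ℝ) {h : ℝ} (hh : 0 ≤ h) (g : ℝ≥0∞) :
    (b : EReal) - ((g + ENNReal.ofReal h : ℝ≥0∞) : EReal) = i - g + ((b - h - i : ℝ) : EReal) := by
  induction g with
  | top => simp
  | coe g =>
    rw [EReal.coe_ennreal_add, EReal.coe_ennreal_ofReal, max_eq_left hh,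
      EReal.coe_nnreal_eq_coe_real]
    norm_cast
    ring

section harmonicPart

variable {v : ℂ → EReal} {H : ℂ → ℝ} {μ : Measure ℂ} [IsFiniteMeasureOnCompacts μ]
  {B m R S : ℝ} {w : ℂ}

lemma harmonicOnNhd_harmonicPart (B : ℝ) (hSR : S < R) (hH : HarmonicOnNhd H (ball 0 S)) :
    HarmonicOnNhd (harmonicPart B H μ R S) (ball 0 S) :=
  ((harmonicOnNhd_const B).sub hH).sub (harmonicOnNhd_integral_greenRegular hSR)

lemma eq_logPotential_add_harmonicPart (hSR : S < R) (hw : ‖w‖ < S) (hB : v w ≤ B)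
    (hH : 0 ≤ H w)
    (hdec : superPart v B R w = greenPotential μ R S w + ENNReal.ofReal (H w)) :
    v w = logPotential μ (ball 0 S) w + harmonicPart B H μ R S w := by
  rw [superPart_of_norm_lt (hw.trans hSR)] at hdec
  rw [logPotential_eq_sub_greenPotential hSR hw, harmonicPart, ← coe_sub_coe_add_ofReal _ _ hH,
    ← hdec, coe_sub_toENNReal_coe_sub hB]

lemma measureReal_mul_log_add_le (hS : 0 < S) (hSR : S < R) (hB : v 0 ≤ B) (hm : v 0 = m)
    (hH : 0 ≤ H 0)
    (hdec : superPart v B R 0 = greenPotential μ R S 0 + ENNReal.ofReal (H 0)) :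
    μ.real (ball 0 S) * Real.log (R / S) + H 0 ≤ B - m := by
  have hlog : 0 ≤ Real.log (R / S) := Real.log_nonneg ((one_le_div hS).2 hSR.le)
  have hBm : 0 ≤ B - m := sub_nonneg.2 (EReal.coe_le_coe_iff.1 (hm ▸ hB))
  rw [← ENNReal.ofReal_le_ofReal_iff hBm, ENNReal.ofReal_add (by positivity) hH,
    ← superPart_eq_ofReal (by simpa using hS.trans hSR) hm, hdec]
  gcongr
  exact ofReal_measureReal_mul_log_le_greenPotential_zero hS (hS.trans hSR)

lemma harmonicPart_sub_harmonicPart_zero_le (B : ℝ) (hSR : S < R) (hw : ‖w‖ < S)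
    (hH : 0 ≤ H w) :
    harmonicPart B H μ R S w - harmonicPart B H μ R S 0 ≤
      H 0 + μ.real (ball 0 S) * Real.log (R ^ 2 / (R ^ 2 - S ^ 2)) := by
  have hS : 0 < S := (norm_nonneg w).trans_lt hw
  have hR : 0 < R := hS.trans hSR
  have hlow := measureReal_mul_log_sub_log_le_integral_greenRegular (μ := μ) hSR hw
  rw [harmonicPart, harmonicPart, integral_greenRegular_zero,
    Real.log_div (by positivity) (by nlinarith), Real.log_pow]
  push_cast
  linarith

end harmonicPart

/-! ### The constants -/

section constants

variable {R S T : ℝ}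

lemma ite_log_eq_max (hS : 0 < S) (hSR : S < R) :
    (if R < R ^ 2 - S ^ 2 then Real.log R else Real.log (R ^ 2 / (R ^ 2 - S ^ 2))) =
      max (Real.log R) (Real.log (R ^ 2 / (R ^ 2 - S ^ 2))) := by
  have hR : 0 < R := hS.trans hSR
  have hsq : 0 < R ^ 2 - S ^ 2 := by nlinarith
  split_ifs with h
  · refine (max_eq_left (Real.log_le_log (by positivity) ?_)).symm
    rw [div_le_iff₀ hsq]
    nlinarith
  · refine (max_eq_right (Real.log_le_log hR ?_)).symm
    rw [le_div_iff₀ hsq]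
    nlinarith

lemma add_mul_le_div_mul_max {D M H ℓ L N : ℝ} (hℓ : 0 < ℓ) (hℓN : ℓ ≤ N) (hH : 0 ≤ H)
    (hM : 0 ≤ M) (hD : M * ℓ + H ≤ D) : H + M * L ≤ D / ℓ * max N L := by
  have hmax : ℓ ≤ max N L := hℓN.trans (le_max_left N L)
  have hmax0 : 0 ≤ max N L := hℓ.le.trans hmax
  calc H + M * L ≤ H * (max N L / ℓ) + M * max N L := by
        gcongr
        · exact le_mul_of_one_le_right hH ((one_le_div hℓ).2 hmax)
        · exact le_max_right N L
    _ = (M * ℓ + H) / ℓ * max N L := by field_simp; ring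
    _ ≤ D / ℓ * max N L := by gcongr

/-- A one-sided bound on `h - h 0` is a two-sided bound on a smaller disc, by the Harnack
inequality for the nonnegative function `h 0 + K - h`. -/
lemma exists_abs_sub_le_of_sub_le {h : ℂ → ℝ} {K : ℝ} (hTS : T < S)
    (hh : HarmonicOnNhd h (ball 0 S)) (hK : ∀ w ∈ ball (0 : ℂ) S, h w - h 0 ≤ K) :
    ∃ c : ℝ, ∀ w : ℂ, ‖w‖ ≤ T → |h w - c| ≤ (S + T) / (S - T) * K / 2 := by
  refine ⟨h 0 + K - (S + T) / (S - T) * K / 2, fun w hw => ?_⟩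
  have hg : HarmonicOnNhd (fun w => h 0 + K - h w) (ball 0 S) :=
    (harmonicOnNhd_const (h 0 + K)).sub hh
  have hharnack := le_mul_of_harmonicOnNhd_ball hg (fun z hz => by linarith [hK z hz]) hTS hw
  have hKw := hK w (mem_ball_zero_iff.2 (hw.trans_lt hTS))
  rw [add_sub_cancel_left] at hharnack
  rw [abs_le]
  constructor <;> linarith

lemma exists_abs_harmonicPart_sub_le {μ : Measure ℂ} [IsFiniteMeasureOnCompacts μ] {H : ℂ → ℝ}
    (B : ℝ) {D : ℝ} (hS : 1 < S) (hTS : T < S) (hSR : S < R) (hH : HarmonicOnNhd H (ball 0 S))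
    (hH0 : ∀ w, 0 ≤ H w) (hD : μ.real (ball 0 S) * Real.log (R / S) + H 0 ≤ D) :
    ∃ c : ℝ, ∀ w : ℂ, ‖w‖ ≤ T → |harmonicPart B H μ R S w - c| ≤ B₀ R S T * D := by
  have hS0 : 0 < S := one_pos.trans hS
  have hlog : 0 < Real.log (R / S) := Real.log_pos ((one_lt_div hS0).2 hSR)
  have hlogR : Real.log (R / S) ≤ Real.log R :=
    Real.log_le_log (div_pos (hS0.trans hSR) hS0) (div_le_self (hS0.trans hSR).le hS.le)
  obtain ⟨c, hc⟩ := exists_abs_sub_le_of_sub_le hTS (harmonicOnNhd_harmonicPart B hSR hH)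
    fun w hw => (harmonicPart_sub_harmonicPart_zero_le B hSR (mem_ball_zero_iff.1 hw)
      (hH0 w)).trans (add_mul_le_div_mul_max hlog hlogR (hH0 0) measureReal_nonneg hD)
  refine ⟨c, fun w hw => (hc w hw).trans_eq ?_⟩
  rw [B₀, ite_log_eq_max hS0 hSR]
  ring

end constants

end EffectiveRiesz

end

open EffectiveRiesz in
theorem mainTheorem4 (R R₁ R₂ B m : ℝ) (hR₂ : 1 < R₂) (hR₂₁ : R₂ < R₁) (hR₁ : R₁ < R)
    (v : ℂ → EReal) (hv : EffectiveRiesz.SubharmonicOn v (Metric.closedBall 0 R))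
    (hB : ∀ z ∈ Metric.closedBall (0 : ℂ) R, v z ≤ (B : EReal)) (hm : v 0 = (m : EReal)) :
    ∃ (μ : MeasureTheory.Measure ℂ) (h : ℂ → ℝ),
      (∀ w ∈ Metric.ball (0 : ℂ) R₁,
        v w = EffectiveRiesz.logPotential μ (Metric.ball 0 R₁) w + (h w : EReal)) ∧
      μ (Metric.ball 0 R₁) ≤ ENNReal.ofReal ((B - m) / Real.log (R / R₁)) ∧
      InnerProductSpace.HarmonicOnNhd h (Metric.ball 0 R₁) ∧
      (∃ c : ℝ, ∀ w : ℂ, ‖w‖ ≤ R₂ → |h w - c| ≤ EffectiveRiesz.B₀ R R₁ R₂ * (B - m)) ∧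
      (∀ φ : ℝ, |iteratedDeriv 1 (fun t : ℝ => h (EffectiveRiesz.e t)) φ| ≤
        EffectiveRiesz.B₁ R R₁ R₂ * (B - m)) ∧
      (∀ φ : ℝ, |iteratedDeriv 2 (fun t : ℝ => h (EffectiveRiesz.e t)) φ| ≤
        EffectiveRiesz.B₂ R R₁ R₂ * (B - m)) := by
  have hR₁_one : 1 < R₁ := hR₂.trans hR₂₁
  have hR₁_pos : 0 < R₁ := one_pos.trans hR₁_one
  have hR_pos : 0 < R := hR₁_pos.trans hR₁
  have hlog : 0 < Real.log (R / R₁) := Real.log_pos ((one_lt_div hR₁_pos).2 hR₁)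
  obtain ⟨μ, H, hμ, hH, hH0, hdec⟩ :=
    (hv.isSuperharmonicDisc_superPart hB hm hR_pos).exists_riesz_decomposition hR₁_pos hR₁
  have hcentre : μ.real (ball 0 R₁) * Real.log (R / R₁) + H 0 ≤ B - m :=
    measureReal_mul_log_add_le hR₁_pos hR₁ (hB 0 (mem_closedBall_self hR_pos.le)) hm (hH0 0)
      (hdec 0 (by simpa using hR₁_pos))
  have hharm := harmonicOnNhd_harmonicPart (μ := μ) B hR₁ hH
  have hclosed := hharm.mono (closedBall_subset_ball hR₂₁)
  obtain ⟨c, hc⟩ := exists_abs_harmonicPart_sub_le B hR₁_one hR₂₁ hR₁ hH hH0 hcentre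
  refine ⟨μ, harmonicPart B H μ R R₁, fun w hw => ?_, ?_, hharm, ⟨c, hc⟩, fun φ => ?_, fun φ => ?_⟩
  · rw [mem_ball_zero_iff] at hw
    exact eq_logPotential_add_harmonicPart hR₁ hw
      (hB w (mem_closedBall_zero_iff.2 (hw.trans hR₁).le)) (hH0 w) (hdec w hw)
  · rw [← ofReal_measureReal measure_ball_lt_top.ne]
    exact ENNReal.ofReal_le_ofReal ((le_div_iff₀ hlog).2 (by linarith [hH0 0]))
  · rw [B₁, mul_right_comm]
    exact abs_iteratedDeriv_one_comp_e_le hR₂ hclosed hc φ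
  · rw [B₂, mul_right_comm]
    exact abs_iteratedDeriv_two_comp_e_le hR₂ hclosed hc φ
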